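/- **Indistinguishability to eavesdroppers (multi-group private handshake).** *Setting.* Let $\theta:\mathbb N\to\mathbb R$ be a scale. Call $f:\mathbb N\to\mathbb R$ *negligible* if for every $c\in\mathbb N$ we have $\sigma^c|f(\sigma)|<\theta(\sigma)$ for all sufficiently large $\sigma$. (The case $\theta=1$ is the usual notion; for $\theta(\sigma)=2^{-\sigma}$ negligible functions are eventually smaller than $1/2^\sigma$.) A *PPT machine* is a probabilistic random access machine with logarithmic cost, possibly with oracles, whose running time is bounded by a fixed polynomial in the security parameter $\sigma$. For each $\sigma$ let $p$ be a prime whose bit length is bounded by a polynomial in $\sigma$, and let $1\le g<p$. The key length $\kappa$, the secret length $\ell$ and the hash length $\tau$ are polynomials in $\sigma$, and $2^{-\kappa}$ and $2^{-\ell}$ are negligible. The hash functions $h:\{0,\dots,p-1\}\to\{0,1\}^{\kappa}$ and $h_\bullet,h'_\bullet:\{0,1\}^{\kappa}\times\{0,1\}^{\ell}\to\{0,1\}^{\tau}$ are independent random oracles. The *Diffie–Hellman assumption* is that for every PPT machine $B$ the probability that $B$, given $\sigma,p,g,g^a\bmod p,g^b\bmod p$ with $a,b$ independent and uniform in $\{0,\dots,p-2\}$,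 outputs $g^{ab}\bmod p$ is negligible. There are $n$ nodes and $r$ groups, and each node $l$ belongs to a set $\mathcal G_l$ of at most $m$ groups ($n,r,m$ and the sets $\mathcal G_l$ are fixed). Each group has a uniformly random secret in $\{0,1\}^\ell$. Node $l$ stores an array $s_l$ of $m$ cells that holds the secrets of its groups and fresh random values in the remaining cells, in uniformly random order. In a run in which node $u$ plays Alice and node $v$ plays Bob, $u$ picks a random $x$ and sends $g^x\bmod p$, $v$ picks a random $y$ and sends $g^y\bmod p$ (with $x,y$ uniform in $\{0,\dots,p-2\}$), both compute the session key $k=h(g^{xy}\bmod p)$, $u$ sends $h_k(s_u[c])$ for all cells $c$, and $v$ sends $h'_k(s_v[c])$ for all cells $c$. An *eavesdropper* $\mathcal A$ is a PPT machine with access to the random oracles that knows $\sigma,p,g$, the secrets of **all** groups, and the arrays of all nodes in a fixed set of corrupt nodes; the other nodes are honest. It may adaptively make any two honest nodes perform a run of the protocol, as often as its running time allows, and it then receives the complete transcript of the unaltered run. *Statement.* Assume the Diffie–Hellman assumption. Let $i,j$ be honest nodes, let $G$ be a group with $|\mathcal G_i\cup\{G\}|\le m$, and let $\mathcal A$ be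 an eavesdropper. Then: 1. The probability that $\mathcal A$ outputs the number of a run between $i$ and $j$ together with the session key $k$ of that run is negligible in $\sigma$. 2. The keyed hashes look random: the probability that $\mathcal A$ outputs $1$ changes only by a negligible amount if in all runs the keyed hashes that are sent are replaced by independent uniformly random elements of $\{0,1\}^\tau$. 3. The runs reveal nothing about whether $i\in G$: the probabilities that $\mathcal A$ outputs $1$ when $\mathcal G_i$ is replaced by $\mathcal G_i\cup\{G\}$, and when it is replaced by $\mathcal G_i\setminus\{G\}$ (everything else being the same), differ by a negligible amount. This holds although $\mathcal A$ knows the secret of $G$. -/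

import Mathlib

open Filter

namespace PrivateHandshake

/-! ### Probabilistic polynomial-time oracle machines

A random access machine with logarithmic cost: memory consists of arrays of natural numbers, and
every operation is charged the bit length of the numbers that it handles. -/

/-- Memory: `M a i` is the content of cell `i` of array `a`. -/
abbrev Memory : Type := ℕ → ℕ → ℕ

/-- Arithmetic terms: literals, array look-ups, and the operations of `ℕ` (truncated subtraction,
integer division). -/
inductive ATerm : Type
  | lit (n : ℕ)
  | get (a : ℕ) (i : ATerm)
  | add (s t : ATerm)
  | sub (s t : ATerm)
  | mul (s t : ATerm)
  | div (s t : ATerm)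

/-- The value of a term. -/
def ATerm.eval (M : Memory) : ATerm → ℕ
  | .lit n => n
  | .get a i => M a (i.eval M)
  | .add s t => s.eval M + t.eval M
  | .sub s t => s.eval M - t.eval M
  | .mul s t => s.eval M * t.eval M
  | .div s t => s.eval M / t.eval M

/-- The cost of evaluating a term: every node costs one plus the bit length of its value. -/
def ATerm.cost (M : Memory) : ATerm → ℕ
  | .lit n => 1 + n.size
  | .get a i => i.cost M + (1 + (M a (i.eval M)).size)
  | .add s t => s.cost M + t.cost M + (1 + (s.eval M + t.eval M).size)
  | .sub s t => s.cost M + t.cost M + (1 + (s.eval M - t.eval M).size)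
  | .mul s t => s.cost M + t.cost M + (1 + (s.eval M * t.eval M).size)
  | .div s t => s.cost M + t.cost M + (1 + (s.eval M / t.eval M).size)

/-- Programs.
* `store a i e`: put the value of `e` into cell `i` of array `a`;
* `flip a i e`: toss as many fair coins as the value of `e` says, and put the number whose binary
  digits they are into cell `i` of array `a`;
* `call k a e₁ e₂`: send the query `(e₁, e₂)` to the oracle on channel `k`, and write the answer
  (a list of numbers) into array `a`, from cell `0` on;
* `ite e c d`: do `c` if `e ≠ 0`, otherwise `d`;
* `loop e c`: while `e ≠ 0` do `c`. -/
inductive Prog : Type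
  | skip
  | store (a : ℕ) (i e : ATerm)
  | flip (a : ℕ) (i e : ATerm)
  | call (k a : ℕ) (e₁ e₂ : ATerm)
  | seq (c d : Prog)
  | ite (e : ATerm) (c d : Prog)
  | loop (e : ATerm) (c : Prog)

/-- Overwrite one cell. -/
def Memory.write (M : Memory) (a i v : ℕ) : Memory :=
  fun b j => if b = a ∧ j = i then v else M b j

/-- Overwrite the first cells of an array by a list. -/
def Memory.writeList (M : Memory) (a : ℕ) (l : List ℕ) : Memory :=
  fun b j => if b = a then (l[j]?).getD (M b j) else M b j

/-- An oracle with internal states in `S`: from the current state, a channel and the two components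
of a query it produces a new state and an answer. -/
abbrev Oracle (S : Type) : Type := S → ℕ → ℕ → ℕ → S × List ℕ

/-- The oracle that never tells anything. -/
def noOracle : Oracle Unit := fun _ _ _ _ => ((), [])

/-- A configuration: the commands still to be executed, the memory, the number of coins tossed,
the state of the oracle, and the time spent so far. -/
structure Config (S : Type) where
  todo : List Prog
  mem : Memory
  tossed : ℕ
  state : S
  spent : ℕ

/-- The number whose binary digits are the coins `pos, …, pos + len - 1` (least significant digit
first). -/
def coinNumber (coin : ℕ → Bool) (pos len : ℕ) : ℕ :=
  ∑ d ∈ Finset.range len, if coin (pos + d) then 2 ^ d else 0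

/-- The time it takes to receive an answer. -/
def answerCost (l : List ℕ) : ℕ := (l.map fun v => 1 + v.size).sum

/-- One step of execution. A configuration with nothing left to do is final. -/
def step {S : Type} (coin : ℕ → Bool) (O : Oracle S) (c : Config S) : Config S :=
  match c.todo with
  | [] => c
  | .skip :: r => { c with todo := r, spent := c.spent + 1 }
  | .store a i e :: r =>
      { c with
        todo := r
        mem := c.mem.write a (i.eval c.mem) (e.eval c.mem)
        spent := c.spent + (1 + i.cost c.mem + e.cost c.mem) }
  | .flip a i e :: r =>
      { c with
        todo := r
        mem := c.mem.write a (i.eval c.mem) (coinNumber coin c.tossed (e.eval c.mem))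
        tossed := c.tossed + e.eval c.mem
        spent := c.spent + (1 + i.cost c.mem + e.cost c.mem + e.eval c.mem) }
  | .call k a e₁ e₂ :: r =>
      let ans := O c.state k (e₁.eval c.mem) (e₂.eval c.mem)
      { c with
        todo := r
        mem := c.mem.writeList a ans.2
        state := ans.1
        spent := c.spent + (1 + e₁.cost c.mem + e₂.cost c.mem + answerCost ans.2) }
  | .seq p q :: r => { c with todo := p :: q :: r, spent := c.spent + 1 }
  | .ite e p q :: r =>
      { c with
        todo := (if e.eval c.mem ≠ 0 then p else q) :: r
        spent := c.spent + (1 + e.cost c.mem) }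
  | .loop e p :: r =>
      { c with
        todo := if e.eval c.mem ≠ 0 then p :: .loop e p :: r else r
        spent := c.spent + (1 + e.cost c.mem) }

/-- A probabilistic polynomial-time machine: a program with a polynomial clock. With security
parameter `σ` it may spend time `clock.eval σ`. -/
structure PPT where
  prog : Prog
  clock : Polynomial ℕ

/-- The time bound for security parameter `σ`. -/
def PPT.time (A : PPT) (σ : ℕ) : ℕ := A.clock.eval σ

/-- Run a program with time bound `T` on the initial memory `M`, with coin tape `coin`, and with
oracle `O` in the initial state `s`. The result is the final memory and the final state of the
oracle, or `none` if the program does not halt in time. (Every step that is not idle costs at least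
`1`, so a program that halts within time `T` does so within `T` steps.) -/
def runProg {S : Type} (T : ℕ) (P : Prog) (coin : Fin T → Bool) (O : Oracle S) (s : S)
    (M : Memory) : Option (Memory × S) :=
  let tape : ℕ → Bool := fun d => if hd : d < T then coin ⟨d, hd⟩ else false
  let c := (step tape O)^[T] ⟨[P], M, 0, s, 0⟩
  if c.todo.isEmpty ∧ c.spent ≤ T then some (c.mem, c.state) else none

/-! ### Probabilities -/

open Classical in
/-- The probability of the event `E` for a uniformly random element of a finite type. -/
noncomputable def prob (Ω : Type) [Fintype Ω] (E : Ω → Prop) : ℝ :=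
  ((Finset.univ.filter E).card : ℝ) / (Fintype.card Ω : ℝ)

/-- `f` is negligible at scale `θ`: even after multiplication by any fixed power of the security
parameter it is eventually smaller than `θ`. The usual notion is `θ = 1`; for `θ σ = 1 / 2 ^ σ` it
follows that `f σ` is eventually less than `1 / 2 ^ σ`. -/
def Negligible (θ f : ℕ → ℝ) : Prop :=
  ∀ c : ℕ, ∀ᶠ σ : ℕ in atTop, (σ : ℝ) ^ c * |f σ| < θ σ

/-! ### The Diffie-Hellman assumption -/

/-- A prime modulus `p` and a base `g`, invertible modulo `p`; `g` generates a cyclic group of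
residues, in which the key exchange takes place. -/
structure DHGroup where
  p : ℕ
  prime : p.Prime
  g : ℕ
  g_pos : 0 < g
  g_lt : g < p

instance (D : DHGroup) : NeZero D.p := ⟨D.prime.ne_zero⟩

/-- Exponents are residues modulo `p - 1`. -/
abbrev DHGroup.Exponent (D : DHGroup) : Type := Fin (D.p - 1)

/-- The random choices of a Diffie-Hellman challenge and of a solver that tosses at most `T`
coins. -/
abbrev DHSample (D : DHGroup) (T : ℕ) : Type :=
  D.Exponent × D.Exponent × (Fin T → Bool)

/-- The input of a solver: array `0` starts with `σ`, `p`, `g`, `g ^ a mod p`, `g ^ b mod p`. -/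
def dhInput (σ : ℕ) (D : DHGroup) (a b : ℕ) : Memory := fun k i =>
  if k = 0 then (([σ, D.p, D.g, D.g ^ a % D.p, D.g ^ b % D.p] : List ℕ)[i]?).getD 0 else 0

/-- The probability that the solver `B` finds `g ^ (a * b) mod p` (as the first number in array
`0`). -/
noncomputable def dhSuccess (D : ℕ → DHGroup) (B : PPT) (σ : ℕ) : ℝ :=
  prob (DHSample (D σ) (B.time σ)) fun ω =>
    ∃ res, runProg (B.time σ) B.prog ω.2.2 noOracle () (dhInput σ (D σ) ω.1 ω.2.1) = some res ∧
      res.1 0 0 = (D σ).g ^ ((ω.1 : ℕ) * (ω.2.1 : ℕ)) % (D σ).p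

/-- The (computational) Diffie-Hellman assumption at scale `θ` for a family of groups. -/
def DHAssumption (θ : ℕ → ℝ) (D : ℕ → DHGroup) : Prop :=
  ∀ B : PPT, Negligible θ (dhSuccess D B)

/-! ### The multi-group handshake protocol -/

/-- The parameters for one value of the security parameter: the group, and the lengths in bits of
session keys, of group secrets, and of the keyed hashes. -/
structure Params where
  grp : DHGroup
  keyLen : ℕ
  secLen : ℕ
  hashLen : ℕ

abbrev Params.Key (P : Params) : Type := Fin (2 ^ P.keyLen)

abbrev Params.Secret (P : Params) : Type := Fin (2 ^ P.secLen)

abbrev Params.Hash (P : Params) : Type := Fin (2 ^ P.hashLen)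

/-- All random choices in a system of `n` nodes and `r` groups, in which each node has an array of
`m` cells, and in which at most `T` runs take place. -/
structure Sample (P : Params) (n r m T : ℕ) where
  /-- the group secrets -/
  secret : Fin r → P.Secret
  /-- the random values for cells that do not correspond to groups -/
  filler : Fin n → Fin m → P.Secret
  /-- the permutations of the arrays -/
  perm : Fin n → Equiv.Perm (Fin m)
  /-- the exponent of Alice in every run -/
  x : Fin T → P.grp.Exponent
  /-- the exponent of Bob in every run -/
  y : Fin T → P.grp.Exponent
  /-- the random oracle that derives session keys -/
  h : Fin P.grp.p → P.Key
  /-- the keyed random oracle of Alice -/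
  hA : P.Key → P.Secret → P.Hash
  /-- the keyed random oracle of Bob -/
  hB : P.Key → P.Secret → P.Hash
  /-- random values that replace the keyed hashes of Alice in idealised runs -/
  idealA : Fin T → Fin m → P.Hash
  /-- random values that replace the keyed hashes of Bob in idealised runs -/
  idealB : Fin T → Fin m → P.Hash
  /-- the coins of the adversary -/
  coin : Fin T → Bool

/-- The fields of a sample as a tuple. -/
def Sample.toProd {P : Params} {n r m T : ℕ} (ω : Sample P n r m T) :
    ((Fin r → P.Secret) × (Fin n → Fin m → P.Secret) × (Fin n → Equiv.Perm (Fin m))) ×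
    ((Fin T → P.grp.Exponent) × (Fin T → P.grp.Exponent)) ×
    ((Fin P.grp.p → P.Key) × (P.Key → P.Secret → P.Hash) × (P.Key → P.Secret → P.Hash)) ×
    ((Fin T → Fin m → P.Hash) × (Fin T → Fin m → P.Hash) × (Fin T → Bool)) :=
  ⟨⟨ω.secret, ω.filler, ω.perm⟩, ⟨ω.x, ω.y⟩, ⟨ω.h, ω.hA, ω.hB⟩, ⟨ω.idealA, ω.idealB, ω.coin⟩⟩

/-- There are finitely many samples. -/
noncomputable instance (P : Params) (n r m T : ℕ) : Fintype (Sample P n r m T) :=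
  Fintype.ofInjective Sample.toProd (by
    rintro ⟨⟩ ⟨⟩ hω
    simp only [Sample.toProd, Prod.mk.injEq] at hω
    simp only [Sample.mk.injEq]
    tauto)

section Protocol

variable {P : Params} {n r m T : ℕ}

/-- The array of group secrets stored by node `l`: the secrets of the groups to which it belongs,
random values in the remaining cells, all randomly permuted. -/
def Sample.array (ω : Sample P n r m T) (groups : Fin n → Finset (Fin r)) (l : Fin n) (c : Fin m) :
    P.Secret :=
  match ((groups l).sort (· ≤ ·))[((ω.perm l c : Fin m) : ℕ)]? with
  | some G => ω.secret G
  | none => ω.filler l (ω.perm l c)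

/-- The first message of Alice, `g ^ x mod p`. -/
def Sample.msgA (ω : Sample P n r m T) (t : Fin T) : ℕ := P.grp.g ^ (ω.x t : ℕ) % P.grp.p

/-- The first message of Bob, `g ^ y mod p`. -/
def Sample.msgB (ω : Sample P n r m T) (t : Fin T) : ℕ := P.grp.g ^ (ω.y t : ℕ) % P.grp.p

/-- The session key that Alice derives from the message of Bob. -/
def Sample.keyA (ω : Sample P n r m T) (t : Fin T) : P.Key :=
  ω.h (Fin.ofNat P.grp.p (ω.msgB t ^ (ω.x t : ℕ)))

/-- The session key that Bob derives from the message of Alice. -/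
def Sample.keyB (ω : Sample P n r m T) (t : Fin T) : P.Key :=
  ω.h (Fin.ofNat P.grp.p (ω.msgA t ^ (ω.y t : ℕ)))

/-- The transcript of run `t`, in which node `u` plays Alice and node `v` plays Bob: the two
messages of the key exchange, and the keyed hashes of the arrays of both. -/
def Sample.realRun (ω : Sample P n r m T) (groups : Fin n → Finset (Fin r)) (t : Fin T)
    (u v : Fin n) : List ℕ :=
  [ω.msgA t, ω.msgB t]
    ++ List.ofFn (fun c => (ω.hA (ω.keyA t) (ω.array groups u c) : ℕ))
    ++ List.ofFn (fun c => (ω.hB (ω.keyB t) (ω.array groups v c) : ℕ))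

/-- The transcript of an idealised run: the keyed hashes are replaced by random values. -/
def Sample.idealRun (ω : Sample P n r m T) (t : Fin T) : List ℕ :=
  [ω.msgA t, ω.msgB t]
    ++ List.ofFn (fun c => (ω.idealA t c : ℕ))
    ++ List.ofFn (fun c => (ω.idealB t c : ℕ))

/-- The oracle available to an eavesdropper. Its state is the list of the runs that took place (the
pairs Alice, Bob, in order of time).
* Channels `0`, `1`, `2` are the random oracles (arguments are reduced to their domain).
* Channel `3`, with query `(u, v)`, makes the honest nodes `u` and `v` (those outside the set
  `corrupt`) perform a run of the protocol, in which no message is altered; the answer is the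
  transcript `transcript t u v`, where `t` is the number of earlier runs. -/
def Sample.oracle (ω : Sample P n r m T) (corrupt : Finset (Fin n))
    (transcript : Fin T → Fin n → Fin n → List ℕ) : Oracle (List (Fin n × Fin n)) :=
  fun runs k v₁ v₂ =>
    match k with
    | 0 => (runs, [(ω.h (Fin.ofNat P.grp.p v₁) : ℕ)])
    | 1 => (runs, [(ω.hA (Fin.ofNat _ v₁) (Fin.ofNat _ v₂) : ℕ)])
    | 2 => (runs, [(ω.hB (Fin.ofNat _ v₁) (Fin.ofNat _ v₂) : ℕ)])
    | 3 =>
      if hq : v₁ < n ∧ v₂ < n ∧ runs.length < T then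
        let u : Fin n := ⟨v₁, hq.1⟩
        let v : Fin n := ⟨v₂, hq.2.1⟩
        if u ∉ corrupt ∧ v ∉ corrupt then
          (runs ++ [(u, v)], transcript ⟨runs.length, hq.2.2⟩ u v)
        else (runs, [])
      else (runs, [])
    | _ => (runs, [])

/-- What the eavesdropper knows at the start. Array `0` starts with `σ`, `p`, `g`; array `1` holds
the secrets of all groups; array `2 + l` is the array stored by node `l`, if `l` is corrupt. -/
def Sample.knowledge (ω : Sample P n r m T) (σ : ℕ) (groups : Fin n → Finset (Fin r))
    (corrupt : Finset (Fin n)) : Memory := fun a i =>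
  match a with
  | 0 => (([σ, P.grp.p, P.grp.g] : List ℕ)[i]?).getD 0
  | 1 => if hi : i < r then (ω.secret ⟨i, hi⟩ : ℕ) else 0
  | l + 2 =>
    if hl : l < n ∧ i < m then
      if (⟨l, hl.1⟩ : Fin n) ∈ corrupt then (ω.array groups ⟨l, hl.1⟩ ⟨i, hl.2⟩ : ℕ) else 0
    else 0

end Protocol

/-- The handshake scheme: a family of groups, and polynomials that give the lengths of session keys,
group secrets and keyed hashes. -/
structure Scheme where
  grp : ℕ → DHGroup
  keyLen : Polynomial ℕ
  secLen : Polynomial ℕ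
  hashLen : Polynomial ℕ

/-- The parameters for security parameter `σ`. -/
def Scheme.params (𝒮 : Scheme) (σ : ℕ) : Params :=
  ⟨𝒮.grp σ, 𝒮.keyLen.eval σ, 𝒮.secLen.eval σ, 𝒮.hashLen.eval σ⟩

section Experiments

variable {n r : ℕ} (𝒮 : Scheme) (m : ℕ) (groups : Fin n → Finset (Fin r))
  (corrupt : Finset (Fin n)) (A : PPT) (σ : ℕ)

/-- The random choices of an experiment with the eavesdropper `A`. -/
abbrev ExpSample (𝒮 : Scheme) (n r m : ℕ) (A : PPT) (σ : ℕ) : Type :=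
  Sample (𝒮.params σ) n r m (A.time σ)

/-- `A` eavesdrops on runs of the protocol. -/
def realExp (ω : ExpSample 𝒮 n r m A σ) : Option (Memory × List (Fin n × Fin n)) :=
  runProg (A.time σ) A.prog ω.coin (ω.oracle corrupt (ω.realRun groups)) []
    (ω.knowledge σ groups corrupt)

/-- `A` eavesdrops on idealised runs. -/
def idealExp (ω : ExpSample 𝒮 n r m A σ) : Option (Memory × List (Fin n × Fin n)) :=
  runProg (A.time σ) A.prog ω.coin (ω.oracle corrupt (fun t _ _ => ω.idealRun t)) []
    (ω.knowledge σ groups corrupt)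

/-- The probability that `A`, eavesdropping on runs of the protocol, outputs `1`. -/
noncomputable def realAccept : ℝ :=
  prob (ExpSample 𝒮 n r m A σ) fun ω =>
    ∃ res, realExp 𝒮 m groups corrupt A σ ω = some res ∧ res.1 0 0 = 1

/-- The probability that `A`, eavesdropping on idealised runs, outputs `1`. -/
noncomputable def idealAccept : ℝ :=
  prob (ExpSample 𝒮 n r m A σ) fun ω =>
    ∃ res, idealExp 𝒮 m groups corrupt A σ ω = some res ∧ res.1 0 0 = 1

/-- The probability that `A`, eavesdropping on runs of the protocol, outputs the number `t` of a run
between `i` and `j` (in either order) together with the session key of that run. -/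
noncomputable def keySuccess (i j : Fin n) : ℝ :=
  prob (ExpSample 𝒮 n r m A σ) fun ω =>
    ∃ res, realExp 𝒮 m groups corrupt A σ ω = some res ∧
      ∃ t : Fin (A.time σ), res.1 0 0 = t ∧
        (res.2[(t : ℕ)]? = some (i, j) ∨ res.2[(t : ℕ)]? = some (j, i)) ∧
        (res.1 0 1 = ω.keyA t ∨ res.1 0 1 = ω.keyB t)

end Experiments

end PrivateHandshake

/-! In an idealised run the transcript consists of `g ^ x`, `g ^ y` and fresh random values. It says
nothing about the groups of the nodes, and the initial knowledge only involves the arrays of corrupt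
nodes (`idealAccept_congr`). So the third claim follows from the second by a triangle inequality,
and the first two claims amount to comparing real and idealised runs.

The comparison is one measure-preserving exchange instead of a chain of hybrids. `Sample.swapRuns`
exchanges the values of the keyed oracles at the points (session key, stored value) that occur in
the runs for the ideal hashes. If these points are pairwise distinct, and the eavesdropper on
idealised runs never queries a keyed oracle at a session key, the exchange turns the idealised
execution into an identical real one (`Sample.realFin_swapRuns`). Since the exchange can be undone,
an event outside the bad cases is at most as likely in the idealised game as in the real one
(`prob_ideal_le_prob_real`); applying this to complements as well gives both directions.

What remains is the event `Sample.Compromised` in the idealised game: `h` is evaluated at a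
Diffie-Hellman secret, or a session key is guessed without that, or two session keys agree, or two
stored values agree. A key whose secret was not asked is uniform given the view of the eavesdropper.
Two Diffie-Hellman secrets agree at most as often as one of them is `1`, and the solver that always
answers `1` makes this negligible. Stored values collide with probability of order `2 ^ (-secLen)`.

The first event needs a genuine reduction. A solver simulates the eavesdropper on idealised runs,
for which it needs powers of `g` but no exponents. It puts its challenge into a guessed run, samples
the oracles lazily, and stops with the argument of `h` at a guessed position in the list of new
points. With time bound `T` the two guesses cost a factor `(T + 1) ^ 2`, the reduction of coins to
nearly uniform values costs a factor `2`, and the finitely many array permutations are hard-wired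
into separate solvers whose success probabilities are added (`prob_askedDH_le`).

Most of the length is the verification of this solver as a program: `Does` is a program logic with
time bounds, `Sim` is the simulation invariant, and `solver_finds` is the resulting correctness
statement. -/

namespace PrivateHandshake

/-! ### Runs that stop at the time limit -/

section Machine

variable {S : Type}

/-- The time spent after the next step if the answer of the oracle is not charged. -/
def Config.due (c : Config S) : ℕ :=
  match c.todo with
  | [] => c.spent
  | .skip :: _ => c.spent + 1
  | .store _ i e :: _ => c.spent + (1 + i.cost c.mem + e.cost c.mem)
  | .flip _ i e :: _ => c.spent + (1 + i.cost c.mem + e.cost c.mem + e.eval c.mem)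
  | .call _ _ e₁ e₂ :: _ => c.spent + (1 + e₁.cost c.mem + e₂.cost c.mem)
  | .seq _ _ :: _ => c.spent + 1
  | .ite e _ _ :: _ => c.spent + (1 + e.cost c.mem)
  | .loop e _ :: _ => c.spent + (1 + e.cost c.mem)

/-- A step of execution that is taken only if there is time left for it. -/
def stepT (T : ℕ) (coin : ℕ → Bool) (O : Oracle S) (c : Config S) : Config S :=
  if c.due ≤ T then step coin O c else c

/-- The query that the next step sends to the oracle. -/
def Config.query (c : Config S) : Option (ℕ × ℕ × ℕ) :=
  match c.todo with
  | .call k _ e₁ e₂ :: _ => some (k, e₁.eval c.mem, e₂.eval c.mem)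
  | _ => none

theorem Config.spent_le_due (c : Config S) : c.spent ≤ c.due := by
  unfold Config.due; split <;> omega

theorem Config.spent_lt_due (c : Config S) (h : c.todo ≠ []) : c.spent < c.due := by
  unfold Config.due; split <;> first | contradiction | omega

theorem Config.due_le_spent_step (coin : ℕ → Bool) (O : Oracle S) (c : Config S) :
    c.due ≤ (step coin O c).spent := by
  unfold Config.due step
  rcases c with ⟨_ | ⟨p, r⟩, M, k, s, t⟩
  · simp
  · cases p <;> simp

theorem step_of_todo_nil (coin : ℕ → Bool) (O : Oracle S) (c : Config S) (h : c.todo = []) :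
    step coin O c = c := by
  unfold step; rw [h]

theorem iterate_step_of_todo_nil (coin : ℕ → Bool) (O : Oracle S) (c : Config S) (h : c.todo = [])
    (N : ℕ) : (step coin O)^[N] c = c :=
  Function.iterate_fixed (step_of_todo_nil coin O c h) N

theorem step_congr (coin : ℕ → Bool) (O O' : Oracle S) (c : Config S)
    (h : ∀ q ∈ c.query, O c.state q.1 q.2.1 q.2.2 = O' c.state q.1 q.2.1 q.2.2) :
    step coin O c = step coin O' c := by
  rcases c with ⟨_ | ⟨p, r⟩, M, k, s, t⟩
  · rfl
  · cases p <;> try rfl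
    simp only [Config.query, Option.mem_def, Option.some.injEq, forall_eq'] at h
    simp only [step, h]

theorem stepT_congr (T : ℕ) (coin : ℕ → Bool) (O O' : Oracle S) (c : Config S)
    (h : c.due ≤ T → ∀ q ∈ c.query, O c.state q.1 q.2.1 q.2.2 = O' c.state q.1 q.2.1 q.2.2) :
    stepT T coin O c = stepT T coin O' c := by
  unfold stepT
  split_ifs with hc
  · exact step_congr _ _ _ _ (h hc)
  · rfl

theorem spent_le_step (coin : ℕ → Bool) (O : Oracle S) (c : Config S) :
    c.spent ≤ (step coin O c).spent :=
  c.spent_le_due.trans (c.due_le_spent_step coin O)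

/-- The two computations coincide until a step comes whose foreseeable cost exceeds the remaining
time. From then on the truncated one stands still and the other has overspent for good, so neither
counts as halting. The alternative `T < spent` covers an empty command list after an expensive
oracle answer, which `due` does not include. -/
theorem stepT_iterate_or (T : ℕ) (coin : ℕ → Bool) (O : Oracle S) (c : Config S) (N : ℕ) :
    (stepT T coin O)^[N] c = (step coin O)^[N] c ∨
      (((stepT T coin O)^[N] c).todo ≠ [] ∨ T < ((stepT T coin O)^[N] c).spent) ∧
      T < ((stepT T coin O)^[N] c).due ∧ T < ((step coin O)^[N] c).spent := by
  induction N with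
  | zero => exact Or.inl rfl
  | succ N ih =>
    simp only [Function.iterate_succ_apply']
    set d := (stepT T coin O)^[N] c
    rcases ih with ih | ⟨h1, h2, h3⟩
    · rw [← ih]
      by_cases hd : d.due ≤ T
      · left; simp [stepT, hd]
      · right
        have : stepT T coin O d = d := by simp [stepT, hd]
        rw [this]
        refine ⟨?_, by omega, by have := d.due_le_spent_step coin O; omega⟩
        by_cases hn : d.todo = []
        · right; simpa [Config.due, hn] using hd
        · exact Or.inl hn
    · right
      have : stepT T coin O d = d := by simp [stepT, h2]
      rw [this]
      exact ⟨h1, h2, lt_of_lt_of_le h3 (spent_le_step _ _ _)⟩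

/-- A coin tape of finite length, continued by `false`. -/
def extendTape {T : ℕ} (coin : Fin T → Bool) (d : ℕ) : Bool :=
  if hd : d < T then coin ⟨d, hd⟩ else false

/-- After truncation every query that is really sent is affordable, so its arguments have fewer than
`T` bits, and whether it is sent is decided before the answer is known. The simulation needs the
first property, lazy sampling the second. -/
theorem runProg_eq_stepT (T : ℕ) (P : Prog) (coin : Fin T → Bool) (O : Oracle S) (s : S)
    (M : Memory) :
    runProg T P coin O s M =
      let c := (stepT T (extendTape coin) O)^[T] ⟨[P], M, 0, s, 0⟩
      if c.todo.isEmpty ∧ c.spent ≤ T then some (c.mem, c.state) else none := by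
  have key := stepT_iterate_or T (extendTape coin) O ⟨[P], M, 0, s, 0⟩ T
  unfold runProg
  change (let c := (step (extendTape coin) O)^[T] ⟨[P], M, 0, s, 0⟩
      if c.todo.isEmpty ∧ c.spent ≤ T then some (c.mem, c.state) else none) = _
  rcases key with key | ⟨h1, -, h3⟩
  · rw [key]
  · dsimp only
    rw [if_neg (by omega), if_neg]
    simp only [List.isEmpty_iff, not_and, not_le]
    intro h
    rcases h1 with h1 | h1
    · exact absurd h h1
    · exact h1

/-- Each coin costs one unit of time, so an affordable `flip` only reads coins with index below `T`.
The solver can therefore provide them from a block of its own tape. -/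
theorem tossed_le_spent_step (coin : ℕ → Bool) (O : Oracle S) (c : Config S)
    (h : c.tossed ≤ c.spent) : (step coin O c).tossed ≤ (step coin O c).spent := by
  rcases c with ⟨_ | ⟨p, r⟩, M, k, s, t⟩
  · exact h
  · cases p <;> simp only [step] at * <;> omega

theorem tossed_le_spent_stepT (T : ℕ) (coin : ℕ → Bool) (O : Oracle S) (c : Config S)
    (h : c.tossed ≤ c.spent) : (stepT T coin O c).tossed ≤ (stepT T coin O c).spent := by
  unfold stepT
  split_ifs
  · exact tossed_le_spent_step _ _ _ h
  · exact h

theorem lt_spent_step {coin : ℕ → Bool} {O : Oracle S} {c : Config S} (h : c.todo ≠ []) :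
    c.spent < (step coin O c).spent :=
  (c.spent_lt_due h).trans_le (c.due_le_spent_step coin O)

theorem le_spent_iterate (coin : ℕ → Bool) (O : Oracle S) (c : Config S) (N : ℕ) :
    ((step coin O)^[N] c).todo = [] ∨ c.spent + N ≤ ((step coin O)^[N] c).spent := by
  induction N with
  | zero => right; simp
  | succ N ih =>
    simp only [Function.iterate_succ_apply']
    by_cases h : ((step coin O)^[N] c).todo = []
    · left; rwa [step_of_todo_nil _ _ _ h]
    · right
      have := lt_spent_step (coin := coin) (O := O) h
      rcases ih with ih | ih
      · exact absurd ih h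
      · omega

/-- A program that reaches the end within the time bound, in any number of steps, halts. -/
theorem runProg_of_iterate {T : ℕ} {P : Prog} {coin : Fin T → Bool} {O : Oracle S} {s s' : S}
    {M M' : Memory} {N k t : ℕ}
    (h : (step (extendTape coin) O)^[N] ⟨[P], M, 0, s, 0⟩ = ⟨[], M', k, s', t⟩) (ht : t ≤ T) :
    runProg T P coin O s M = some (M', s') := by
  have key : (step (extendTape coin) O)^[T] ⟨[P], M, 0, s, 0⟩ = ⟨[], M', k, s', t⟩ := by
    rcases le_total N T with hN | hN
    · obtain ⟨d, rfl⟩ := Nat.exists_eq_add_of_le' hN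
      rw [Function.iterate_add_apply, h]
      exact iterate_step_of_todo_nil _ _ _ rfl _
    · obtain ⟨d, rfl⟩ := Nat.exists_eq_add_of_le' hN
      rw [Function.iterate_add_apply] at h
      set c := (step (extendTape coin) O)^[T] ⟨[P], M, 0, s, 0⟩ with hc
      by_cases hn : c.todo = []
      · rwa [iterate_step_of_todo_nil _ _ _ hn] at h
      -- A run that is unfinished after `T` steps has spent at least `T`; one more step takes the
      -- total above `T`, whereas the run ends with `t ≤ T`.
      · rcases le_spent_iterate (extendTape coin) O ⟨[P], M, 0, s, 0⟩ T with h1 | h1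
        · exact absurd h1 hn
        · simp only [← hc] at h1
          cases d with
          | zero => exact h
          | succ d =>
            rw [Function.iterate_succ_apply] at h
            have h2 := lt_spent_step (coin := extendTape coin) (O := O) hn
            have h3 : ∀ (N : ℕ) (c : Config S),
                c.spent ≤ ((step (extendTape coin) O)^[N] c).spent := by
              intro N
              induction N with
              | zero => intro c; exact le_rfl
              | succ N ih =>
                intro c
                rw [Function.iterate_succ_apply]
                exact (spent_le_step _ _ _).trans (ih _)
            have h4 := h3 d (step (extendTape coin) O c)
            rw [h] at h4
            simp only at h4
            omega
  unfold runProg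
  change (let c := (step (extendTape coin) O)^[T] ⟨[P], M, 0, s, 0⟩
      if c.todo.isEmpty ∧ c.spent ≤ T then some (c.mem, c.state) else none) = _
  rw [key]
  simp [ht]

end Machine

/-! ### Counting probabilities -/

section Prob

open Classical in
theorem prob_eq_sum (Ω : Type) [Fintype Ω] (E : Ω → Prop) :
    prob Ω E = (∑ ω, if E ω then (1 : ℝ) else 0) / Fintype.card Ω := by
  unfold prob
  congr 1
  rw [Finset.card_filter]
  push_cast
  rfl

theorem prob_nonneg {Ω : Type} [Fintype Ω] (E : Ω → Prop) : 0 ≤ prob Ω E := by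
  unfold prob; positivity

theorem prob_mono {Ω : Type} [Fintype Ω] {E E' : Ω → Prop} (h : ∀ ω, E ω → E' ω) :
    prob Ω E ≤ prob Ω E' := by
  classical
  unfold prob
  gcongr
  intro h'
  exact h _ h'

theorem prob_congr {Ω : Type} [Fintype Ω] {E E' : Ω → Prop} (h : ∀ ω, E ω ↔ E' ω) :
    prob Ω E = prob Ω E' :=
  le_antisymm (prob_mono fun ω => (h ω).1) (prob_mono fun ω => (h ω).2)

theorem prob_or_le {Ω : Type} [Fintype Ω] (E E' : Ω → Prop) :
    prob Ω (fun ω => E ω ∨ E' ω) ≤ prob Ω E + prob Ω E' := by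
  classical
  simp only [prob_eq_sum, ← add_div, ← Finset.sum_add_distrib]
  gcongr with ω
  split_ifs <;> simp_all

theorem prob_exists_le {Ω ι : Type} [Fintype Ω] (s : Finset ι) (E : ι → Ω → Prop) :
    prob Ω (fun ω => ∃ a ∈ s, E a ω) ≤ ∑ a ∈ s, prob Ω (E a) := by
  classical
  induction s using Finset.induction_on with
  | empty => simp [prob]
  | insert a s ha ih =>
    rw [Finset.sum_insert ha]
    refine (prob_mono (E' := fun ω => E a ω ∨ ∃ b ∈ s, E b ω) ?_).trans
      ((prob_or_le _ _).trans (by gcongr))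
    intro ω
    simp

theorem prob_exists_le_card_mul {Ω ι : Type} [Fintype Ω] [Fintype ι] (E : ι → Ω → Prop) (ε : ℝ)
    (h : ∀ a, prob Ω (E a) ≤ ε) : prob Ω (fun ω => ∃ a, E a ω) ≤ Fintype.card ι * ε := by
  refine (prob_mono (E' := fun ω => ∃ a ∈ Finset.univ, E a ω) (by simp)).trans
    ((prob_exists_le _ _).trans ((Finset.sum_le_sum fun a _ => h a).trans ?_))
  simp [Finset.card_univ]

theorem prob_not {Ω : Type} [Fintype Ω] [Nonempty Ω] (E : Ω → Prop) :
    prob Ω (fun ω => ¬ E ω) = 1 - prob Ω E := by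
  classical
  have h : ((Finset.univ.filter E).card : ℝ) + (Finset.univ.filter fun ω => ¬ E ω).card
      = Fintype.card Ω := by
    exact_mod_cast (Finset.card_filter_add_card_filter_not (s := Finset.univ) E)
  have h0 : (Fintype.card Ω : ℝ) ≠ 0 := by simp
  unfold prob
  rw [eq_sub_iff_add_eq, ← add_div, add_comm, div_eq_one_iff_eq h0]
  convert h

theorem prob_equiv {Ω Ω' : Type} [Fintype Ω] [Fintype Ω'] (e : Ω ≃ Ω') (E : Ω' → Prop) :
    prob Ω (fun ω => E (e ω)) = prob Ω' E := by
  classical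
  rw [prob_eq_sum, prob_eq_sum, Fintype.card_congr e]
  congr 1
  exact Equiv.sum_comp e (fun ω => if E ω then (1 : ℝ) else 0)

/-- An injection on a part of the space does not increase the number of samples. -/
theorem prob_le_of_leftInverse {Ω : Type} [Fintype Ω] {E E' : Ω → Prop} (Ψ Θ : Ω → Ω)
    (hE : ∀ ω, E ω → E' (Ψ ω)) (hΘ : ∀ ω, E ω → Θ (Ψ ω) = ω) : prob Ω E ≤ prob Ω E' := by
  classical
  unfold prob
  refine div_le_div_of_nonneg_right (Nat.cast_le.2 ?_) (Nat.cast_nonneg _)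
  refine Finset.card_le_card_of_injOn Ψ (fun ω hω => ?_) (fun ω hω ω' hω' h => ?_)
  · simpa using hE ω (by simpa using hω)
  · rw [← hΘ ω (by simpa using hω), ← hΘ ω' (by simpa using hω'), h]

/-- A component of a sample that can be read and overwritten. -/
structure Lens (Ω V : Type) where
  get : Ω → V
  set : Ω → V → Ω
  get_set : ∀ ω v, get (set ω v) = v
  set_get : ∀ ω, set ω (get ω) = ω
  set_set : ∀ ω v w, set (set ω v) w = set ω w

/-- Exchange the component for a new value. -/
def Lens.swap {Ω V : Type} (l : Lens Ω V) : Ω × V ≃ Ω × V where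
  toFun a := (l.set a.1 a.2, l.get a.1)
  invFun a := (l.set a.1 a.2, l.get a.1)
  left_inv a := by simp [l.set_set, l.set_get, l.get_set]
  right_inv a := by simp [l.set_set, l.set_get, l.get_set]

theorem prob_prod {Ω V : Type} [Fintype Ω] [Fintype V] (E : Ω × V → Prop) :
    prob (Ω × V) E = (∑ ω, prob V (fun v => E (ω, v))) / Fintype.card Ω := by
  simp only [prob_eq_sum, Fintype.sum_prod_type, Fintype.card_prod]
  rw [← Finset.sum_div, div_div, Nat.cast_mul, mul_comm (Fintype.card Ω : ℝ)]

theorem prob_const {V : Type} [Fintype V] [Nonempty V] (p : Prop) [Decidable p] :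
    prob V (fun _ => p) = if p then 1 else 0 := by
  classical
  unfold prob
  split_ifs with h <;> simp [h, Finset.card_univ]

theorem prob_fst {Ω V : Type} [Fintype Ω] [Fintype V] [Nonempty V] (E : Ω → Prop) :
    prob (Ω × V) (fun a => E a.1) = prob Ω E := by
  classical
  rw [prob_prod, prob_eq_sum]
  simp only [prob_const]

theorem prob_snd {Ω V : Type} [Fintype Ω] [Fintype V] [Nonempty V] (E : Ω → Prop) :
    prob (V × Ω) (fun a => E a.2) = prob Ω E := by
  rw [← prob_equiv (Equiv.prodComm Ω V)]
  exact prob_fst E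

theorem prob_prod_le {Ω Ω' V : Type} [Fintype Ω] [Fintype Ω'] [Fintype V]
    {E : Ω × V → Prop} {E' : Ω × Ω' → Prop}
    (h : ∀ ω, prob V (fun v => E (ω, v)) ≤ prob Ω' (fun v => E' (ω, v))) :
    prob (Ω × V) E ≤ prob (Ω × Ω') E' := by
  classical
  rw [prob_prod, prob_prod]
  gcongr with ω
  exact h ω

/-- The probability that a pair lies in `E` is at most the greatest conditional probability. -/
theorem prob_prod_le_const {Ω V : Type} [Fintype Ω] [Fintype V] {E : Ω × V → Prop} {ε : ℝ}
    (hε : 0 ≤ ε) (h : ∀ ω, prob V (fun v => E (ω, v)) ≤ ε) : prob (Ω × V) E ≤ ε := by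
  classical
  rw [prob_prod]
  refine div_le_of_le_mul₀ (by positivity) hε ((Finset.sum_le_sum fun ω _ => h ω).trans ?_)
  simp [mul_comm]

/-- `Lens.swap` is a bijection of `Ω × V` that trades the component for an independent uniform
value, so overwriting the component by such a value does not change the distribution. -/
theorem Lens.prob_eq {Ω V : Type} [Fintype Ω] [Fintype V] [Nonempty V] (l : Lens Ω V)
    (E : Ω → Prop) : prob Ω E = prob (Ω × V) (fun a => E (l.set a.1 a.2)) := by
  rw [← prob_fst (V := V) E]
  exact (prob_equiv l.swap (fun a : Ω × V => E a.1)).symm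

theorem Lens.prob_get {Ω V : Type} [Fintype Ω] [Nonempty Ω] [Fintype V] [Nonempty V]
    (l : Lens Ω V) (E : V → Prop) : prob Ω (fun ω => E (l.get ω)) = prob V E := by
  rw [l.prob_eq]
  simp only [l.get_set]
  exact prob_snd E

/-- Resampling one component. -/
theorem Lens.prob_le {Ω V : Type} [Fintype Ω] [Fintype V] [Nonempty V] (l : Lens Ω V)
    {E : Ω → Prop} {ε : ℝ} (hε : 0 ≤ ε) (h : ∀ ω, prob V (fun v => E (l.set ω v)) ≤ ε) :
    prob Ω E ≤ ε := by
  rw [l.prob_eq]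
  exact prob_prod_le_const hε h

theorem Lens.prob_le_prob {Ω V : Type} [Fintype Ω] [Fintype V] [Nonempty V] (l : Lens Ω V)
    {E E' : Ω → Prop}
    (h : ∀ ω, prob V (fun v => E (l.set ω v)) ≤ prob V (fun v => E' (l.set ω v))) :
    prob Ω E ≤ prob Ω E' := by
  rw [l.prob_eq E, l.prob_eq E']
  exact prob_prod_le h

theorem prob_le_of_subset {V : Type} [Fintype V] (s : Finset V) {E : V → Prop}
    (h : ∀ v, E v → v ∈ s) : prob V E ≤ s.card / Fintype.card V := by
  classical
  unfold prob
  gcongr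
  intro v hv
  exact h v (by simpa using hv)

theorem prob_eq_le {V : Type} [Fintype V] (a : V) : prob V (fun v => v = a) ≤ 1 / Fintype.card V := by
  simpa using prob_le_of_subset {a} (E := fun v => v = a) (by simp)

theorem le_prob_of_exists {V : Type} [Fintype V] {E : V → Prop} (h : ∃ v, E v) :
    1 / (Fintype.card V : ℝ) ≤ prob V E := by
  classical
  obtain ⟨v, hv⟩ := h
  unfold prob
  gcongr
  exact_mod_cast Finset.card_pos.2 ⟨v, by simpa using hv⟩

/-- Guessing the value of a component for which `E` holds. -/
theorem Lens.prob_exists_le {Ω V : Type} [Fintype Ω] [Fintype V] [Nonempty V] (l : Lens Ω V)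
    (E : Ω → Prop) :
    prob Ω (fun ω => ∃ v, E (l.set ω v)) ≤ Fintype.card V * prob Ω E := by
  classical
  rw [l.prob_eq E]
  rw [prob_prod, prob_eq_sum, ← mul_div_assoc, Finset.mul_sum]
  gcongr with ω
  -- If some value makes `E` true, then a uniform value does so with probability at least `1 / card
  -- V`.
  split_ifs with h
  · have := le_prob_of_exists h
    have h0 : (0 : ℝ) < Fintype.card V := by exact_mod_cast Fintype.card_pos
    rwa [div_le_iff₀' h0] at this
  · exact mul_nonneg (by positivity) (prob_nonneg _)

/-- The images of independent uniform values under maps that hit every value about equally often. -/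
theorem half_prob_le_prob_pi {ι : Type} [Fintype ι] {A : Type} [Fintype A] {B : ι → Type}
    [∀ a, Fintype (B a)] [DecidableEq ι]
    (f : ∀ a, A → B a) (ε : ℝ) (hε : Fintype.card ι * ε ≤ 1 / 2) (hε1 : ε ≤ 1)
    (hf : ∀ a b, (1 - ε) / Fintype.card (B a) ≤ prob A (fun x => f a x = b))
    (E : (∀ a, B a) → Prop) :
    1 / 2 * prob (∀ a, B a) E ≤ prob (ι → A) (fun x => E fun a => f a (x a)) := by
  classical
  -- Every point of the target gets at least half of its uniform weight: by independence the weight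
  -- is a product over the coordinates, and Bernoulli's inequality bounds `(1 - ε) ^ card ι` below
  -- by `1 - card ι * ε ≥ 1 / 2`.
  have fib : ∀ y : ∀ a, B a, (1 / 2 : ℝ) / Fintype.card (∀ a, B a)
      ≤ prob (ι → A) (fun x => (fun a => f a (x a)) = y) := by
    intro y
    have h1 : prob (ι → A) (fun x => (fun a => f a (x a)) = y)
        = ∏ a, prob A (fun x => f a x = y a) := by
      unfold prob
      rw [Finset.prod_div_distrib]
      congr 1
      · rw [← Nat.cast_prod, ← Fintype.card_piFinset]
        congr 2
        ext x
        simp [Fintype.mem_piFinset, funext_iff]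
      · simp
    have h2 : ∏ a, ((1 - ε) / (Fintype.card (B a) : ℝ)) ≤ ∏ a, prob A (fun x => f a x = y a) :=
      Finset.prod_le_prod (fun a _ => div_nonneg (by linarith) (by positivity))
        fun a _ => hf a (y a)
    rw [h1]
    refine le_trans ?_ h2
    rw [Finset.prod_div_distrib, Finset.prod_const, Finset.card_univ, Fintype.card_pi, Nat.cast_prod]
    gcongr
    have := one_add_mul_le_pow (a := -ε) (by linarith) (Fintype.card ι)
    calc (1 / 2 : ℝ) ≤ 1 + Fintype.card ι * (-ε) := by linarith
      _ ≤ (1 - ε) ^ Fintype.card ι := by rw [sub_eq_add_neg]; exact this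
  have h3 : prob (ι → A) (fun x => E fun a => f a (x a))
      = ∑ y, if E y then prob (ι → A) (fun x => (fun a => f a (x a)) = y) else 0 := by
    simp only [prob_eq_sum]
    rw [← Finset.sum_filter (s := Finset.univ) (p := E), ← Finset.sum_div, Finset.sum_comm]
    congr 1
    refine Finset.sum_congr rfl fun x _ => ?_
    by_cases h : E fun a => f a (x a)
    · rw [if_pos h, Finset.sum_eq_single_of_mem (fun a => f a (x a)) (by simpa using h)]
      · simp
      · intro y _ hy
        exact if_neg (Ne.symm hy)
    · rw [if_neg h, Finset.sum_eq_zero]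
      intro y hy
      apply if_neg
      rintro rfl
      exact h (by simpa using hy)
  rw [h3, prob_eq_sum, mul_div_assoc', Finset.mul_sum, Finset.sum_div]
  refine Finset.sum_le_sum fun y _ => ?_
  split_ifs
  · simpa using fib y
  · simp

/-- Reducing a uniform number of many bits. -/
theorem prob_mod_ge (W M : ℕ) [NeZero M] (b : Fin M) :
    (1 - M / 2 ^ W : ℝ) / M ≤ prob (Fin (2 ^ W)) (fun x => Fin.ofNat M x = b) := by
  classical
  have hM : 0 < M := Nat.pos_of_ne_zero (NeZero.ne M)
  -- The numbers `q * M + b` with `q` below the integer quotient are in range and reduce to `b`;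
  -- only the incomplete last block may miss `b`.
  have h1 : 2 ^ W / M ≤ (Finset.univ.filter fun x : Fin (2 ^ W) => Fin.ofNat M x = b).card := by
    calc 2 ^ W / M = (Finset.univ : Finset (Fin (2 ^ W / M))).card := by simp
      _ ≤ _ := by
        have hlt : ∀ q : Fin (2 ^ W / M), (q : ℕ) * M + b < 2 ^ W := by
          intro q
          calc (q : ℕ) * M + b < (q : ℕ) * M + M := by have := b.2; omega
            _ = (q + 1) * M := by ring
            _ ≤ (2 ^ W / M) * M := by gcongr; exact q.2
            _ ≤ 2 ^ W := Nat.div_mul_le_self _ _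
        refine Finset.card_le_card_of_injOn (fun q => ⟨q * M + b, hlt q⟩) ?_ ?_
        · intro q _
          simp only [Finset.coe_filter, Set.mem_ofPred_eq, Finset.mem_univ, true_and]
          apply Fin.ext
          simp [Fin.ofNat, Nat.add_mod, Nat.mod_eq_of_lt b.2]
        · intro q _ q' _ h
          simp only [Fin.mk.injEq, add_left_inj] at h
          exact Fin.ext (Nat.eq_of_mul_eq_mul_right hM h)
  have h2 : (2 ^ W : ℝ) / M - 1 ≤ ((2 ^ W / M : ℕ) : ℝ) := by
    have h3 : 2 ^ W < (2 ^ W / M + 1) * M := by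
      have := Nat.lt_mul_div_succ (2 ^ W) hM
      rwa [mul_comm] at this
    have h3' : (2 ^ W : ℝ) < (((2 ^ W / M : ℕ) : ℝ) + 1) * M := by exact_mod_cast h3
    have h4 : (2 ^ W : ℝ) / M < ((2 ^ W / M : ℕ) : ℝ) + 1 := by
      rw [div_lt_iff₀ (by exact_mod_cast hM)]; exact h3'
    linarith
  have h5 : (2 ^ W / M : ℕ) ≤
    ((Finset.univ.filter fun x : Fin (2 ^ W) => Fin.ofNat M x = b).card : ℝ) := by
    exact_mod_cast h1
  unfold prob
  rw [Fintype.card_fin]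
  push_cast
  have hM' : (0 : ℝ) < M := by exact_mod_cast hM
  have hW : (0 : ℝ) < 2 ^ W := by positivity
  rw [div_le_div_iff₀ hM' hW]
  have : (1 - M / 2 ^ W : ℝ) * 2 ^ W = ((2 ^ W : ℝ) / M - 1) * M := by field_simp
  rw [this]
  refine mul_le_mul_of_nonneg_right (h2.trans (h5.trans (le_of_eq ?_))) hM'.le
  congr!

end Prob

/-! ### Negligible functions -/

section Negligible

variable {θ f f' : ℕ → ℝ}

theorem Negligible.of_le {F : ℕ → ℝ} (hF : Negligible θ F) (h : ∀ σ, |f σ| ≤ F σ) :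
    Negligible θ f := by
  intro c
  filter_upwards [hF c] with σ hσ
  exact lt_of_le_of_lt
    (mul_le_mul_of_nonneg_left ((h σ).trans (le_abs_self _)) (by positivity)) hσ

theorem Negligible.pow_mul (hf : Negligible θ f) (d : ℕ) :
    Negligible θ (fun σ => (σ : ℝ) ^ d * f σ) := by
  intro c
  filter_upwards [hf (c + d)] with σ hσ
  rw [abs_mul, abs_of_nonneg (by positivity : (0 : ℝ) ≤ (σ : ℝ) ^ d), ← mul_assoc, ← pow_add]
  exact hσ

theorem Negligible.add (hf : Negligible θ f) (hf' : Negligible θ f') :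
    Negligible θ (fun σ => f σ + f' σ) := by
  intro c
  -- The exponent `c + 1` gives a spare factor `σ ≥ 2`, which pays for adding two bounds.
  filter_upwards [hf (c + 1), hf' (c + 1), eventually_ge_atTop 2] with σ h1 h2 h3
  have hσ : (2 : ℝ) ≤ σ := by exact_mod_cast h3
  have h4 : (σ : ℝ) ^ c * |f σ + f' σ| ≤ (σ : ℝ) ^ c * |f σ| + (σ : ℝ) ^ c * |f' σ| := by
    rw [← mul_add]
    gcongr
    exact abs_add_le _ _
  rw [pow_succ] at h1 h2
  have p1 : 0 ≤ (σ : ℝ) ^ c * |f σ| := by positivity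
  have p2 : 0 ≤ (σ : ℝ) ^ c * |f' σ| := by positivity
  nlinarith

/-- One spare power of `σ` eventually exceeds the constant. -/
theorem Negligible.const_mul (hf : Negligible θ f) (C : ℝ) :
    Negligible θ (fun σ => C * f σ) := by
  intro c
  filter_upwards [hf (c + 1), eventually_ge_atTop ⌈|C|⌉₊] with σ h1 h2
  have h3 : |C| ≤ σ := (Nat.le_ceil _).trans (by exact_mod_cast h2)
  refine lt_of_le_of_lt ?_ h1
  rw [abs_mul, pow_succ, mul_assoc]
  gcongr

/-- The scale `θ` need not be positive, so the empty sum requires `h0`. -/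
theorem Negligible.sum {ι : Type} (s : Finset ι) {F : ι → ℕ → ℝ} (h0 : Negligible θ fun _ => 0)
    (h : ∀ a ∈ s, Negligible θ (F a)) : Negligible θ (fun σ => ∑ a ∈ s, F a σ) := by
  classical
  induction s using Finset.induction_on with
  | empty => simpa using h0
  | insert a s ha ih =>
    simp only [Finset.sum_insert ha]
    exact (h a (Finset.mem_insert_self a s)).add
      (ih fun b hb => h b (Finset.mem_insert_of_mem hb))

/-- The existence of any negligible function forces `θ` to be eventually positive. -/
theorem Negligible.zero (hf : Negligible θ f) : Negligible θ fun _ => 0 := by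
  simpa using hf.const_mul 0

theorem Negligible.poly_mul (hf : Negligible θ f) (q : Polynomial ℕ) :
    Negligible θ (fun σ => ((q.eval σ : ℕ) : ℝ) * f σ) := by
  induction q using Polynomial.induction_on' with
  | add q q' h h' =>
    simp only [Polynomial.eval_add, Nat.cast_add, add_mul]
    exact h.add h'
  | monomial d a =>
    simp only [Polynomial.eval_monomial, Nat.cast_mul, Nat.cast_pow, mul_assoc]
    exact (hf.pow_mul d).const_mul a

end Negligible

/-! ### Lazy sampling of random functions -/

section Lazy

variable {X D R : Type} [DecidableEq D]

/-- Append a point to the list of known points, if it is new. -/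
def record (L : List D) (q : Option D) : List D :=
  match q with
  | none => L
  | some d => if d ∈ L then L else L ++ [d]

/-- A step of a process that evaluates a function `F` at the point `q x`, together with the list of
all points at which `F` was evaluated. -/
def recStep (nxt : X → (D → R) → X) (q : X → Option D) (F : D → R) (c : X × List D) : X × List D :=
  (nxt c.1 F, record c.2 (q c.1))

/-- The function that is known if the points of `L` got the answers `w 0`, `w 1`, and so on. -/
def answers (w : ℕ → R) (L : List D) (d : D) : R := w (L.idxOf d)

/-- The step with lazy sampling: every new point gets the next value of `w`. -/
def lazyStep (nxt : X → (D → R) → X) (q : X → Option D) (w : ℕ → R) (c : X × List D) :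
    X × List D :=
  (nxt c.1 (answers w (record c.2 (q c.1))), record c.2 (q c.1))

theorem prefix_record (L : List D) (q : Option D) : L <+: record L q := by
  unfold record
  split
  · exact List.prefix_rfl
  · split_ifs
    · exact List.prefix_rfl
    · exact List.prefix_append _ _

theorem nodup_record {L : List D} (h : L.Nodup) (q : Option D) : (record L q).Nodup := by
  unfold record
  split
  · exact h
  · split_ifs with hd
    · exact h
    · exact List.nodup_append.2 ⟨h, List.nodup_singleton _, by aesop⟩

theorem length_record_le (L : List D) (q : Option D) : (record L q).length ≤ L.length + 1 := by
  unfold record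
  split
  · omega
  · split_ifs <;> simp

theorem mem_record {L : List D} {d : D} : d ∈ record L (some d) := by
  unfold record
  simp only
  split_ifs with h <;> simp [h]

theorem idxOf_eq_of_prefix {L L' : List D} (h : L <+: L') {d : D} (hd : d ∈ L) :
    L'.idxOf d = L.idxOf d := by
  obtain ⟨K, rfl⟩ := h
  exact List.idxOf_append_of_mem hd

variable (nxt : X → (D → R) → X) (q : X → Option D)

theorem prefix_recStep_iterate (F : D → R) (c : X × List D) {s N : ℕ} (h : s ≤ N) :
    ((recStep nxt q F)^[s] c).2 <+: ((recStep nxt q F)^[N] c).2 := by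
  induction N, h using Nat.le_induction with
  | base => exact List.prefix_rfl
  | succ N _ ih =>
    rw [Function.iterate_succ_apply']
    exact ih.trans (prefix_record _ _)

theorem prefix_lazyStep_iterate (w : ℕ → R) (c : X × List D) {s N : ℕ} (h : s ≤ N) :
    ((lazyStep nxt q w)^[s] c).2 <+: ((lazyStep nxt q w)^[N] c).2 := by
  induction N, h using Nat.le_induction with
  | base => exact List.prefix_rfl
  | succ N _ ih =>
    rw [Function.iterate_succ_apply']
    exact ih.trans (prefix_record _ _)

theorem nodup_lazyStep_iterate (w : ℕ → R) (x : X) (s : ℕ) :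
    ((lazyStep nxt q w)^[s] (x, [])).2.Nodup := by
  induction s with
  | zero => exact List.nodup_nil
  | succ s ih =>
    rw [Function.iterate_succ_apply']
    exact nodup_record ih _

theorem length_lazyStep_iterate_le (w : ℕ → R) (x : X) (s : ℕ) :
    ((lazyStep nxt q w)^[s] (x, [])).2.length ≤ s := by
  induction s with
  | zero => simp
  | succ s ih =>
    rw [Function.iterate_succ_apply']
    exact (length_record_le _ _).trans (by omega)

theorem length_recStep_iterate_le (F : D → R) (x : X) (s : ℕ) :
    ((recStep nxt q F)^[s] (x, [])).2.length ≤ s := by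
  induction s with
  | zero => simp
  | succ s ih =>
    rw [Function.iterate_succ_apply']
    exact (length_record_le _ _).trans (by omega)

variable {nxt q}

/-- The process does not change if the function is changed at points where it is not evaluated. -/
theorem recStep_iterate_congr
    (hloc : ∀ x F F', (∀ d ∈ q x, F d = F' d) → nxt x F = nxt x F') {F F' : D → R} {x : X} {N : ℕ}
    (h : ∀ d ∈ ((recStep nxt q F)^[N] (x, [])).2, F d = F' d) {s : ℕ} (hs : s ≤ N) :
    (recStep nxt q F')^[s] (x, []) = (recStep nxt q F)^[s] (x, []) := by
  induction s with
  | zero => rfl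
  | succ s ih =>
    have hp := prefix_recStep_iterate nxt q F (x, []) hs
    rw [Function.iterate_succ_apply'] at hp
    rw [Function.iterate_succ_apply', Function.iterate_succ_apply', ih (by omega)]
    set c := (recStep nxt q F)^[s] (x, [])
    refine Prod.ext (hloc _ _ _ fun d hd => (h d (hp.subset ?_)).symm) rfl
    rw [Option.mem_def] at hd
    simp only [recStep, hd]
    exact mem_record

/-- Lists of known points only grow at the end, so the index of a point, and with it the lazily
chosen answer, is never revised. A function that agrees with the final answers therefore reproduces
every earlier step. -/
theorem recStep_iterate_eq_lazyStep_iterate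
    (hloc : ∀ x F F', (∀ d ∈ q x, F d = F' d) → nxt x F = nxt x F') {w : ℕ → R} {F : D → R} {x : X}
    {N : ℕ} (h : ∀ d ∈ ((lazyStep nxt q w)^[N] (x, [])).2,
      F d = answers w ((lazyStep nxt q w)^[N] (x, [])).2 d) {s : ℕ} (hs : s ≤ N) :
    (recStep nxt q F)^[s] (x, []) = (lazyStep nxt q w)^[s] (x, []) := by
  induction s with
  | zero => rfl
  | succ s ih =>
    have hp := prefix_lazyStep_iterate nxt q w (x, []) hs
    rw [Function.iterate_succ_apply'] at hp
    rw [Function.iterate_succ_apply', Function.iterate_succ_apply', ih (by omega)]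
    set c := (lazyStep nxt q w)^[s] (x, [])
    refine Prod.ext (hloc _ _ _ fun d hd => ?_) rfl
    rw [Option.mem_def] at hd
    simp only [lazyStep, hd] at hp ⊢
    rw [h d (hp.subset mem_record)]
    unfold answers
    rw [idxOf_eq_of_prefix hp mem_record]

/-- A finite list of values, continued by a default value. -/
def extendPool [Inhabited R] {N : ℕ} (w : Fin N → R) (k : ℕ) : R :=
  if hk : k < N then w ⟨k, hk⟩ else default

/-- Exchange the values of a function at the points of a list for the first values of a pool. -/
def swapPool [Inhabited R] {N : ℕ} (L : List D) (a : (D → R) × (Fin N → R)) :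
    (D → R) × (Fin N → R) :=
  (fun d => if d ∈ L then extendPool a.2 (L.idxOf d) else a.1 d,
   fun k => if hk : (k : ℕ) < L.length then a.1 L[k] else a.2 k)

/-- Without repetitions, points of the list correspond to positions one to one; the pool has to be
long enough for all positions, since beyond its end `extendPool` only returns the default. -/
theorem swapPool_swapPool [Inhabited R] {N : ℕ} {L : List D} (hL : L.Nodup) (hN : L.length ≤ N)
    (a : (D → R) × (Fin N → R)) : swapPool L (swapPool L a) = a := by
  refine Prod.ext (funext fun d => ?_) (funext fun k => ?_)
  · simp only [swapPool]
    split_ifs with hd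
    · have h1 := List.idxOf_lt_length_iff.2 hd
      simp [extendPool, h1, h1.trans_le hN]
    · rfl
  · by_cases hk : (k : ℕ) < L.length
    · simp [swapPool, hk, extendPool, hL.idxOf_getElem]
    · simp [swapPool, hk]

/-- Evaluating a uniformly random function is the same as lazy sampling. -/
theorem prob_rec_le_prob_lazy [Fintype D] [Fintype R] [Inhabited R]
    (hloc : ∀ x F F', (∀ d ∈ q x, F d = F' d) → nxt x F = nxt x F') (x : X) (N : ℕ)
    (E : X × List D → Prop) :
    prob (D → R) (fun F => E ((recStep nxt q F)^[N] (x, []))) ≤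
      prob (Fin N → R) (fun w => E ((lazyStep nxt q (extendPool w))^[N] (x, []))) := by
  -- The exchange gives the opposite inequality, for all events; passing to complements then yields
  -- the desired one.
  have key : ∀ E : X × List D → Prop,
      prob (Fin N → R) (fun w => E ((lazyStep nxt q (extendPool w))^[N] (x, []))) ≤
      prob (D → R) (fun F => E ((recStep nxt q F)^[N] (x, []))) := by
    intro E
    have e1 := prob_snd (V := D → R) (fun w : Fin N → R =>
      E ((lazyStep nxt q (extendPool w))^[N] (x, [])))
    have e2 := prob_fst (V := Fin N → R) (fun F : D → R => E ((recStep nxt q F)^[N] (x, [])))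
    rw [← e1, ← e2]
    -- After the exchange the function has the lazily chosen values at all points of the list, so
    -- the two processes coincide. In particular the list can be read off afterwards, and the
    -- exchange can be undone.
    have h1 : ∀ a : (D → R) × (Fin N → R),
        (recStep nxt q
          (swapPool ((lazyStep nxt q (extendPool a.2))^[N] (x, [])).2 a).1)^[N] (x, []) =
          (lazyStep nxt q (extendPool a.2))^[N] (x, []) := by
      intro a
      refine recStep_iterate_eq_lazyStep_iterate hloc (fun d hd => ?_) le_rfl
      simp only [swapPool, hd, if_true]
      rfl
    refine prob_le_of_leftInverse
      (fun a => swapPool ((lazyStep nxt q (extendPool a.2))^[N] (x, [])).2 a)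
      (fun a => swapPool ((recStep nxt q a.1)^[N] (x, [])).2 a) (fun a ha => ?_) (fun a _ => ?_)
    · simp only [h1]
      exact ha
    · simp only [h1]
      exact swapPool_swapPool (nodup_lazyStep_iterate nxt q _ x N)
        (length_lazyStep_iterate_le nxt q _ x N) a
  have := key fun c => ¬ E c
  rw [prob_not, prob_not] at this
  linarith

end Lazy

/-! ### Idealised runs -/

/-- The points at which the random oracles can be evaluated. -/
abbrev Params.Point (P : Params) : Type := Fin P.grp.p ⊕ (P.Key × P.Secret) ⊕ (P.Key × P.Secret)

/-- A common range of the random oracles. -/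
abbrev Params.Answer (P : Params) : Type := P.Key × P.Hash

/-- The random oracle call that is made in the next step, if there is time for that step. -/
def Config.point {S : Type} (P : Params) (T : ℕ) (c : Config S) : Option P.Point :=
  if c.due ≤ T then
    match c.query with
    | some (0, v, _) => some (.inl (Fin.ofNat _ v))
    | some (1, v, w) => some (.inr (.inl (Fin.ofNat _ v, Fin.ofNat _ w)))
    | some (2, v, w) => some (.inr (.inr (Fin.ofNat _ v, Fin.ofNat _ w)))
    | _ => none
  else none

section Ideal

variable {P : Params} {n r m T : ℕ}

/-- The random oracles of a sample. -/
def Sample.ro (ω : Sample P n r m T) : P.Point → P.Answer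
  | .inl v => (ω.h v, 0)
  | .inr (.inl a) => (0, ω.hA a.1 a.2)
  | .inr (.inr a) => (0, ω.hB a.1 a.2)

/-- Replace the random oracles. -/
def Sample.withRO (ω : Sample P n r m T) (F : P.Point → P.Answer) : Sample P n r m T :=
  { ω with
    h := fun v => (F (.inl v)).1
    hA := fun k s => (F (.inr (.inl (k, s)))).2
    hB := fun k s => (F (.inr (.inr (k, s)))).2 }

/-- A step of the eavesdropper with idealised runs, for given random oracles. -/
def Sample.idealStep (ω : Sample P n r m T) (corrupt : Finset (Fin n))
    (c : Config (List (Fin n × Fin n))) (F : P.Point → P.Answer) : Config (List (Fin n × Fin n)) :=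
  stepT T (extendTape ω.coin) ((ω.withRO F).oracle corrupt fun t _ _ => ω.idealRun t) c

/-- This is the locality required for lazy sampling. It holds because idealised transcripts do not
evaluate the random oracles: only a direct query does, at a single point. -/
theorem Sample.idealStep_congr (ω : Sample P n r m T) (corrupt : Finset (Fin n))
    (c : Config (List (Fin n × Fin n))) (F F' : P.Point → P.Answer)
    (h : ∀ d ∈ c.point P T, F d = F' d) :
    ω.idealStep corrupt c F = ω.idealStep corrupt c F' := by
  refine stepT_congr _ _ _ _ _ fun hc q hq => ?_
  obtain ⟨k, v, w⟩ := q
  rw [Option.mem_def] at hq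
  simp only [Config.point, hc, hq, if_true] at h
  match k with
  | 0 => simp at h; simp [Sample.oracle, Sample.withRO, h]
  | 1 => simp at h; simp [Sample.oracle, Sample.withRO, h]
  | 2 => simp at h; simp [Sample.oracle, Sample.withRO, h]
  | 3 => rfl
  | k + 4 => rfl

variable (groups : Fin n → Finset (Fin r)) (corrupt : Finset (Fin n)) (prog : Prog) (σ : ℕ)

/-- The initial configuration of an eavesdropper. -/
def Sample.start (ω : Sample P n r m T) : Config (List (Fin n × Fin n)) :=
  ⟨[prog], ω.knowledge σ groups corrupt, 0, [], 0⟩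

/-- The process of eavesdropping on idealised runs, after `s` steps: the configuration, and the
points at which the random oracles were evaluated. -/
def Sample.idealAt (ω : Sample P n r m T) (s : ℕ) :
    Config (List (Fin n × Fin n)) × List P.Point :=
  (recStep (ω.idealStep corrupt) (Config.point P T) ω.ro)^[s] (ω.start groups corrupt prog σ, [])

/-- The final configuration of an eavesdropper on idealised runs. -/
def Sample.idealFin (ω : Sample P n r m T) : Config (List (Fin n × Fin n)) :=
  (ω.idealAt groups corrupt prog σ T).1

/-- The points at which the random oracles are evaluated by an eavesdropper on idealised runs. -/
def Sample.asked (ω : Sample P n r m T) : List P.Point :=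
  (ω.idealAt groups corrupt prog σ T).2

/-- The final configuration of an eavesdropper on runs of the protocol. -/
def Sample.realFin (ω : Sample P n r m T) : Config (List (Fin n × Fin n)) :=
  (stepT T (extendTape ω.coin) (ω.oracle corrupt (ω.realRun groups)))^[T]
    (ω.start groups corrupt prog σ)

theorem Sample.idealAt_fst (ω : Sample P n r m T) (s : ℕ) :
    (ω.idealAt groups corrupt prog σ s).1 =
      (stepT T (extendTape ω.coin) (ω.oracle corrupt fun t _ _ => ω.idealRun t))^[s]
        (ω.start groups corrupt prog σ) := by
  induction s with
  | zero => rfl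
  | succ s ih =>
    rw [Function.iterate_succ_apply', ← ih]
    unfold Sample.idealAt
    rw [Function.iterate_succ_apply']
    -- `ω.withRO ω.ro` is `ω` by definition.
    rfl

theorem Sample.idealAt_succ_fst (ω : Sample P n r m T) (s : ℕ) :
    (ω.idealAt groups corrupt prog σ (s + 1)).1 =
      stepT T (extendTape ω.coin) (ω.oracle corrupt fun t _ _ => ω.idealRun t)
        (ω.idealAt groups corrupt prog σ s).1 := by
  rw [Sample.idealAt_fst, Sample.idealAt_fst, Function.iterate_succ_apply']

/-- The Diffie-Hellman secret of run `t`. -/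
def Sample.dh (ω : Sample P n r m T) (t : Fin T) : Fin P.grp.p :=
  Fin.ofNat _ (P.grp.g ^ ((ω.x t : ℕ) * ω.y t))

theorem Sample.keyA_eq (ω : Sample P n r m T) (t : Fin T) : ω.keyA t = ω.h (ω.dh t) := by
  unfold Sample.keyA Sample.dh Sample.msgB
  congr 1
  apply Fin.ext
  simp only [Fin.ofNat]
  rw [← Nat.pow_mod, ← pow_mul, mul_comm]

theorem Sample.keyB_eq (ω : Sample P n r m T) (t : Fin T) : ω.keyB t = ω.h (ω.dh t) := by
  unfold Sample.keyB Sample.dh Sample.msgA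
  congr 1
  apply Fin.ext
  simp only [Fin.ofNat]
  rw [← Nat.pow_mod, ← pow_mul]

/-! ### Exchanging values of a function for values of a list -/

open Classical in
/-- The values of `f` at the points `pt j` are replaced by `g j`. -/
noncomputable def swapFun {J D R : Type} (pt : J → Option D) (f : D → R) (g : J → R) (d : D) : R :=
  if h : ∃ j, pt j = some d then g h.choose else f d

/-- The values `g j` are replaced by those of `f` at the points `pt j`. -/
def swapVal {J D R : Type} (pt : J → Option D) (f : D → R) (g : J → R) (j : J) : R :=
  match pt j with
  | some d => f d
  | none => g j

section Swap

variable {J D R : Type} {pt : J → Option D} (f : D → R) (g : J → R)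

theorem swapFun_of_eq (hpt : ∀ j j' d, pt j = some d → pt j' = some d → j = j') {j : J} {d : D}
    (h : pt j = some d) : swapFun pt f g d = g j := by
  have hex : ∃ j, pt j = some d := ⟨j, h⟩
  rw [swapFun, dif_pos hex, hpt _ _ _ hex.choose_spec h]

theorem swapFun_of_ne {d : D} (h : ∀ j, pt j ≠ some d) : swapFun pt f g d = f d := by
  rw [swapFun, dif_neg (by simpa using h)]

theorem swapFun_swap (hpt : ∀ j j' d, pt j = some d → pt j' = some d → j = j') :
    swapFun pt (swapFun pt f g) (swapVal pt f g) = f := by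
  funext d
  by_cases h : ∃ j, pt j = some d
  · obtain ⟨j, hj⟩ := h
    rw [swapFun_of_eq _ _ hpt hj, swapVal, hj]
  · push Not at h
    rw [swapFun_of_ne _ _ h, swapFun_of_ne _ _ h]

theorem swapVal_swap (hpt : ∀ j j' d, pt j = some d → pt j' = some d → j = j') :
    swapVal pt (swapFun pt f g) (swapVal pt f g) = g := by
  funext j
  cases hj : pt j with
  | none => simp [swapVal, hj]
  | some d =>
    simp only [swapVal, hj]
    exact swapFun_of_eq _ _ hpt hj

end Swap

/-- The point at which Alice (or Bob, according to `side`) evaluates the keyed random oracle. -/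
def Sample.hashPoint (ω : Sample P n r m T) (runs : List (Fin n × Fin n))
    (side : Fin n × Fin n → Fin n) (j : Fin T × Fin m) : Option (P.Key × P.Secret) :=
  (runs[(j.1 : ℕ)]?).map fun uv => (ω.keyA j.1, ω.array groups (side uv) j.2)

/-- Exchange the keyed hashes that occur in the given runs for the ideal ones. -/
noncomputable def Sample.swapRuns (ω : Sample P n r m T) (runs : List (Fin n × Fin n)) :
    Sample P n r m T :=
  { ω with
    hA := fun k s => swapFun (ω.hashPoint groups runs Prod.fst) (fun a => ω.hA a.1 a.2)
      (fun j => ω.idealA j.1 j.2) (k, s)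
    hB := fun k s => swapFun (ω.hashPoint groups runs Prod.snd) (fun a => ω.hB a.1 a.2)
      (fun j => ω.idealB j.1 j.2) (k, s)
    idealA := fun t c => swapVal (ω.hashPoint groups runs Prod.fst) (fun a => ω.hA a.1 a.2)
      (fun j => ω.idealA j.1 j.2) (t, c)
    idealB := fun t c => swapVal (ω.hashPoint groups runs Prod.snd) (fun a => ω.hB a.1 a.2)
      (fun j => ω.idealB j.1 j.2) (t, c) }

/-! ### Idealised runs as real runs after an exchange of hashes -/

variable {groups corrupt prog σ}

/-- Different runs are separated by their keys, different cells of one run by the stored values. So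
every hash that is sent has an oracle point of its own, and the exchange is an involution. -/
theorem Sample.hashPoint_inj {ω : Sample P n r m T} {runs : List (Fin n × Fin n)}
    {side : Fin n × Fin n → Fin n} (hkey : Function.Injective ω.keyA)
    (harr : ∀ l, Function.Injective (ω.array groups l)) (j j' : Fin T × Fin m) (d : P.Key × P.Secret)
    (hj : ω.hashPoint groups runs side j = some d) (hj' : ω.hashPoint groups runs side j' = some d) :
    j = j' := by
  unfold Sample.hashPoint at hj hj'
  obtain ⟨uv, h1, h2⟩ := Option.map_eq_some_iff.1 hj
  obtain ⟨uv', h1', h2'⟩ := Option.map_eq_some_iff.1 hj'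
  rw [← h2', Prod.mk.injEq] at h2
  have h3 : j.1 = j'.1 := hkey h2.1
  rw [h3, h1'] at h1
  cases h1
  exact Prod.ext h3 (harr _ h2.2)

theorem Sample.swapRuns_swapRuns {ω : Sample P n r m T} {runs : List (Fin n × Fin n)}
    (hkey : Function.Injective ω.keyA) (harr : ∀ l, Function.Injective (ω.array groups l)) :
    (ω.swapRuns groups runs).swapRuns groups runs = ω := by
  -- The exchange touches neither `h` nor the exponents nor the arrays, so the points of exchange
  -- stay where they are.
  have hp : ∀ side, (ω.swapRuns groups runs).hashPoint groups runs side =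
      ω.hashPoint groups runs side := fun side => rfl
  have hi := fun side => Sample.hashPoint_inj (ω := ω) (runs := runs) (side := side) hkey harr
  rcases ω with ⟨secret, filler, perm, x, y, h, hA, hB, idealA, idealB, coin⟩
  rw [Sample.swapRuns]
  simp only [hp]
  simp only [Sample.swapRuns, Sample.mk.injEq, true_and, and_true]
  refine ⟨?_, ?_, ?_, ?_⟩
  · funext k s
    exact congrFun (swapFun_swap _ _ (hi Prod.fst)) (k, s)
  · funext k s
    exact congrFun (swapFun_swap _ _ (hi Prod.snd)) (k, s)
  · funext t c
    exact congrFun (swapVal_swap _ _ (hi Prod.fst)) (t, c)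
  · funext t c
    exact congrFun (swapVal_swap _ _ (hi Prod.snd)) (t, c)

theorem Sample.oracle_state_prefix (ω : Sample P n r m T)
    (tr : Fin T → Fin n → Fin n → List ℕ) (runs : List (Fin n × Fin n)) (k v w : ℕ) :
    runs <+: (ω.oracle corrupt tr runs k v w).1 := by
  unfold Sample.oracle
  split
  any_goals exact List.prefix_rfl
  dsimp only
  split_ifs
  · exact List.prefix_append _ _
  all_goals exact List.prefix_rfl

theorem stepT_state_prefix {Q : Type} {O : Oracle (List Q)}
    (hO : ∀ s k v w, s <+: (O s k v w).1) (T : ℕ) (coin : ℕ → Bool) (c : Config (List Q)) :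
    c.state <+: (stepT T coin O c).state := by
  unfold stepT
  split_ifs
  · rcases c with ⟨_ | ⟨p, rest⟩, M, k, s, t⟩
    · exact List.prefix_rfl
    · cases p <;> simp only [step] <;> first | exact List.prefix_rfl | exact hO _ _ _ _
  · exact List.prefix_rfl

theorem Sample.idealAt_state_prefix (ω : Sample P n r m T) {s N : ℕ} (h : s ≤ N) :
    (ω.idealAt groups corrupt prog σ s).1.state <+: (ω.idealAt groups corrupt prog σ N).1.state := by
  induction N, h using Nat.le_induction with
  | base => exact List.prefix_rfl
  | succ N _ ih =>
    refine ih.trans ?_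
    simp only [Sample.idealAt_fst, Function.iterate_succ_apply']
    exact stepT_state_prefix (fun _ _ _ _ => ω.oracle_state_prefix _ _ _ _ _) _ _ _

theorem Sample.idealAt_snd_prefix (ω : Sample P n r m T) {s N : ℕ} (h : s ≤ N) :
    (ω.idealAt groups corrupt prog σ s).2 <+: (ω.idealAt groups corrupt prog σ N).2 :=
  prefix_recStep_iterate _ _ _ _ h

theorem Sample.point_mem_asked (ω : Sample P n r m T) {s : ℕ} (h : s < T) {d : P.Point}
    (hd : d ∈ (ω.idealAt groups corrupt prog σ s).1.point P T) :
    d ∈ ω.asked groups corrupt prog σ := by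
  refine (ω.idealAt_snd_prefix (Nat.succ_le_of_lt h)).subset ?_
  rw [Option.mem_def] at hd
  unfold Sample.idealAt at hd ⊢
  rw [Function.iterate_succ_apply']
  simp only [recStep, hd]
  exact mem_record

variable (groups corrupt prog σ)

/-- The eavesdropper on idealised runs evaluates a keyed random oracle at a session key. -/
def Sample.AskedKey (ω : Sample P n r m T) : Prop :=
  ∃ t s, .inr (.inl (ω.keyA t, s)) ∈ ω.asked groups corrupt prog σ ∨
    .inr (.inr (ω.keyA t, s)) ∈ ω.asked groups corrupt prog σ

variable {groups corrupt prog σ}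

/-- If the session keys are not known, then idealised runs are like real ones. -/
theorem Sample.realFin_swapRuns {ω : Sample P n r m T} (hkey : Function.Injective ω.keyA)
    (harr : ∀ l, Function.Injective (ω.array groups l)) (hask : ¬ ω.AskedKey groups corrupt prog σ) :
    (ω.swapRuns groups (ω.idealFin groups corrupt prog σ).state).realFin groups corrupt prog σ =
      ω.idealFin groups corrupt prog σ := by
  set runs := (ω.idealFin groups corrupt prog σ).state with hruns
  set ω' := ω.swapRuns groups runs with hω'
  have hi := fun side => Sample.hashPoint_inj (ω := ω) (runs := runs) (side := side) hkey harr
  -- The two executions stay in the same configuration: at each affordable step the two oracles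
  -- agree on the query that is sent.
  have main : ∀ s ≤ T, (stepT T (extendTape ω'.coin) (ω'.oracle corrupt (ω'.realRun groups)))^[s]
      (ω'.start groups corrupt prog σ) = (ω.idealAt groups corrupt prog σ s).1 := by
    intro s
    induction s with
    | zero => intro _; rfl
    | succ s ih =>
      intro hs
      have hstate := ω.idealAt_state_prefix (groups := groups) (corrupt := corrupt) (prog := prog)
        (σ := σ) hs
      have hask' : ∀ d ∈ (ω.idealAt groups corrupt prog σ s).1.point P T,
          d ∈ ω.asked groups corrupt prog σ := fun d => ω.point_mem_asked hs
      rw [Function.iterate_succ_apply', ih (by omega)]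
      rw [Sample.idealAt_succ_fst] at hstate ⊢
      set c := (ω.idealAt groups corrupt prog σ s).1
      refine stepT_congr _ _ _ _ _ fun hc q hq => ?_
      obtain ⟨k, v, w⟩ := q
      rw [Option.mem_def] at hq
      simp only [Config.point, hc, hq, if_true] at hask'
      match k with
      | 0 => rfl
      | 1 =>
        -- The queried point was recorded. If the exchange had altered `hA` there, its first
        -- component would be a session key, contrary to `hask`.
        have h1 := hask' _ rfl
        simp only [Sample.oracle, Prod.mk.injEq, List.cons.injEq, and_true, true_and]
        congr 1
        change swapFun (ω.hashPoint groups runs Prod.fst) (fun a => ω.hA a.1 a.2)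
          (fun j => ω.idealA j.1 j.2) (_, _) = _
        refine swapFun_of_ne _ _ ?_
        intro j hj
        obtain ⟨uv, h2, h3⟩ := Option.map_eq_some_iff.1 hj
        rw [Prod.mk.injEq] at h3
        rw [← h3.1] at h1
        exact hask ⟨_, _, Or.inl h1⟩
      | 2 =>
        have h1 := hask' _ rfl
        simp only [Sample.oracle, Prod.mk.injEq, List.cons.injEq, and_true, true_and]
        congr 1
        change swapFun (ω.hashPoint groups runs Prod.snd) (fun a => ω.hB a.1 a.2)
          (fun j => ω.idealB j.1 j.2) (_, _) = _
        refine swapFun_of_ne _ _ ?_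
        intro j hj
        obtain ⟨uv, h2, h3⟩ := Option.map_eq_some_iff.1 hj
        rw [Prod.mk.injEq] at h3
        rw [← h3.1] at h1
        exact hask ⟨_, _, Or.inr h1⟩
      | 3 =>
        have hst : (stepT T (extendTape ω.coin)
            (ω.oracle corrupt fun t x x => ω.idealRun t) c).state =
            (ω.oracle corrupt (fun t x x => ω.idealRun t) c.state 3 v w).1 := by
          rw [stepT, if_pos hc]
          rcases hcc : c with ⟨_ | ⟨p, rest⟩, M, k, s, t⟩
          · simp [Config.query, hcc] at hq
          · cases p <;> simp [Config.query, hcc] at hq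
            obtain ⟨rfl, rfl, rfl⟩ := hq
            rfl
        rw [hst] at hstate
        simp only [Sample.oracle] at hstate ⊢
        split_ifs with h1 h2
        · rw [dif_pos h1, if_pos h2] at hstate
          refine Prod.ext rfl ?_
          dsimp only
          -- The final list of runs extends the state after this step, so the present run is its
          -- entry number `c.state.length`; hence its hashes are among those exchanged.
          have hrun : runs[c.state.length]? = some (⟨v, h1.1⟩, ⟨w, h1.2.1⟩) := by
            obtain ⟨K, hK⟩ := hstate
            have : runs = c.state ++ [(⟨v, h1.1⟩, ⟨w, h1.2.1⟩)] ++ K := hK.symm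
            rw [this]
            simp
          unfold Sample.realRun Sample.idealRun
          congr 1
          · congr 1
            congr 1
            funext c'
            congr 1
            change swapFun (ω.hashPoint groups runs Prod.fst) (fun a => ω.hA a.1 a.2)
              (fun j => ω.idealA j.1 j.2) (_, _) = _
            refine swapFun_of_eq _ _ (hi Prod.fst) (j := (⟨c.state.length, h1.2.2⟩, c')) ?_
            simp only [Sample.hashPoint, hrun]
            rfl
          · congr 1
            funext c'
            congr 1
            change swapFun (ω.hashPoint groups runs Prod.snd) (fun a => ω.hB a.1 a.2)
              (fun j => ω.idealB j.1 j.2) (_, _) = _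
            refine swapFun_of_eq _ _ (hi Prod.snd) (j := (⟨c.state.length, h1.2.2⟩, c')) ?_
            simp only [Sample.hashPoint, hrun, Option.map_some]
            congr 2
            rw [Sample.keyB_eq, Sample.keyA_eq]
            rfl
        · rfl
        · rfl
      | k + 4 => rfl
  exact main T le_rfl

/-- An event is about as likely with real runs as with idealised ones. -/
theorem prob_ideal_le_prob_real {Good : Sample P n r m T → Prop}
    {E : Sample P n r m T → Config (List (Fin n × Fin n)) → Prop}
    (hE : ∀ ω runs c, E ω c → E (ω.swapRuns groups runs) c)
    (hkey : ∀ ω, Good ω → Function.Injective ω.keyA)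
    (harr : ∀ ω, Good ω → ∀ l, Function.Injective (ω.array groups l))
    (hask : ∀ ω, Good ω → ¬ ω.AskedKey groups corrupt prog σ) :
    prob (Sample P n r m T) (fun ω => Good ω ∧ E ω (ω.idealFin groups corrupt prog σ)) ≤
      prob (Sample P n r m T) (fun ω => E ω (ω.realFin groups corrupt prog σ)) := by
  -- The runs needed to undo the exchange are read off from the real execution of the exchanged
  -- sample, which is the idealised execution of the original one.
  refine prob_le_of_leftInverse
    (fun ω => ω.swapRuns groups (ω.idealFin groups corrupt prog σ).state)
    (fun ω => ω.swapRuns groups (ω.realFin groups corrupt prog σ).state) ?_ ?_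
  · intro ω ⟨hg, h⟩
    rw [Sample.realFin_swapRuns (hkey ω hg) (harr ω hg) (hask ω hg)]
    exact hE _ _ _ h
  · intro ω ⟨hg, _⟩
    rw [Sample.realFin_swapRuns (hkey ω hg) (harr ω hg) (hask ω hg)]
    exact Sample.swapRuns_swapRuns (hkey ω hg) (harr ω hg)

end Ideal

/-! ### Unlikely events -/

section Events

variable {P : Params} {n r m T : ℕ}

instance : Nonempty (Sample P n r m T) :=
  haveI : NeZero (P.grp.p - 1) := ⟨by have := P.grp.prime.two_le; omega⟩
  ⟨⟨0, 0, fun _ => 1, 0, 0, fun _ => 0, fun _ _ => 0, fun _ _ => 0, fun _ _ => 0, fun _ _ => 0,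
    fun _ => false⟩⟩

instance (D : DHGroup) : NeZero (D.p - 1) := ⟨by have := D.prime.two_le; omega⟩

/-- The session key derived from the Diffie-Hellman secret of run `t`, as a component. -/
def Sample.keyLens (t : Fin T) : Lens (Sample P n r m T) P.Key where
  get ω := ω.h (ω.dh t)
  set ω v := { ω with h := Function.update ω.h (ω.dh t) v }
  get_set ω v := by
    -- `dh` depends on the exponents only, so the update of `h` does not move the point of update.
    change Function.update ω.h (ω.dh t) v (ω.dh t) = v
    simp
  set_get ω := by
    rcases ω with ⟨⟩
    simp
  set_set ω v w := by
    change ({ ω with h := Function.update (Function.update ω.h (ω.dh t) v) (ω.dh t) w } :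
      Sample P n r m T) = _
    simp

/-- Bob's exponent in run `t`, as a component. -/
def Sample.yLens (t : Fin T) : Lens (Sample P n r m T) P.grp.Exponent where
  get ω := ω.y t
  set ω v := { ω with y := Function.update ω.y t v }
  get_set ω v := by simp
  set_get ω := by simp
  set_set ω v w := by simp

/-- The exponents in run `t`, as a component. -/
def Sample.xyLens (t : Fin T) : Lens (Sample P n r m T) (P.grp.Exponent × P.grp.Exponent) where
  get ω := (ω.x t, ω.y t)
  set ω v := { ω with x := Function.update ω.x t v.1, y := Function.update ω.y t v.2 }
  get_set ω v := by simp
  set_get ω := by simp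
  set_set ω v w := by simp

/-- The secret of a group, as a component. -/
def Sample.secretLens (G : Fin r) : Lens (Sample P n r m T) P.Secret where
  get ω := ω.secret G
  set ω v := { ω with secret := Function.update ω.secret G v }
  get_set ω v := by simp
  set_get ω := by simp
  set_set ω v w := by simp

/-- The random value in one cell, as a component. -/
def Sample.fillerLens (l : Fin n) (c : Fin m) : Lens (Sample P n r m T) P.Secret where
  get ω := ω.filler l c
  set ω v := { ω with filler := Function.update ω.filler l (Function.update (ω.filler l) c v) }
  get_set ω v := by simp
  set_get ω := by simp
  set_set ω v w := by simp

variable (groups : Fin n → Finset (Fin r)) (corrupt : Finset (Fin n)) (prog : Prog) (σ : ℕ)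

/-- The eavesdropper evaluates the random oracle at the Diffie-Hellman secret of a run. -/
def Sample.AskedDH (ω : Sample P n r m T) : Prop :=
  ∃ t, .inl (ω.dh t) ∈ ω.asked groups corrupt prog σ

/-- The eavesdropper guesses the session key of run `t`. -/
def Sample.GuessedKey (t : Fin T) (ω : Sample P n r m T) : Prop :=
  .inl (ω.dh t) ∉ ω.asked groups corrupt prog σ ∧
    ((∃ s, .inr (.inl (ω.keyA t, s)) ∈ ω.asked groups corrupt prog σ ∨
      .inr (.inr (ω.keyA t, s)) ∈ ω.asked groups corrupt prog σ) ∨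
    (ω.idealFin groups corrupt prog σ).mem 0 1 = ω.keyA t)

/-- The key component of a point. -/
def pointKey : P.Point → Option P.Key
  | .inl _ => none
  | .inr (.inl a) => some a.1
  | .inr (.inr a) => some a.1

/-- As long as `h` is not evaluated at the secret of run `t`, the view in idealised runs is
independent of the key of that run. At most `T` queried keys and one output are candidates for a
uniform value. -/
theorem prob_guessedKey_le (t : Fin T) :
    prob (Sample P n r m T) (Sample.GuessedKey groups corrupt prog σ t) ≤
      (T + 1) * (1 / 2 ^ P.keyLen) := by
  classical
  refine (Sample.keyLens t).prob_le (by positivity) fun ω => ?_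
  -- If some value `v₀` of the key leads to the event, its execution serves as reference for all
  -- other values; otherwise the probability is zero.
  by_cases hex : ∃ v₀, Sample.GuessedKey groups corrupt prog σ t ((Sample.keyLens t).set ω v₀)
  swap
  · push Not at hex
    refine (prob_le_of_subset ∅ (E := fun v => _) fun v hv => absurd hv (hex v)).trans ?_
    simp
    positivity
  obtain ⟨v₀, hv₀, -⟩ := hex
  set ω₀ := (Sample.keyLens t).set ω v₀ with hω₀
  -- The reference execution never evaluates `h` at the updated point, so it is the execution for
  -- every value `v`.
  have hsame : ∀ v, ((Sample.keyLens t).set ω v).idealAt groups corrupt prog σ T =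
      ω₀.idealAt groups corrupt prog σ T := by
    intro v
    refine recStep_iterate_congr (ω.idealStep_congr corrupt) (fun d hd => ?_) le_rfl
    rcases d with d | d | d
    · have hd' : d ≠ ω.dh t := by
        rintro rfl
        exact hv₀ hd
      change (Function.update ω.h (ω.dh t) v₀ d, (0 : P.Hash)) =
        (Function.update ω.h (ω.dh t) v d, 0)
      rw [Function.update_of_ne hd', Function.update_of_ne hd']
    · rfl
    · rfl
  let s : Finset P.Key := ((ω₀.asked groups corrupt prog σ).filterMap pointKey).toFinset ∪
    {Fin.ofNat _ ((ω₀.idealFin groups corrupt prog σ).mem 0 1)}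
  have hs : s.card ≤ T + 1 := by
    refine (Finset.card_union_le _ _).trans (Nat.add_le_add ?_ (by simp))
    exact (List.toFinset_card_le _).trans
      ((List.length_filterMap_le _ _).trans (length_recStep_iterate_le _ _ _ _ _))
  refine (prob_le_of_subset s fun v hv => ?_).trans ?_
  · obtain ⟨-, h⟩ := hv
    have hk : ((Sample.keyLens t).set ω v).keyA t = v := by
      rw [Sample.keyA_eq]
      exact (Sample.keyLens t).get_set ω v
    simp only [hk, Sample.asked, Sample.idealFin, hsame] at h
    rw [Finset.mem_union]
    rcases h with ⟨a, h | h⟩ | h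
    · exact Or.inl (List.mem_toFinset.2 (List.mem_filterMap.2 ⟨_, h, rfl⟩))
    · exact Or.inl (List.mem_toFinset.2 (List.mem_filterMap.2 ⟨_, h, rfl⟩))
    · refine Or.inr (Finset.mem_singleton.2 ?_)
      simp only [Sample.idealFin, h]
      simp
  · rw [Fintype.card_fin, mul_one_div, Nat.cast_pow, Nat.cast_ofNat]
    gcongr
    exact_mod_cast hs

/-- The probability that a Diffie-Hellman secret is trivial. -/
noncomputable def trivialDH (D : DHGroup) : ℝ :=
  prob (D.Exponent × D.Exponent) fun a => D.g ^ ((a.1 : ℕ) * a.2) % D.p = 1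

theorem DHGroup.coprime (D : DHGroup) : Nat.Coprime D.g D.p :=
  Nat.Coprime.symm ((Nat.Prime.coprime_iff_not_dvd D.prime).2
    (Nat.not_dvd_of_pos_of_lt D.g_pos D.g_lt))

theorem DHGroup.pow_mod (D : DHGroup) (e : ℕ) :
    D.g ^ (e % (D.p - 1)) % D.p = D.g ^ e % D.p := by
  have h : D.g ^ (D.p - 1) ≡ 1 [MOD D.p] := by
    rw [← Nat.totient_prime D.prime]
    exact Nat.ModEq.pow_totient D.coprime
  conv_rhs => rw [← Nat.div_add_mod e (D.p - 1), pow_add, pow_mul]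
  have h2 := ((h.pow (e / (D.p - 1))).mul_right (D.g ^ (e % (D.p - 1))))
  rw [one_pow, one_mul] at h2
  exact h2.symm

/-- Powers are at least as likely to be trivial as to have any other value. -/
theorem prob_pow_le (D : DHGroup) (a z : ℕ) :
    prob D.Exponent (fun y => D.g ^ (a * y) % D.p = z) ≤
      prob D.Exponent (fun y => D.g ^ (a * y) % D.p = 1) := by
  classical
  by_cases hex : ∃ y₀ : D.Exponent, D.g ^ (a * y₀) % D.p = z
  swap
  · push Not at hex
    exact prob_mono fun y hy => absurd hy (hex y)
  obtain ⟨y₀, rfl⟩ := hex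
  -- The exponents with power `z` are a translate of those with power `1`: adding `y₀` modulo `p -
  -- 1` multiplies the power by `g ^ (a * y₀)`, which is invertible modulo `p`.
  let e : D.Exponent ≃ D.Exponent := Equiv.addRight y₀
  rw [← prob_equiv e]
  refine prob_mono fun y hy => ?_
  have h1 : ((e y : D.Exponent) : ℕ) = ((y : ℕ) + y₀) % (D.p - 1) := Fin.val_add _ _
  have h2 : D.g ^ (a * (e y : ℕ)) % D.p = (D.g ^ (a * y) * D.g ^ (a * (y₀ : ℕ))) % D.p := by
    rw [← D.pow_mod, h1, Nat.mul_mod, Nat.mod_mod, ← Nat.mul_mod, D.pow_mod, mul_add, pow_add]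
  rw [h2] at hy
  have h3 : D.g ^ (a * y) * D.g ^ (a * (y₀ : ℕ)) ≡ 1 * D.g ^ (a * (y₀ : ℕ)) [MOD D.p] := by
    rw [one_mul]; exact hy
  have h4 := Nat.ModEq.cancel_right_of_coprime
    (Nat.Coprime.symm (Nat.Coprime.pow_left _ D.coprime)) h3
  rw [Nat.ModEq, Nat.mod_eq_of_lt D.prime.one_lt] at h4
  exact h4

/-- Only `y t` is resampled. The secret of the other run is then a constant, and `prob_pow_le` shows
that `1` is the most likely value to be hit. This form is chosen because `trivialDH` can be bounded
by the Diffie-Hellman assumption, without knowledge of the order of `g`. -/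
theorem prob_dh_collision_le {t t' : Fin T} (h : t ≠ t') :
    prob (Sample P n r m T) (fun ω => ω.dh t = ω.dh t') ≤ trivialDH P.grp := by
  refine ((Sample.yLens t).prob_le_prob
    (E' := fun ω => P.grp.g ^ ((ω.x t : ℕ) * ω.y t) % P.grp.p = 1) fun ω => ?_).trans ?_
  · refine le_trans (prob_mono fun v hv => ?_) ((prob_pow_le P.grp (ω.x t)
      (P.grp.g ^ ((ω.x t' : ℕ) * ω.y t') % P.grp.p)).trans (prob_mono fun v hv => ?_))
    · have h1 := congrArg Fin.val hv
      simp only [Sample.dh, Sample.yLens, Fin.ofNat, Function.update_self,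
        Function.update_of_ne h.symm] at h1
      exact h1
    · simpa only [Sample.yLens, Function.update_self] using hv
  · exact ((Sample.xyLens t).prob_get
      (fun a : P.grp.Exponent × P.grp.Exponent => P.grp.g ^ ((a.1 : ℕ) * a.2) % P.grp.p = 1)).le

theorem prob_hash_collision_le (t t' : Fin T) :
    prob (Sample P n r m T) (fun ω => ω.dh t ≠ ω.dh t' ∧ ω.h (ω.dh t) = ω.h (ω.dh t')) ≤
      1 / 2 ^ P.keyLen := by
  refine (Sample.keyLens t).prob_le (by positivity) fun ω => ?_
  refine (prob_mono (E' := fun v => v = ω.h (ω.dh t')) fun v hv => ?_).trans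
    ((prob_eq_le _).trans (by simp))
  obtain ⟨h1, h2⟩ := hv
  change Function.update ω.h (ω.dh t) v (ω.dh t) = Function.update ω.h (ω.dh t) v (ω.dh t') at h2
  change ω.dh t ≠ ω.dh t' at h1
  rwa [Function.update_self, Function.update_of_ne h1.symm] at h2

theorem prob_keys_not_injective_le :
    prob (Sample P n r m T) (fun ω => ¬ Function.Injective ω.keyA) ≤
      (T : ℝ) ^ 2 * (trivialDH P.grp + 1 / 2 ^ P.keyLen) := by
  have h0 : 0 ≤ trivialDH P.grp := prob_nonneg _
  refine (prob_mono (E' := fun ω => ∃ a : Fin T × Fin T, a.1 ≠ a.2 ∧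
    (ω.dh a.1 = ω.dh a.2 ∨ (ω.dh a.1 ≠ ω.dh a.2 ∧ ω.h (ω.dh a.1) = ω.h (ω.dh a.2)))) ?_).trans ?_
  · intro ω hω
    simp only [Function.Injective, not_forall] at hω
    obtain ⟨t, t', h1, h2⟩ := hω
    rw [Sample.keyA_eq, Sample.keyA_eq] at h1
    refine ⟨(t, t'), h2, ?_⟩
    by_cases h3 : ω.dh t = ω.dh t'
    · exact Or.inl h3
    · exact Or.inr ⟨h3, h1⟩
  · refine (prob_exists_le_card_mul _ (trivialDH P.grp + 1 / 2 ^ P.keyLen) fun a => ?_).trans ?_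
    · by_cases ha : a.1 = a.2
      · refine (prob_le_of_subset ∅ fun v hv => absurd ha hv.1).trans ?_
        simp
        positivity
      · refine (prob_mono fun ω hω => hω.2).trans ((prob_or_le _ _).trans ?_)
        exact add_le_add (prob_dh_collision_le ha) (prob_hash_collision_le _ _)
    · simp [sq]

/-- The secrets and the random values in the arrays. -/
def Sample.value (ω : Sample P n r m T) : Fin r ⊕ (Fin n × Fin m) → P.Secret
  | .inl G => ω.secret G
  | .inr a => ω.filler a.1 a.2

/-- One of the values, as a component. -/
def Sample.valueLens : Fin r ⊕ (Fin n × Fin m) → Lens (Sample P n r m T) P.Secret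
  | .inl G => Sample.secretLens G
  | .inr a => Sample.fillerLens a.1 a.2

theorem Sample.value_valueLens_self (ω : Sample P n r m T) (a : Fin r ⊕ (Fin n × Fin m))
    (v : P.Secret) : ((Sample.valueLens a).set ω v).value a = v := by
  rcases a with G | a
  · exact (Sample.secretLens G).get_set ω v
  · exact (Sample.fillerLens a.1 a.2).get_set ω v

theorem Sample.value_valueLens_of_ne (ω : Sample P n r m T) {a b : Fin r ⊕ (Fin n × Fin m)}
    (h : b ≠ a) (v : P.Secret) : ((Sample.valueLens a).set ω v).value b = ω.value b := by
  rcases a with G | ⟨l, c⟩ <;> rcases b with G' | ⟨l', c'⟩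
  · simp only [Sample.valueLens, Sample.secretLens, Sample.value]
    rw [Function.update_of_ne (by simpa using h)]
  · rfl
  · rfl
  · simp only [Sample.valueLens, Sample.fillerLens, Sample.value]
    by_cases hl : l' = l
    · subst hl
      rw [Function.update_self, Function.update_of_ne (by simpa using h)]
    · rw [Function.update_of_ne hl]

theorem prob_value_not_injective_le :
    prob (Sample P n r m T) (fun ω => ¬ Function.Injective ω.value) ≤
      ((r : ℝ) + n * m) ^ 2 * (1 / 2 ^ P.secLen) := by
  refine (prob_mono (E' := fun ω => ∃ a : (Fin r ⊕ (Fin n × Fin m)) × (Fin r ⊕ (Fin n × Fin m)),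
    a.1 ≠ a.2 ∧ ω.value a.1 = ω.value a.2) ?_).trans ?_
  · intro ω hω
    simp only [Function.Injective, not_forall] at hω
    obtain ⟨t, t', h1, h2⟩ := hω
    exact ⟨(t, t'), h2, h1⟩
  · refine (prob_exists_le_card_mul _ (1 / 2 ^ P.secLen) fun a => ?_).trans ?_
    · refine (Sample.valueLens a.1).prob_le (by positivity) fun ω => ?_
      refine (prob_mono (E' := fun v => v = ω.value a.2) fun v hv => ?_).trans
        ((prob_eq_le _).trans (by simp))
      obtain ⟨h1, h2⟩ := hv
      rwa [Sample.value_valueLens_self, Sample.value_valueLens_of_ne _ (Ne.symm h1)] at h2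
    · simp [sq]

/-- Cells carry distinct labels, a group or a filler index, because the permutation is injective and
the sorted list of groups has no repetitions. Injectivity of `value` turns distinct labels into
distinct contents. -/
theorem Sample.array_injective {ω : Sample P n r m T} (h : Function.Injective ω.value) (l : Fin n) :
    Function.Injective (ω.array groups l) := by
  have key : ∀ c, ∃ a, ω.array groups l c = ω.value a ∧
      (match ((groups l).sort (· ≤ ·))[((ω.perm l c : Fin m) : ℕ)]? with
        | some G => Sum.inl G
        | none => Sum.inr (l, ω.perm l c)) = a := by
    intro c
    refine ⟨_, ?_, rfl⟩
    unfold Sample.array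
    cases ((groups l).sort (· ≤ ·))[((ω.perm l c : Fin m) : ℕ)]? <;> rfl
  intro c c' hc
  obtain ⟨a, h1, h2⟩ := key c
  obtain ⟨a', h1', h2'⟩ := key c'
  rw [h1, h1'] at hc
  have := h hc
  subst this
  rw [← h2'] at h2
  have hnd : ((groups l).sort (· ≤ ·)).Nodup := Finset.sort_nodup _ _
  cases h3 : ((groups l).sort (· ≤ ·))[((ω.perm l c : Fin m) : ℕ)]? with
  | none =>
    cases h4 : ((groups l).sort (· ≤ ·))[((ω.perm l c' : Fin m) : ℕ)]? with
    | none =>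
      simp only [h3, h4, Sum.inr.injEq, Prod.mk.injEq, true_and] at h2
      exact (ω.perm l).injective h2
    | some G => simp [h3, h4] at h2
  | some G =>
    cases h4 : ((groups l).sort (· ≤ ·))[((ω.perm l c' : Fin m) : ℕ)]? with
    | none => simp [h3, h4] at h2
    | some G' =>
      simp only [h3, h4, Sum.inl.injEq] at h2
      subst h2
      obtain ⟨i1, e1⟩ := List.getElem?_eq_some_iff.1 h3
      obtain ⟨i2, e2⟩ := List.getElem?_eq_some_iff.1 h4
      have h5 := (hnd.getElem_inj_iff).1 (e1.trans e2.symm)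
      exact (ω.perm l).injective (Fin.ext h5)

/-- The eavesdropper on idealised runs, or chance, reveals something. -/
def Sample.Compromised (ω : Sample P n r m T) : Prop :=
  ω.AskedDH groups corrupt prog σ ∨ (∃ t, ω.GuessedKey groups corrupt prog σ t) ∨
    ¬ Function.Injective ω.keyA ∨ ¬ Function.Injective ω.value

theorem prob_compromised_le :
    prob (Sample P n r m T) (Sample.Compromised groups corrupt prog σ) ≤
      prob (Sample P n r m T) (Sample.AskedDH groups corrupt prog σ) +
      (T * ((T + 1) * (1 / 2 ^ P.keyLen)) +
      ((T : ℝ) ^ 2 * (trivialDH P.grp + 1 / 2 ^ P.keyLen) +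
      ((r : ℝ) + n * m) ^ 2 * (1 / 2 ^ P.secLen))) := by
  refine (prob_or_le _ _).trans (add_le_add le_rfl ((prob_or_le _ _).trans (add_le_add ?_
    ((prob_or_le _ _).trans (add_le_add prob_keys_not_injective_le prob_value_not_injective_le)))))
  refine (prob_exists_le_card_mul _ _ fun t => prob_guessedKey_le groups corrupt prog σ t).trans ?_
  simp

/-- A query at a session key either comes with a query of `h` at its Diffie-Hellman secret, or
counts as a guess. -/
theorem Sample.not_askedKey {ω : Sample P n r m T} (h : ¬ ω.Compromised groups corrupt prog σ) :
    ¬ ω.AskedKey groups corrupt prog σ := by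
  rintro ⟨t, s, hs⟩
  refine h ?_
  by_cases hd : .inl (ω.dh t) ∈ ω.asked groups corrupt prog σ
  · exact Or.inl ⟨t, hd⟩
  · exact Or.inr (Or.inl ⟨t, hd, Or.inl ⟨s, hs⟩⟩)

theorem Sample.output_ne_key {ω : Sample P n r m T} (h : ¬ ω.Compromised groups corrupt prog σ)
    (t : Fin T) : (ω.idealFin groups corrupt prog σ).mem 0 1 ≠ ω.keyA t := by
  intro hs
  refine h ?_
  by_cases hd : .inl (ω.dh t) ∈ ω.asked groups corrupt prog σ
  · exact Or.inl ⟨t, hd⟩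
  · exact Or.inr (Or.inl ⟨t, hd, Or.inr hs⟩)

/-- Real and idealised runs are indistinguishable up to the probability of a compromise. -/
theorem prob_ideal_le {E : Sample P n r m T → Config (List (Fin n × Fin n)) → Prop}
    (hE : ∀ ω runs c, E ω c → E (ω.swapRuns groups runs) c) :
    prob (Sample P n r m T) (fun ω => E ω (ω.idealFin groups corrupt prog σ)) ≤
      prob (Sample P n r m T) (fun ω => E ω (ω.realFin groups corrupt prog σ)) +
      prob (Sample P n r m T) (Sample.Compromised groups corrupt prog σ) := by
  refine le_trans ?_ (add_le_add (prob_ideal_le_prob_real (groups := groups) (corrupt := corrupt)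
    (prog := prog) (σ := σ) (Good := fun ω => ¬ ω.Compromised groups corrupt prog σ) hE ?_ ?_ ?_)
    le_rfl)
  · refine le_trans (prob_mono fun ω hω => ?_) (prob_or_le _ _)
    by_cases h : ω.Compromised groups corrupt prog σ
    · exact Or.inr h
    · exact Or.inl ⟨h, hω⟩
  · intro ω h
    by_contra hk
    exact h (Or.inr (Or.inr (Or.inl hk)))
  · intro ω h l
    refine Sample.array_injective groups ?_ l
    by_contra hk
    exact h (Or.inr (Or.inr (Or.inr hk)))
  · exact fun ω => Sample.not_askedKey groups corrupt prog σ

/-- The transfer between the games only gives lower bounds for the real game, so it is applied to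
the event that no key is output. This event contains the complement of a compromise. -/
theorem prob_output_key_le :
    prob (Sample P n r m T) (fun ω => ∃ t, (ω.realFin groups corrupt prog σ).mem 0 1 = ω.keyA t) ≤
      prob (Sample P n r m T) (Sample.Compromised groups corrupt prog σ) := by
  have h1 := prob_ideal_le_prob_real (groups := groups) (corrupt := corrupt)
    (prog := prog) (σ := σ) (P := P) (T := T) (m := m)
    (Good := fun ω => ¬ ω.Compromised groups corrupt prog σ)
    (E := fun ω c => ¬ ∃ t, c.mem 0 1 = ω.keyA t) (fun ω runs c h => h) ?_ ?_ ?_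
  · have h2 : prob (Sample P n r m T) (fun ω => ¬ ω.Compromised groups corrupt prog σ) ≤
        prob (Sample P n r m T) (fun ω => ¬ ω.Compromised groups corrupt prog σ ∧
          ¬ ∃ t, (ω.idealFin groups corrupt prog σ).mem 0 1 = ω.keyA t) :=
      prob_mono fun ω h => ⟨h, fun ⟨t, ht⟩ => Sample.output_ne_key groups corrupt prog σ h t ht⟩
    have h3 := h2.trans h1
    rw [prob_not, prob_not] at h3
    linarith
  · intro ω h
    by_contra hk
    exact h (Or.inr (Or.inr (Or.inl hk)))
  · intro ω h l
    refine Sample.array_injective groups ?_ l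
    by_contra hk
    exact h (Or.inr (Or.inr (Or.inr hk)))
  · exact fun ω => Sample.not_askedKey groups corrupt prog σ

end Events

/-! ### Verification of programs without oracle calls -/

/-- The term only reads arrays with index less than `K`. -/
def ATerm.Priv (K : ℕ) : ATerm → Prop
  | .lit _ => True
  | .get a i => a < K ∧ i.Priv K
  | .add s t => s.Priv K ∧ t.Priv K
  | .sub s t => s.Priv K ∧ t.Priv K
  | .mul s t => s.Priv K ∧ t.Priv K
  | .div s t => s.Priv K ∧ t.Priv K

/-- A bound for the bit length of the value of a term, relative to that of the memory. -/
def ATerm.sz : ATerm → ℕ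
  | .lit n => n.size
  | .get _ _ => 1
  | .add s t => s.sz + t.sz + 1
  | .sub s _ => s.sz
  | .mul s t => s.sz + t.sz
  | .div s _ => s.sz

/-- A bound for the cost of a term, relative to the bit length of the memory. -/
def ATerm.wt : ATerm → ℕ
  | .lit n => 1 + n.size
  | .get _ i => i.wt + 2
  | .add s t => s.wt + t.wt + (1 + (s.sz + t.sz + 1))
  | .sub s t => s.wt + t.wt + (1 + s.sz)
  | .mul s t => s.wt + t.wt + (1 + (s.sz + t.sz))
  | .div s t => s.wt + t.wt + (1 + s.sz)

/-- The numbers in the first `K` arrays have at most `S` bits. -/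
def Small (K S : ℕ) (M : Memory) : Prop := ∀ a < K, ∀ i, (M a i).size ≤ S

theorem size_add_le (a b : ℕ) : (a + b).size ≤ a.size + b.size + 1 := by
  rw [Nat.size_le]
  have h1 := Nat.lt_size_self a
  have h2 := Nat.lt_size_self b
  have h3 : 2 ^ a.size ≤ 2 ^ (a.size + b.size) := Nat.pow_le_pow_right (by norm_num) (by omega)
  have h4 : 2 ^ b.size ≤ 2 ^ (a.size + b.size) := Nat.pow_le_pow_right (by norm_num) (by omega)
  rw [pow_succ]
  omega

theorem size_mul_le (a b : ℕ) : (a * b).size ≤ a.size + b.size := by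
  rw [Nat.size_le, pow_add]
  exact Nat.mul_lt_mul'' (Nat.lt_size_self a) (Nat.lt_size_self b)

theorem ATerm.size_eval_le {K S : ℕ} {M : Memory} (hM : Small K S M) (hS : 1 ≤ S) :
    ∀ e : ATerm, e.Priv K → (e.eval M).size ≤ e.sz * S
  | .lit n, _ => Nat.le_mul_of_pos_right _ hS
  | .get a i, h => by simpa [ATerm.eval, ATerm.sz] using hM a h.1 _
  | .add s t, h => by
    have h1 := s.size_eval_le hM hS h.1
    have h2 := t.size_eval_le hM hS h.2
    have h3 := size_add_le (s.eval M) (t.eval M)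
    simp only [ATerm.eval, ATerm.sz, add_mul]
    omega
  | .mul s t, h => by
    have h1 := s.size_eval_le hM hS h.1
    have h2 := t.size_eval_le hM hS h.2
    have h3 := size_mul_le (s.eval M) (t.eval M)
    simp only [ATerm.eval, ATerm.sz, add_mul]
    omega
  | .sub s t, h => (Nat.size_le_size (Nat.sub_le _ _)).trans (s.size_eval_le hM hS h.1)
  | .div s t, h => (Nat.size_le_size (Nat.div_le_self _ _)).trans (s.size_eval_le hM hS h.1)

theorem ATerm.cost_le {K S : ℕ} {M : Memory} (hM : Small K S M) (hS : 1 ≤ S) :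
    ∀ e : ATerm, e.Priv K → e.cost M ≤ e.wt * S
  | .lit n, _ => Nat.le_mul_of_pos_right _ hS
  | .get a i, h => by
    have h1 := i.cost_le hM hS h.2
    have h2 := hM a h.1 (i.eval M)
    simp only [ATerm.cost, ATerm.wt, add_mul]
    omega
  | .add s t, h => by
    have h1 := s.cost_le hM hS h.1
    have h2 := t.cost_le hM hS h.2
    have h3 := (ATerm.add s t).size_eval_le hM hS h
    simp only [ATerm.cost, ATerm.wt, ATerm.eval, ATerm.sz, add_mul] at *
    omega
  | .mul s t, h => by
    have h1 := s.cost_le hM hS h.1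
    have h2 := t.cost_le hM hS h.2
    have h3 := (ATerm.mul s t).size_eval_le hM hS h
    simp only [ATerm.cost, ATerm.wt, ATerm.eval, ATerm.sz, add_mul] at *
    omega
  | .sub s t, h => by
    have h1 := s.cost_le hM hS h.1
    have h2 := t.cost_le hM hS h.2
    have h3 := (ATerm.sub s t).size_eval_le hM hS h
    simp only [ATerm.cost, ATerm.wt, ATerm.eval, ATerm.sz, add_mul] at *
    omega
  | .div s t, h => by
    have h1 := s.cost_le hM hS h.1
    have h2 := t.cost_le hM hS h.2
    have h3 := (ATerm.div s t).size_eval_le hM hS h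
    simp only [ATerm.cost, ATerm.wt, ATerm.eval, ATerm.sz, add_mul] at *
    omega

theorem ATerm.cost_pos (M : Memory) (e : ATerm) : (e.eval M).size < e.cost M := by
  cases e <;> simp only [ATerm.eval, ATerm.cost] <;> omega

/-- A bound for the running time, if all loops make at most `S` iterations. -/
def Prog.bound (S : ℕ) : Prog → ℕ
  | .skip => 1
  | .store _ i e => (1 + i.wt + e.wt) * S
  | .flip _ i e => (2 + i.wt + e.wt) * S
  | .call _ _ _ _ => 0
  | .seq p q => 1 + p.bound S + q.bound S
  | .ite e p q => (1 + e.wt) * S + p.bound S + q.bound S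
  | .loop e p => (S + 1) * ((1 + e.wt) * S + p.bound S)

/-- The solver needs a polynomial clock; for a fixed program the bound is built from `S` by sums and
products. -/
theorem Prog.bound_eq_polynomial (P : Prog) : ∃ q : Polynomial ℕ, ∀ S, P.bound S = q.eval S := by
  induction P with
  | skip => exact ⟨1, by simp [Prog.bound]⟩
  | store a i e =>
    exact ⟨Polynomial.C (1 + i.wt + e.wt) * Polynomial.X, by simp [Prog.bound]⟩
  | flip a i e =>
    exact ⟨Polynomial.C (2 + i.wt + e.wt) * Polynomial.X, by simp [Prog.bound]⟩
  | call => exact ⟨0, by simp [Prog.bound]⟩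
  | seq p q hp hq =>
    obtain ⟨p', hp⟩ := hp
    obtain ⟨q', hq⟩ := hq
    exact ⟨1 + p' + q', by simp [Prog.bound, hp, hq]⟩
  | ite e p q hp hq =>
    obtain ⟨p', hp⟩ := hp
    obtain ⟨q', hq⟩ := hq
    exact ⟨Polynomial.C (1 + e.wt) * Polynomial.X + p' + q', by simp [Prog.bound, hp, hq]⟩
  | loop e p hp =>
    obtain ⟨p', hp⟩ := hp
    exact ⟨(Polynomial.X + 1) * (Polynomial.C (1 + e.wt) * Polynomial.X + p'), by
      simp [Prog.bound, hp]⟩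

/-- The configuration `c'` is reached from `c` without oracle. -/
def Reach (tape : ℕ → Bool) (c c' : Config Unit) : Prop :=
  ∃ N, (step tape noOracle)^[N] c = c'

theorem Reach.refl (tape : ℕ → Bool) (c : Config Unit) : Reach tape c c := ⟨0, rfl⟩

theorem Reach.trans {tape : ℕ → Bool} {c c' c'' : Config Unit} (h : Reach tape c c')
    (h' : Reach tape c' c'') : Reach tape c c'' := by
  obtain ⟨N, rfl⟩ := h
  obtain ⟨N', rfl⟩ := h'
  exact ⟨N' + N, Function.iterate_add_apply _ _ _ _⟩

theorem Reach.step {tape : ℕ → Bool} {c c' : Config Unit} (h : Reach tape (step tape noOracle c) c') :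
    Reach tape c c' := Reach.trans ⟨1, rfl⟩ h

/-- Started on memory `M` after `k` coin tosses, the program halts within its time bound, keeps the
first `K` arrays small, and ends in memory and with coins that satisfy `Q`. -/
def Does (K S : ℕ) (tape : ℕ → Bool) (P : Prog) (M : Memory) (k : ℕ) (Q : Memory → ℕ → Prop) :
    Prop :=
  Small K S M → ∀ rest s, ∃ M' k' t, Reach tape ⟨P :: rest, M, k, (), s⟩ ⟨rest, M', k', (), s + t⟩ ∧
    t ≤ P.bound S ∧ Small K S M' ∧ Q M' k'

/-! ### Rules of a program logic with time and size bounds -/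

section Does

variable {K S : ℕ} {tape : ℕ → Bool} {M : Memory} {k : ℕ} {Q Q' : Memory → ℕ → Prop}

theorem Small.write (hM : Small K S M) {a i v : ℕ} (h : a < K → v.size ≤ S) :
    Small K S (M.write a i v) := by
  intro b hb j
  unfold Memory.write
  split_ifs with hc
  · exact h (hc.1 ▸ hb)
  · exact hM b hb j

theorem Memory.write_self (M : Memory) (a i v : ℕ) : M.write a i v a i = v := by
  simp [Memory.write]

theorem Memory.write_of_ne (M : Memory) {a i v b j : ℕ} (h : ¬ (b = a ∧ j = i)) :
    M.write a i v b j = M b j := by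
  simp [Memory.write, h]

theorem Does.mono {P : Prog} (h : Does K S tape P M k Q)
    (hQ : ∀ M' k', Small K S M' → Q M' k' → Q' M' k') : Does K S tape P M k Q' := by
  intro hM rest s
  obtain ⟨M', k', t, h1, h2, h3, h4⟩ := h hM rest s
  exact ⟨M', k', t, h1, h2, h3, hQ _ _ h3 h4⟩

theorem Does.skip (h : Q M k) : Does K S tape .skip M k Q := by
  intro hM rest s
  exact ⟨M, k, 1, ⟨1, rfl⟩, le_rfl, hM, h⟩

theorem Does.store (hS : 1 ≤ S) {a : ℕ} {i e : ATerm} (hi : i.Priv K) (he : e.Priv K)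
    (hv : a < K → (e.eval M).size ≤ S) (h : Q (M.write a (i.eval M) (e.eval M)) k) :
    Does K S tape (.store a i e) M k Q := by
  intro hM rest s
  refine ⟨_, _, 1 + i.cost M + e.cost M, ⟨1, rfl⟩, ?_, hM.write hv, h⟩
  have h1 := i.cost_le hM hS hi
  have h2 := e.cost_le hM hS he
  simp only [Prog.bound, add_mul]
  omega

theorem coinNumber_lt (coin : ℕ → Bool) (pos len : ℕ) : coinNumber coin pos len < 2 ^ len := by
  induction len with
  | zero => simp [coinNumber]
  | succ len ih =>
    unfold coinNumber at ih ⊢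
    rw [Finset.sum_range_succ, pow_succ]
    split_ifs <;> omega

theorem Does.flip (hS : 1 ≤ S) {a : ℕ} {i e : ATerm} (hi : i.Priv K) (he : e.Priv K)
    (hv : e.eval M ≤ S)
    (h : Q (M.write a (i.eval M) (coinNumber tape k (e.eval M))) (k + e.eval M)) :
    Does K S tape (.flip a i e) M k Q := by
  intro hM rest s
  refine ⟨_, _, 1 + i.cost M + e.cost M + e.eval M, ⟨1, rfl⟩, ?_, hM.write fun _ => ?_, h⟩
  · have h1 := i.cost_le hM hS hi
    have h2 := e.cost_le hM hS he
    simp only [Prog.bound, add_mul]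
    omega
  · exact (Nat.size_le.2 (coinNumber_lt _ _ _)).trans hv

theorem Does.seq {p q : Prog} (h : Does K S tape p M k fun M' k' => Does K S tape q M' k' Q) :
    Does K S tape (.seq p q) M k Q := by
  intro hM rest s
  obtain ⟨M', k', t, h1, h2, h3, h4⟩ := h hM (q :: rest) (s + 1)
  obtain ⟨M'', k'', t', h1', h2', h3', h4'⟩ := h4 h3 rest (s + 1 + t)
  refine ⟨M'', k'', 1 + t + t', Reach.step (h1.trans ?_), ?_, h3', h4'⟩
  · convert h1' using 2
    omega
  · simp only [Prog.bound]
    omega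

theorem Does.ite (hS : 1 ≤ S) {e : ATerm} {p q : Prog} (he : e.Priv K)
    (h1 : e.eval M ≠ 0 → Does K S tape p M k Q) (h2 : e.eval M = 0 → Does K S tape q M k Q) :
    Does K S tape (.ite e p q) M k Q := by
  intro hM rest s
  have hc := e.cost_le hM hS he
  by_cases hz : e.eval M = 0
  · obtain ⟨M', k', t, h1, h2, h3, h4⟩ := h2 hz hM rest (s + (1 + e.cost M))
    refine ⟨M', k', 1 + e.cost M + t, Reach.step ?_, ?_, h3, h4⟩
    · simp only [PrivateHandshake.step, hz, ne_eq, not_true_eq_false, if_false]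
      convert h1 using 2
      omega
    · simp only [Prog.bound, add_mul]
      omega
  · obtain ⟨M', k', t, h1, h2, h3, h4⟩ := h1 hz hM rest (s + (1 + e.cost M))
    refine ⟨M', k', 1 + e.cost M + t, Reach.step ?_, ?_, h3, h4⟩
    · simp only [PrivateHandshake.step, hz, ne_eq, not_false_eq_true, if_true]
      convert h1 using 2
      omega
    · simp only [Prog.bound, add_mul]
      omega

/-- `I j` is the invariant after `j` iterations. The number `N` of iterations is known exactly, and
`N ≤ S` because `Prog.bound` pays for `S` iterations and a last test. -/
theorem Does.loop (hS : 1 ≤ S) {e : ATerm} {p : Prog} (he : e.Priv K) (I : ℕ → Memory → ℕ → Prop)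
    {N : ℕ} (hN : N ≤ S) (h0 : I 0 M k)
    (hI : ∀ j < N, ∀ M k, Small K S M → I j M k →
      e.eval M ≠ 0 ∧ Does K S tape p M k (I (j + 1)))
    (hend : ∀ M k, Small K S M → I N M k → e.eval M = 0 ∧ Q M k) :
    Does K S tape (.loop e p) M k Q := by
  have main : ∀ (d j : ℕ) (M : Memory) (k : ℕ), j + d = N → I j M k → Small K S M → ∀ rest s,
      ∃ M' k' t, Reach tape ⟨.loop e p :: rest, M, k, (), s⟩ ⟨rest, M', k', (), s + t⟩ ∧
        t ≤ (d + 1) * ((1 + e.wt) * S + p.bound S) ∧ Small K S M' ∧ Q M' k' := by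
    intro d
    induction d with
    | zero =>
      intro j M k hj hIj hM rest s
      rw [Nat.add_zero] at hj
      subst hj
      obtain ⟨hz, hQ⟩ := hend M k hM hIj
      have hc := e.cost_le hM hS he
      refine ⟨M, k, 1 + e.cost M, Reach.step ?_, ?_, hM, hQ⟩
      · simp only [PrivateHandshake.step, hz]
        exact Reach.refl _ _
      · simp only [add_mul]
        omega
    | succ d ih =>
      intro j M k hj hIj hM rest s
      obtain ⟨hz, hp⟩ := hI j (by omega) M k hM hIj
      have hc := e.cost_le hM hS he
      obtain ⟨M', k', t, h1, h2, h3, h4⟩ := hp hM (.loop e p :: rest) (s + (1 + e.cost M))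
      obtain ⟨M'', k'', t', h1', h2', h3', h4'⟩ :=
        ih (j + 1) M' k' (by omega) h4 h3 rest (s + (1 + e.cost M) + t)
      refine ⟨M'', k'', 1 + e.cost M + t + t', Reach.step ?_, ?_, h3', h4'⟩
      · simp only [PrivateHandshake.step, hz, ne_eq, not_false_eq_true, if_true]
        refine h1.trans ?_
        convert h1' using 2
        omega
      · rw [add_mul (d + 1) 1]
        simp only [add_mul] at h2' ⊢
        omega
  intro hM rest s
  obtain ⟨M', k', t, h1, h2, h3, h4⟩ := main N 0 M k (by omega) h0 hM rest s
  refine ⟨M', k', t, h1, h2.trans ?_, h3, h4⟩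
  simp only [Prog.bound]
  gcongr

/-- Do a list of programs one after the other. -/
def seqList : List Prog → Prog
  | [] => .skip
  | p :: l => .seq p (seqList l)

theorem Does.seqList (I : ℕ → Memory → ℕ → Prop) (l : List Prog) (h0 : I 0 M k)
    (hI : ∀ j (hj : j < l.length), ∀ M k, Small K S M → I j M k → Does K S tape l[j] M k (I (j + 1))) :
    Does K S tape (seqList l) M k (I l.length) := by
  induction l generalizing M k I with
  | nil => exact Does.skip h0
  | cons p l ih =>
    intro hM
    refine Does.seq ?_ hM
    refine (hI 0 (by simp) M k hM h0).mono fun M' k' hM' h => ?_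
    exact ih (fun j => I (j + 1)) h fun j hj => hI (j + 1) (by simpa using hj)

end Does

/-- Terms for the remainder and for the test of equality. -/
def ATerm.mod (s t : ATerm) : ATerm := .sub s (.mul (.div s t) t)

/-- The value is `1` or `0`. -/
def ATerm.eq (s t : ATerm) : ATerm := .sub (.lit 1) (.add (.sub s t) (.sub t s))

theorem ATerm.eval_mod (M : Memory) (s t : ATerm) : (s.mod t).eval M = s.eval M % t.eval M := by
  simp only [ATerm.mod, ATerm.eval]
  rw [Nat.mod_eq_sub_div_mul]

theorem ATerm.eval_eq (M : Memory) (s t : ATerm) :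
    (s.eq t).eval M = if s.eval M = t.eval M then 1 else 0 := by
  simp only [ATerm.eq, ATerm.eval]
  split_ifs <;> omega

theorem ATerm.priv_mod {K : ℕ} {s t : ATerm} : (s.mod t).Priv K ↔ s.Priv K ∧ t.Priv K := by
  simp only [ATerm.mod, ATerm.Priv]
  tauto

theorem ATerm.priv_eq {K : ℕ} {s t : ATerm} : (s.eq t).Priv K ↔ s.Priv K ∧ t.Priv K := by
  simp only [ATerm.eq, ATerm.Priv]
  tauto

/-- The scalar variable number `c`. -/
abbrev var (c : ℕ) : ATerm := .get 0 (.lit c)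

/-- Assignment to the scalar variable number `c`. -/
abbrev assign (c : ℕ) (e : ATerm) : Prog := .store 0 (.lit c) e

/-- Polynomials in the first input can be written as terms. -/
theorem exists_polynomial_term (q : Polynomial ℕ) :
    ∃ e : ATerm, (∀ K, 0 < K → e.Priv K) ∧ ∀ M : Memory, e.eval M = q.eval (M 0 0) := by
  induction q using Polynomial.induction_on' with
  | add q q' h h' =>
    obtain ⟨e, h1, h2⟩ := h
    obtain ⟨e', h1', h2'⟩ := h'
    exact ⟨.add e e', fun K hK => ⟨h1 K hK, h1' K hK⟩, fun M => by simp [ATerm.eval, h2, h2']⟩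
  | monomial d a =>
    induction d with
    | zero => exact ⟨.lit a, fun _ _ => trivial, fun M => by simp [ATerm.eval]⟩
    | succ d ih =>
      obtain ⟨e, h1, h2⟩ := ih
      refine ⟨.mul e (var 0), fun K hK => ⟨h1 K hK, hK, trivial⟩, fun M => ?_⟩
      simp [ATerm.eval, h2, pow_succ, mul_assoc]

/-- A term for a polynomial in the first input. -/
noncomputable def polyTerm (q : Polynomial ℕ) : ATerm := (exists_polynomial_term q).choose

theorem priv_polyTerm (q : Polynomial ℕ) {K : ℕ} (hK : 0 < K) : (polyTerm q).Priv K :=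
  (exists_polynomial_term q).choose_spec.1 K hK

theorem eval_polyTerm (q : Polynomial ℕ) (M : Memory) : (polyTerm q).eval M = q.eval (M 0 0) :=
  (exists_polynomial_term q).choose_spec.2 M

/-! ### Two subroutines -/

/-- Put `2 ^ e` into variable `c`. -/
def powTwoProg (c : ℕ) (e : ATerm) : Prog :=
  .seq (assign 10 e) (.seq (assign c (.lit 1))
    (.loop (var 10) (.seq (assign c (.mul (.lit 2) (var c))) (assign 10 (.sub (var 10) (.lit 1))))))

/-- Put `g ^ e mod p` into variable `12`, where `g`, `p`, `e` are the variables `2`, `1`, `11`. -/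
def powModProg : Prog :=
  .seq (assign 12 (.lit 1)) (.seq (assign 13 (var 2))
    (.loop (var 11)
      (.seq (.ite (.mod (var 11) (.lit 2)) (assign 12 (.mod (.mul (var 12) (var 13)) (var 1))) .skip)
        (.seq (assign 13 (.mod (.mul (var 13) (var 13)) (var 1)))
          (assign 11 (.div (var 11) (.lit 2)))))))

/-- Two memories agree except for some scalar variables. -/
def AgreeExcept (s : Finset ℕ) (M M' : Memory) : Prop :=
  ∀ a i, ¬ (a = 0 ∧ i ∈ s) → M' a i = M a i

section Subroutines

variable {K S : ℕ} {tape : ℕ → Bool} {M : Memory} {k : ℕ}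

/-- Variable `10` counts down while `c` is doubled. The strict bound in `hv` is needed because `2 ^
E` has `E + 1` bits. -/
theorem does_powTwoProg (hK : 0 < K) (hS : 1 ≤ S) {c : ℕ} (hc : c ≠ 10) {e : ATerm} (he : e.Priv K)
    (hv : e.eval M < S) :
    Does K S tape (powTwoProg c e) M k fun M' k' =>
      k' = k ∧ M' 0 c = 2 ^ e.eval M ∧ AgreeExcept {10, c} M M' := by
  set E := e.eval M with hE
  refine Does.seq (Does.store hS trivial he (fun _ => ?_) ?_)
  · exact (Nat.size_le.2 Nat.lt_two_pow_self).trans hv.le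
  refine Does.seq (Does.store hS trivial trivial (fun _ => by simpa [ATerm.eval] using hS) ?_)
  refine Does.loop hS ⟨hK, trivial⟩ (fun j M' k' => j ≤ E ∧ k' = k ∧ M' 0 10 = E - j ∧
    M' 0 c = 2 ^ j ∧ AgreeExcept {10, c} M M') (N := E) hv.le ?_ ?_ ?_
  · refine ⟨Nat.zero_le _, rfl, ?_, ?_, ?_⟩
    · simp [Memory.write, ATerm.eval, hc.symm, hE]
    · simp [Memory.write, ATerm.eval]
    · intro a i hai
      simp only [Finset.mem_insert, Finset.mem_singleton] at hai
      rw [Memory.write_of_ne, Memory.write_of_ne] <;> simp only [ATerm.eval] <;> tauto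
  · rintro j hj M' k' hM' ⟨_, rfl, h1, h2, h3⟩
    refine ⟨by simp [ATerm.eval, h1]; omega, ?_⟩
    refine Does.seq (Does.store hS trivial ⟨trivial, hK, trivial⟩ (fun _ => ?_) ?_)
    · simp only [ATerm.eval, h2]
      rw [Nat.size_le, ← pow_succ']
      exact Nat.pow_lt_pow_right (by norm_num) (by omega)
    refine Does.store hS trivial ⟨⟨hK, trivial⟩, trivial⟩ (fun _ => ?_) ?_
    · simp only [ATerm.eval, Memory.write, hc.symm, and_false, if_false]
      exact (Nat.size_le_size (Nat.sub_le _ _)).trans (hM' 0 hK _)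
    refine ⟨hj, rfl, ?_, ?_, ?_⟩
    · simp [Memory.write, ATerm.eval, hc.symm, h1]
      omega
    · simp [Memory.write, ATerm.eval, hc, h2, pow_succ']
    · intro a i hai
      rw [← h3 a i hai]
      simp only [Finset.mem_insert, Finset.mem_singleton] at hai
      rw [Memory.write_of_ne, Memory.write_of_ne] <;> simp only [ATerm.eval] <;> tauto
  · rintro M' k' hM' ⟨_, rfl, h1, h2, h3⟩
    exact ⟨by simp [ATerm.eval, h1], rfl, h2, h3⟩

theorem div_two_pow_ne_zero {e j : ℕ} (h : j < e.size) : e / 2 ^ j ≠ 0 := by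
  rw [Nat.lt_size] at h
  exact (Nat.div_pos h (by positivity)).ne'

theorem div_two_pow_size (e : ℕ) : e / 2 ^ e.size = 0 :=
  Nat.div_eq_of_lt (Nat.lt_size_self e)

/-- Square and multiply. After `j` iterations variable `11` holds `E / 2 ^ j`, and (variable 12) ·
(variable 13) ^ (`E / 2 ^ j`) is congruent to `g ^ E`. The remaining exponent vanishes after exactly
`E.size` iterations. -/
theorem does_powModProg (hK : 0 < K) (hS : 1 ≤ S) {p g E : ℕ} (hp : 2 ≤ p) (hg : g < p)
    (h1 : M 0 1 = p) (h2 : M 0 2 = g) (h11 : M 0 11 = E) :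
    Does K S tape powModProg M k fun M' k' =>
      k' = k ∧ M' 0 12 = g ^ E % p ∧ AgreeExcept {11, 12, 13} M M' := by
  intro hM
  have hpS : p.size ≤ S := h1 ▸ hM 0 hK 1
  have hES : E.size ≤ S := h11 ▸ hM 0 hK 11
  have small : ∀ {v}, v < p → v.size ≤ S := fun h => (Nat.size_le_size h.le).trans hpS
  revert hM
  refine Does.seq (Does.store hS trivial trivial (fun _ => by simpa [ATerm.eval] using hS) ?_)
  refine Does.seq (Does.store hS trivial ⟨hK, trivial⟩ (fun _ => ?_) ?_)
  · simp only [ATerm.eval, Memory.write]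
    norm_num
    rw [h2]
    exact small hg
  refine Does.loop hS ⟨hK, trivial⟩ (fun j M' k' => k' = k ∧ M' 0 11 = E / 2 ^ j ∧
    M' 0 12 < p ∧ M' 0 13 < p ∧ M' 0 12 * M' 0 13 ^ (E / 2 ^ j) ≡ g ^ E [MOD p] ∧
    AgreeExcept {11, 12, 13} M M') hES ?_ ?_ ?_
  · refine ⟨rfl, ?_, ?_, ?_, ?_, ?_⟩
    · simp [Memory.write, ATerm.eval, h11]
    · simp [Memory.write, ATerm.eval]; omega
    · simpa [Memory.write, ATerm.eval, h2] using hg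
    · simp [Memory.write, ATerm.eval, h2]
      rfl
    · intro a i hai
      simp only [Finset.mem_insert, Finset.mem_singleton] at hai
      rw [Memory.write_of_ne, Memory.write_of_ne] <;> simp only [ATerm.eval] <;> tauto
  · rintro j hj M' k' hM' ⟨rfl, a11, a12, a13, ac, ax⟩
    have b1 : M' 0 1 = p := by rw [ax 0 1 (by simp), h1]
    refine ⟨by simpa [ATerm.eval, a11] using div_two_pow_ne_zero hj, ?_⟩
    set e := E / 2 ^ j with he
    have he' : E / 2 ^ (j + 1) = e / 2 := by rw [he, pow_succ, Nat.div_div_eq_div_mul]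
    rw [he']
    -- A common description of the memory after either branch of the parity test, so that the rest
    -- of the loop body is verified only once.
    set M₁ := M'.write 0 12 (if e % 2 = 0 then M' 0 12 else M' 0 12 * M' 0 13 % p) with hM₁
    have hpp : ∀ v : ℕ, v % p < p := fun v => Nat.mod_lt _ (by omega)
    have hfin : Does K S tape (.seq (assign 13 (.mod (.mul (var 13) (var 13)) (var 1)))
          (assign 11 (.div (var 11) (.lit 2)))) M₁ k' fun M' k'_1 =>
        k'_1 = k' ∧ M' 0 11 = e / 2 ∧ M' 0 12 < p ∧ M' 0 13 < p ∧
        M' 0 12 * M' 0 13 ^ (e / 2) ≡ g ^ E [MOD p] ∧ AgreeExcept {11, 12, 13} M M' := by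
      refine Does.seq (Does.store hS trivial (ATerm.priv_mod.2 (by simp [ATerm.Priv, hK]))
        (fun _ => ?_) ?_)
      · rw [ATerm.eval_mod]
        apply small
        simp [ATerm.eval, hM₁, Memory.write, b1, hpp]
      refine Does.store hS trivial (by simp [ATerm.Priv, hK]) (fun _ => ?_) ?_
      · refine (Nat.size_le_size (Nat.div_le_self _ _)).trans ?_
        simp only [ATerm.eval, ATerm.eval_mod, hM₁, Memory.write]
        norm_num
        exact hM' 0 hK 11
      refine ⟨rfl, ?_, ?_, ?_, ?_, ?_⟩
      · simp [Memory.write, ATerm.eval, hM₁, a11]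
      · simp only [Memory.write, ATerm.eval, hM₁]
        norm_num
        split_ifs
        · exact a12
        · exact hpp _
      · simp [Memory.write, ATerm.eval, ATerm.eval_mod, hM₁, b1, hpp]
      · simp only [Memory.write, ATerm.eval, ATerm.eval_mod, hM₁]
        norm_num
        rw [b1]
        refine Nat.ModEq.trans ?_ ac
        have hsq : (M' 0 13 * M' 0 13 % p) ^ (e / 2) ≡ M' 0 13 ^ (2 * (e / 2)) [MOD p] := by
          rw [pow_mul, pow_two]
          exact (Nat.mod_modEq _ _).pow _
        split_ifs with hpar
        · have : 2 * (e / 2) = e := by omega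
          rw [this] at hsq
          exact hsq.mul_left _
        · have : e = 2 * (e / 2) + 1 := by omega
          calc _ ≡ (M' 0 12 * M' 0 13) * M' 0 13 ^ (2 * (e / 2)) [MOD p] :=
                (Nat.mod_modEq _ _).mul hsq
            _ ≡ M' 0 12 * M' 0 13 ^ e [MOD p] := by
              conv_rhs => rw [this]
              rw [pow_succ]
              exact congrArg (· % p) (by ring)
      · intro a i hai
        rw [← ax a i hai]
        simp only [Finset.mem_insert, Finset.mem_singleton] at hai
        rw [Memory.write_of_ne, Memory.write_of_ne, hM₁, Memory.write_of_ne] <;>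
          (try simp only [ATerm.eval]) <;> tauto
    refine Does.seq (Does.ite hS (ATerm.priv_mod.2 (by simp [ATerm.Priv, hK])) ?_ ?_)
    · intro hodd
      rw [ATerm.eval_mod] at hodd
      simp only [ATerm.eval, a11] at hodd
      refine Does.store hS trivial (ATerm.priv_mod.2 (by simp [ATerm.Priv, hK])) (fun _ => ?_) ?_
      · rw [ATerm.eval_mod]
        apply small
        simp [ATerm.eval, b1, hpp]
      rw [hM₁, if_neg hodd] at hfin
      rw [ATerm.eval_mod]
      simpa only [ATerm.eval, b1] using hfin
    · intro heven
      rw [ATerm.eval_mod] at heven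
      simp only [ATerm.eval, a11] at heven
      refine Does.skip ?_
      rw [hM₁, if_pos heven] at hfin
      convert hfin using 1
      funext a i
      unfold Memory.write
      split_ifs with hai
      · rw [hai.1, hai.2]
      · rfl
  · rintro M' k' hM' ⟨rfl, a11, a12, a13, ac, ax⟩
    rw [div_two_pow_size] at a11 ac
    rw [pow_zero, mul_one, Nat.ModEq, Nat.mod_eq_of_lt a12] at ac
    exact ⟨a11, rfl, ac, ax⟩

end Subroutines

/-! ### The preparations of the solver -/

/-- The kinds of random values that the solver needs: guesses of a run and of a query, exponents of
Alice and Bob, answers of the random oracles (keys and hashes), ideal hashes of Alice and Bob,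
group secrets, and random values in the arrays. -/
inductive Kind (n r m : ℕ) : Type
  | run
  | ask
  | x
  | y
  | key
  | hash
  | idealA (c : Fin m)
  | idealB (c : Fin m)
  | secret (G : Fin r)
  | filler (l : Fin n) (c : Fin m)

/-- Kinds as elements of a sum type. -/
def Kind.toSum {n r m : ℕ} : Kind n r m → Fin 6 ⊕ Fin m ⊕ Fin m ⊕ Fin r ⊕ (Fin n × Fin m)
  | .run => .inl 0
  | .ask => .inl 1
  | .x => .inl 2
  | .y => .inl 3
  | .key => .inl 4
  | .hash => .inl 5
  | .idealA c => .inr (.inl c)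
  | .idealB c => .inr (.inr (.inl c))
  | .secret G => .inr (.inr (.inr (.inl G)))
  | .filler l c => .inr (.inr (.inr (.inr (l, c))))

noncomputable instance (n r m : ℕ) : Fintype (Kind n r m) :=
  Fintype.ofInjective Kind.toSum (by
    intro a b h
    cases a <;> cases b <;> simp_all [Kind.toSum])

section Kinds

variable {n r m : ℕ}

/-- The number of a kind. -/
noncomputable def Kind.code (k : Kind n r m) : ℕ := Fintype.equivFin (Kind n r m) k

theorem Kind.code_lt (k : Kind n r m) : k.code < Fintype.card (Kind n r m) :=
  (Fintype.equivFin (Kind n r m) k).2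

theorem Kind.code_injective : Function.Injective (Kind.code : Kind n r m → ℕ) :=
  fun _ _ h => (Fintype.equivFin (Kind n r m)).injective (Fin.ext h)

/-- The list of all kinds. -/
noncomputable def kindList (n r m : ℕ) : List (Kind n r m) :=
  List.ofFn (Fintype.equivFin (Kind n r m)).symm

theorem length_kindList : (kindList n r m).length = Fintype.card (Kind n r m) := by
  simp [kindList]

theorem code_getElem_kindList (j : ℕ) (hj : j < (kindList n r m).length) :
    (kindList n r m)[j].code = j := by
  simp [kindList, Kind.code]

/-- The array in which the solver keeps the values of a kind. -/
noncomputable def Kind.arr (k : Kind n r m) : ℕ := 4 + k.code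

/-- The number of arrays of the solver itself. -/
noncomputable def offset (n r m : ℕ) : ℕ := 4 + Fintype.card (Kind n r m)

theorem Kind.arr_lt (k : Kind n r m) : k.arr < offset n r m :=
  Nat.add_lt_add_left k.code_lt 4

theorem Kind.le_arr (k : Kind n r m) : 4 ≤ k.arr := Nat.le_add_right _ _

theorem Kind.arr_inj {k k' : Kind n r m} : k.arr = k'.arr ↔ k = k' :=
  ⟨fun h => Kind.code_injective (Nat.add_left_cancel h), fun h => h ▸ rfl⟩

theorem offset_pos : 0 < offset n r m := by unfold offset; omega

theorem four_le_offset : 4 ≤ offset n r m := by unfold offset; omega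

/-- The variable that holds the modulus for a kind. -/
def Kind.modCell : Kind n r m → ℕ
  | .run => 5
  | .ask => 5
  | .x => 1
  | .y => 1
  | .key => 6
  | .hash => 8
  | .idealA _ => 8
  | .idealB _ => 8
  | .secret _ => 7
  | .filler _ _ => 7

/-- The value that is computed from the random number `v`, where `N` is the number of runs and
queries among which the solver chooses. -/
def Kind.value (P : Params) (N : ℕ) (v : ℕ) : Kind n r m → ℕ
  | .run => v % N
  | .ask => v % N
  | .x => P.grp.g ^ v % P.grp.p
  | .y => P.grp.g ^ v % P.grp.p
  | .key => v % 2 ^ P.keyLen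
  | .hash => v % 2 ^ P.hashLen
  | .idealA _ => v % 2 ^ P.hashLen
  | .idealB _ => v % 2 ^ P.hashLen
  | .secret _ => v % 2 ^ P.secLen
  | .filler _ _ => v % 2 ^ P.secLen

/-- Compute a value of the given kind from the random number in variable `11`. -/
noncomputable def Kind.valueProg : Kind n r m → Prog
  | .x => .seq powModProg (.store (Kind.x : Kind n r m).arr (var 20) (var 12))
  | .y => .seq powModProg (.store (Kind.y : Kind n r m).arr (var 20) (var 12))
  | k => .store k.arr (var 20) (.mod (var 11) (var k.modCell))

/-- Sample a value of the given kind. -/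
noncomputable def Kind.sampleProg (k : Kind n r m) : Prog :=
  .seq (.flip 0 (.lit 11) (var 9)) k.valueProg

/-- Sample all values. -/
noncomputable def samplingProg (n r m : ℕ) : Prog :=
  .loop (.sub (var 5) (var 20))
    (.seq (seqList ((kindList n r m).map Kind.sampleProg)) (assign 20 (.add (var 20) (.lit 1))))

/-- The random number from which the `t`-th value of a kind is computed. -/
noncomputable def rawValue (tape : ℕ → Bool) (W t : ℕ) (k : Kind n r m) : ℕ :=
  coinNumber tape ((t * Fintype.card (Kind n r m) + k.code) * W) W

/-- The cells that change during the preparations. -/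
def Scratch (K a i : ℕ) : Prop :=
  a = 0 ∧ (10 ≤ i ∧ i ≤ 13 ∨ 19 ≤ i) ∨ 4 ≤ a ∧ a < K

/-- The constant part of the memory of the solver. -/
structure Base (K : ℕ) (P : Params) (σ ga gb N W : ℕ) (M : Memory) : Prop where
  sigma : M 0 0 = σ
  p : M 0 1 = P.grp.p
  g : M 0 2 = P.grp.g
  ga : M 0 3 = ga
  gb : M 0 4 = gb
  num : M 0 5 = N
  key : M 0 6 = 2 ^ P.keyLen
  sec : M 0 7 = 2 ^ P.secLen
  hash : M 0 8 = 2 ^ P.hashLen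
  width : M 0 9 = W
  zero : ∀ i, 14 ≤ i → i ≤ 18 → M 0 i = 0
  memo : ∀ a, 1 ≤ a → a ≤ 3 → ∀ i, M a i = 0
  adv : ∀ a, K ≤ a → ∀ i, M a i = 0

theorem Base.of_agree {K : ℕ} {P : Params} {σ ga gb N W : ℕ} {M M' : Memory} (hK : 4 ≤ K)
    (h : Base K P σ ga gb N W M) (hM : ∀ a i, ¬ Scratch K a i → M' a i = M a i) :
    Base K P σ ga gb N W M' := by
  have h0 : ∀ i, i < 10 → M' 0 i = M 0 i := fun i hi => hM 0 i (by unfold Scratch; omega)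
  refine ⟨?_, ?_, ?_, ?_, ?_, ?_, ?_, ?_, ?_, ?_, ?_, ?_, ?_⟩
  · rw [h0 _ (by norm_num), h.sigma]
  · rw [h0 _ (by norm_num), h.p]
  · rw [h0 _ (by norm_num), h.g]
  · rw [h0 _ (by norm_num), h.ga]
  · rw [h0 _ (by norm_num), h.gb]
  · rw [h0 _ (by norm_num), h.num]
  · rw [h0 _ (by norm_num), h.key]
  · rw [h0 _ (by norm_num), h.sec]
  · rw [h0 _ (by norm_num), h.hash]
  · rw [h0 _ (by norm_num), h.width]
  · intro i h1 h2
    rw [hM 0 i (by unfold Scratch; omega), h.zero i h1 h2]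
  · intro a h1 h2 i
    rw [hM a i (by unfold Scratch; omega), h.memo a h1 h2]
  · intro a h1 i
    rw [hM a i (by unfold Scratch; omega), h.adv a h1]

theorem Base.write {K : ℕ} {P : Params} {σ ga gb N W : ℕ} {M : Memory} (hK : 4 ≤ K)
    (h : Base K P σ ga gb N W M) {a i : ℕ} (hs : Scratch K a i) (v : ℕ) :
    Base K P σ ga gb N W (M.write a i v) := by
  refine h.of_agree hK fun b j hb => M.write_of_ne ?_
  rintro ⟨rfl, rfl⟩
  exact hb hs

/-- The values of the first `t` rounds, and the first `j` values of the next round, are there. -/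
def Filled (P : Params) (N W : ℕ) (tape : ℕ → Bool) (t j : ℕ) (n r m : ℕ) (M : Memory) : Prop :=
  ∀ (k : Kind n r m) (t' : ℕ), (t' < t ∨ t' = t ∧ k.code < j) →
    M k.arr t' = k.value P N (rawValue tape W t' k)

variable {K S : ℕ} {P : Params} {σ ga gb N W : ℕ} {tape : ℕ → Bool}

/-- For runs only powers of `g` are kept: idealised transcripts show nothing else, and the challenge
comes in this form. So the kinds `x` and `y` use `powModProg` and all others a remainder. -/
theorem does_valueProg (hS : 1 ≤ S) (k : Kind n r m) {M : Memory} {pos : ℕ}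
    (hb : Base (offset n r m) P σ ga gb N W M) :
    Does (offset n r m) S tape k.valueProg M pos fun M' pos' =>
      pos' = pos ∧ M' k.arr (M 0 20) = k.value P N (M 0 11) ∧
      ∀ a i, ¬ (a = 0 ∧ 11 ≤ i ∧ i ≤ 13) → ¬ (a = k.arr ∧ i = M 0 20) → M' a i = M a i := by
  have hK : 0 < offset n r m := offset_pos
  intro hM
  have hp := P.grp.prime
  have hpow : ∀ k : Kind n r m, Does (offset n r m) S tape
      (.seq powModProg (.store k.arr (var 20) (var 12))) M pos fun M' pos' =>
      pos' = pos ∧ M' k.arr (M 0 20) = P.grp.g ^ (M 0 11) % P.grp.p ∧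
      ∀ a i, ¬ (a = 0 ∧ 11 ≤ i ∧ i ≤ 13) → ¬ (a = k.arr ∧ i = M 0 20) → M' a i = M a i := by
    intro k
    refine Does.seq ((does_powModProg hK hS hp.two_le P.grp.g_lt hb.p hb.g rfl).mono ?_)
    rintro M' pos' hM' ⟨rfl, h1, h2⟩
    have h20 : M' 0 20 = M 0 20 := h2 0 20 (by simp)
    refine Does.store hS (by simp [ATerm.Priv, hK]) (by simp [ATerm.Priv, hK])
      (fun _ => hM' 0 hK _) ?_
    simp only [ATerm.eval, h20]
    refine ⟨trivial, by rw [Memory.write_self, h1], fun a i h3 h4 => ?_⟩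
    rw [Memory.write_of_ne _ h4, h2 a i]
    simp only [Finset.mem_insert, Finset.mem_singleton]
    omega
  have hmod : ∀ k : Kind n r m, Does (offset n r m) S tape
      (.store k.arr (var 20) (.mod (var 11) (var k.modCell))) M pos fun M' pos' =>
      pos' = pos ∧ M' k.arr (M 0 20) = M 0 11 % M 0 k.modCell ∧
      ∀ a i, ¬ (a = 0 ∧ 11 ≤ i ∧ i ≤ 13) → ¬ (a = k.arr ∧ i = M 0 20) → M' a i = M a i := by
    intro k
    refine Does.store hS (by simp [ATerm.Priv, hK])
      (ATerm.priv_mod.2 (by simp [ATerm.Priv, hK])) (fun _ => ?_) ?_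
    · rw [ATerm.eval_mod]
      exact (Nat.size_le_size (Nat.mod_le _ _)).trans (hM 0 hK _)
    · simp only [ATerm.eval_mod, ATerm.eval]
      exact ⟨trivial, Memory.write_self _ _ _ _, fun a i _ h4 => Memory.write_of_ne _ h4⟩
  cases k
  case x => exact hpow _ hM
  case y => exact hpow _ hM
  case run =>
    have e := hmod .run hM
    simp only [Kind.modCell, hb.num] at e
    exact e
  case ask =>
    have e := hmod .ask hM
    simp only [Kind.modCell, hb.num] at e
    exact e
  case key =>
    have e := hmod .key hM
    simp only [Kind.modCell, hb.key] at e
    exact e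
  case hash =>
    have e := hmod .hash hM
    simp only [Kind.modCell, hb.hash] at e
    exact e
  case idealA c =>
    have e := hmod (.idealA c) hM
    simp only [Kind.modCell, hb.hash] at e
    exact e
  case idealB c =>
    have e := hmod (.idealB c) hM
    simp only [Kind.modCell, hb.hash] at e
    exact e
  case secret G =>
    have e := hmod (.secret G) hM
    simp only [Kind.modCell, hb.sec] at e
    exact e
  case filler l c =>
    have e := hmod (.filler l c) hM
    simp only [Kind.modCell, hb.sec] at e
    exact e

/-- The tape position is tracked exactly, so that the values are computed from disjoint blocks of
`W` coins; their independence rests on this. -/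
theorem does_sampleProg (hS : 1 ≤ S) (hW : W ≤ S) (k : Kind n r m) {M : Memory} {t : ℕ}
    (hb : Base (offset n r m) P σ ga gb N W M) (ht : M 0 20 = t)
    (hf : Filled P N W tape t k.code n r m M) :
    Does (offset n r m) S tape k.sampleProg M ((t * Fintype.card (Kind n r m) + k.code) * W)
      fun M' pos' => pos' = (t * Fintype.card (Kind n r m) + (k.code + 1)) * W ∧
      Base (offset n r m) P σ ga gb N W M' ∧ M' 0 20 = t ∧
      Filled P N W tape t (k.code + 1) n r m M' := by
  have hK : 0 < offset n r m := offset_pos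
  refine Does.seq (Does.flip hS trivial (by simp [ATerm.Priv, hK]) ?_ ?_)
  · simpa [ATerm.eval, hb.width] using hW
  simp only [ATerm.eval, hb.width]
  set M₁ := M.write 0 11 (coinNumber tape ((t * Fintype.card (Kind n r m) + k.code) * W) W) with hM₁
  have hb₁ : Base (offset n r m) P σ ga gb N W M₁ :=
    hb.write four_le_offset (by unfold Scratch; omega) _
  refine (does_valueProg hS k hb₁).mono ?_
  rintro M' pos' hM' ⟨rfl, h1, h2⟩
  have h20 : M₁ 0 20 = t := by rw [hM₁, Memory.write_of_ne _ (by omega), ht]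
  have h11 : M₁ 0 11 = rawValue tape W t k := Memory.write_self _ _ _ _
  rw [h20] at h1 h2
  rw [h11] at h1
  have hka := k.le_arr
  have hka' := k.arr_lt
  refine ⟨by ring, hb₁.of_agree four_le_offset fun a i hs => h2 a i ?_ ?_, ?_, ?_⟩
  · unfold Scratch at hs; omega
  · unfold Scratch at hs; omega
  · rw [h2 0 20 (by omega) (by omega), h20]
  · intro k' t' hk'
    by_cases heq : k' = k ∧ t' = t
    · rw [heq.1, heq.2, h1]
    · have hka'' := k'.le_arr
      rw [h2 _ _ (by omega) (by rw [Kind.arr_inj]; exact heq), hM₁,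
        Memory.write_of_ne _ (by omega)]
      refine hf k' t' ?_
      rcases hk' with h | ⟨h3, h4⟩
      · exact Or.inl h
      · refine Or.inr ⟨h3, lt_of_le_of_ne (Nat.lt_succ_iff.1 h4) fun h5 => heq ⟨?_, h3⟩⟩
        exact Kind.code_injective h5

theorem does_samplingProg (hS : 1 ≤ S) (hW : W ≤ S) (hN : N ≤ S) {M : Memory}
    (hb : Base (offset n r m) P σ ga gb N W M) (ht : M 0 20 = 0) :
    Does (offset n r m) S tape (samplingProg n r m) M 0 fun M' pos' =>
      pos' = N * Fintype.card (Kind n r m) * W ∧ Base (offset n r m) P σ ga gb N W M' ∧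
      Filled P N W tape N 0 n r m M' := by
  have hK : 0 < offset n r m := offset_pos
  refine Does.loop hS (by simp [ATerm.Priv, hK]) (fun t M' pos' => t ≤ N ∧
    pos' = (t * Fintype.card (Kind n r m)) * W ∧ Base (offset n r m) P σ ga gb N W M' ∧ M' 0 20 = t ∧
    Filled P N W tape t 0 n r m M') hN ?_ ?_ ?_
  · refine ⟨Nat.zero_le _, by simp, hb, ht, fun k t' h => ?_⟩
    omega
  · rintro t htN M' pos' hM' ⟨_, rfl, hb', h20, hf⟩
    refine ⟨by simp [ATerm.eval, hb'.num, h20]; omega, ?_⟩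
    refine Does.seq ((Does.seqList (fun j M' pos' =>
      pos' = (t * Fintype.card (Kind n r m) + j) * W ∧ Base (offset n r m) P σ ga gb N W M' ∧
      M' 0 20 = t ∧ Filled P N W tape t j n r m M') _ ⟨by simp, hb', h20, hf⟩ ?_).mono ?_)
    · rintro j hj M'' pos'' hM'' ⟨rfl, hb'', h20'', hf''⟩
      rw [List.length_map] at hj
      rw [List.getElem_map]
      have hc := code_getElem_kindList j hj
      rw [← hc] at hf''
      have := does_sampleProg (tape := tape) hS hW (kindList n r m)[j] hb'' h20'' hf''
      rwa [hc] at this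
    · rintro M'' pos'' hM'' ⟨rfl, hb'', h20'', hf''⟩
      rw [List.length_map, length_kindList] at hf'' ⊢
      refine Does.store hS trivial (by simp [ATerm.Priv, hK]) (fun _ => ?_) ?_
      · simp only [ATerm.eval, h20'']
        rw [Nat.size_le]
        exact Nat.lt_two_pow_self.trans_le (Nat.pow_le_pow_right (by norm_num) (by omega))
      · refine ⟨by omega, by ring, hb''.write four_le_offset ?_ _, ?_, ?_⟩
        · unfold Scratch; simp [ATerm.eval]
        · simp [Memory.write, ATerm.eval, h20'']
        · intro k t' h
          have := k.le_arr
          rw [Memory.write_of_ne _ (by omega)]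
          refine hf'' k t' ?_
          have := k.code_lt
          omega
  · rintro M' pos' hM' ⟨_, rfl, hb', h20, hf⟩
    exact ⟨by simp [ATerm.eval, hb'.num, h20], rfl, hb', hf⟩

theorem ATerm.eval_congr {K : ℕ} {M M' : Memory} (h : ∀ a < K, ∀ i, M' a i = M a i) :
    ∀ e : ATerm, e.Priv K → e.eval M' = e.eval M
  | .lit _, _ => rfl
  | .get a i, he => by
    simp only [ATerm.eval, i.eval_congr h he.2, h a he.1]
  | .add s t, he => by
    simp only [ATerm.eval, s.eval_congr h he.1, t.eval_congr h he.2]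
  | .sub s t, he => by
    simp only [ATerm.eval, s.eval_congr h he.1, t.eval_congr h he.2]
  | .mul s t, he => by
    simp only [ATerm.eval, s.eval_congr h he.1, t.eval_congr h he.2]
  | .div s t, he => by
    simp only [ATerm.eval, s.eval_congr h he.1, t.eval_congr h he.2]

/-- Store the values of terms in arrays from number `K` on. -/
def storesProg (K : ℕ) (l : List (ℕ × ℕ × ATerm)) : Prog :=
  seqList (l.map fun e => .store (K + e.1) (.lit e.2.1) e.2.2)

/-- Stores to the same cell could overwrite each other, so a final value `v` is asserted if all
entries for that cell evaluate to `v`. The terms only read arrays below `K`, which the stores leave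
alone, hence they may be evaluated in the initial memory. -/
theorem does_storesProg (hS : 1 ≤ S) (l : List (ℕ × ℕ × ATerm)) (hl : ∀ e ∈ l, e.2.2.Priv K)
    (M : Memory) (pos : ℕ) :
    Does K S tape (storesProg K l) M pos fun M' pos' => pos' = pos ∧
      (∀ b < K, ∀ i, M' b i = M b i) ∧
      ∀ a i v, (∀ e, (a, i, e) ∈ l → e.eval M = v) → ((∃ e, (a, i, e) ∈ l) ∨ M (K + a) i = v) →
        M' (K + a) i = v := by
  induction l generalizing M with
  | nil =>
    refine Does.skip ⟨rfl, fun _ _ _ => rfl, fun a i v _ h => ?_⟩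
    simpa using h
  | cons e l ih =>
    obtain ⟨a₀, i₀, e⟩ := e
    have he : e.Priv K := hl (a₀, i₀, e) (by simp)
    have hlow : ∀ b < K, ∀ i, (M.write (K + a₀) i₀ (e.eval M)) b i = M b i :=
      fun b hb i => Memory.write_of_ne _ (by omega)
    refine Does.seq (Does.store hS trivial he (fun h => absurd h (by simp)) ?_)
    refine (ih (fun e' h => hl e' (List.mem_cons_of_mem _ h)) _).mono ?_
    rintro M' pos' _ ⟨rfl, h1, h2⟩
    simp only [ATerm.eval] at h1 h2
    refine ⟨rfl, fun b hb i => (h1 b hb i).trans (hlow b hb i), fun a i v h3 h4 => ?_⟩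
    refine h2 a i v (fun e' he' => ?_) ?_
    · rw [ATerm.eval_congr hlow e' (hl _ (List.mem_cons_of_mem _ he'))]
      exact h3 e' (List.mem_cons_of_mem _ he')
    · by_cases heq : a = a₀ ∧ i = i₀
      · right
        obtain ⟨rfl, rfl⟩ := heq
        rw [Memory.write_self]
        exact h3 e (by simp)
      · rcases h4 with ⟨e', he'⟩ | h4
        · left
          refine ⟨e', ?_⟩
          rcases List.mem_cons.1 he' with h5 | h5
          · simp only [Prod.mk.injEq] at h5
            exact absurd ⟨h5.1, h5.2.1⟩ heq
          · exact h5
        · right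
          rw [Memory.write_of_ne _ (by omega)]
          exact h4

end Kinds

/-! ### Parameters, challenge and initial knowledge in the memory of the solver -/

section Prelude

variable {n r m : ℕ} (groups : Fin n → Finset (Fin r)) (corrupt : Finset (Fin n))
  (perm : Fin n → Equiv.Perm (Fin m))

/-- The kind of the value in a cell of the array of a node. -/
def cellKind (l : Fin n) (c : Fin m) : Kind n r m :=
  match ((groups l).sort (· ≤ ·))[((perm l c : Fin m) : ℕ)]? with
  | some G => .secret G
  | none => .filler l (perm l c)

/-- What the eavesdropper knows at the start, as terms. -/
noncomputable def knowledgeTerms : List (ℕ × ℕ × ATerm) :=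
  [(0, 0, var 0), (0, 1, var 1), (0, 2, var 2)] ++
  (List.finRange r).map (fun G : Fin r => (1, (G : ℕ),
    .get (Kind.secret G : Kind n r m).arr (.lit 0))) ++
  (List.finRange n).flatMap fun l : Fin n => if l ∈ corrupt then
    (List.finRange m).map fun c : Fin m => ((l : ℕ) + 2, (c : ℕ), .get (cellKind groups perm l c).arr (.lit 0))
    else []

/-- Compute the parameters. -/
noncomputable def parameterProg (keyLen secLen hashLen num width : Polynomial ℕ) : Prog :=
  .seq (assign 5 (polyTerm num)) (.seq (powTwoProg 6 (polyTerm keyLen))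
    (.seq (powTwoProg 7 (polyTerm secLen)) (.seq (powTwoProg 8 (polyTerm hashLen))
      (assign 9 (polyTerm width)))))

/-- Put the Diffie-Hellman challenge into the guessed run, and remember the guessed query. -/
noncomputable def challengeProg (n r m : ℕ) : Prog :=
  .seq (.store (Kind.x : Kind n r m).arr
      (.get (Kind.run : Kind n r m).arr (.lit 0)) (var 3))
    (.seq (.store (Kind.y : Kind n r m).arr
      (.get (Kind.run : Kind n r m).arr (.lit 0)) (var 4))
    (assign 22 (.get (Kind.ask : Kind n r m).arr (.lit 0))))

/-- All preparations of the solver. -/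
noncomputable def preludeProg (keyLen secLen hashLen num width : Polynomial ℕ) : Prog :=
  .seq (parameterProg keyLen secLen hashLen num width) (.seq (samplingProg n r m)
    (.seq (challengeProg n r m)
      (storesProg (offset n r m) (knowledgeTerms groups corrupt perm))))

variable {groups corrupt perm}

theorem priv_knowledgeTerms : ∀ e ∈ knowledgeTerms groups corrupt perm, e.2.2.Priv (offset n r m) := by
  have h0 : 0 < offset n r m := offset_pos
  intro e he
  simp only [knowledgeTerms, List.mem_append, List.mem_cons, List.not_mem_nil, or_false,
    List.mem_map, List.mem_flatMap] at he
  rcases he with ((rfl | rfl | rfl) | ⟨G, _, rfl⟩) | ⟨l, _, h⟩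
  · exact ⟨h0, trivial⟩
  · exact ⟨h0, trivial⟩
  · exact ⟨h0, trivial⟩
  · exact ⟨Kind.arr_lt _, trivial⟩
  · split_ifs at h
    · obtain ⟨c, _, rfl⟩ := List.mem_map.1 h
      exact ⟨Kind.arr_lt _, trivial⟩
    · simp at h

/-- The value of a kind in round `t` after the preparations. -/
noncomputable def preparedValue (P : Params) (ga gb N W : ℕ) (tape : ℕ → Bool) (t : ℕ)
    (k : Kind n r m) : ℕ :=
  match k with
  | .x => if t = (Kind.run : Kind n r m).value P N (rawValue tape W 0 (.run : Kind n r m))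
      then ga else (Kind.x : Kind n r m).value P N (rawValue tape W t (.x : Kind n r m))
  | .y => if t = (Kind.run : Kind n r m).value P N (rawValue tape W 0 (.run : Kind n r m))
      then gb else (Kind.y : Kind n r m).value P N (rawValue tape W t (.y : Kind n r m))
  | k => k.value P N (rawValue tape W t k)

/-- The memory of the solver after the preparations. -/
structure Prepared (groups : Fin n → Finset (Fin r)) (corrupt : Finset (Fin n))
    (perm : Fin n → Equiv.Perm (Fin m)) (P : Params) (σ ga gb N W : ℕ) (tape : ℕ → Bool)
    (M : Memory) : Prop where
  p : M 0 1 = P.grp.p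
  key : M 0 6 = 2 ^ P.keyLen
  sec : M 0 7 = 2 ^ P.secLen
  zero : ∀ i, 14 ≤ i → i ≤ 18 → M 0 i = 0
  memo : ∀ a, 1 ≤ a → a ≤ 3 → ∀ i, M a i = 0
  ask : M 0 22 = preparedValue P ga gb N W tape 0 (.ask : Kind n r m)
  value : ∀ (k : Kind n r m) t, t < N → M k.arr t = preparedValue P ga gb N W tape t k
  adv0 : ∀ i, M (offset n r m) i = (([σ, P.grp.p, P.grp.g] : List ℕ)[i]?).getD 0
  adv1 : ∀ i, M (offset n r m + 1) i =
    if hi : i < r then preparedValue P ga gb N W tape 0 (.secret ⟨i, hi⟩ : Kind n r m) else 0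
  adv2 : ∀ l i, M (offset n r m + (l + 2)) i =
    if hl : l < n ∧ i < m then if (⟨l, hl.1⟩ : Fin n) ∈ corrupt then
      preparedValue P ga gb N W tape 0 (cellKind groups perm ⟨l, hl.1⟩ ⟨i, hl.2⟩) else 0 else 0

theorem does_parameterProg {K S : ℕ} {tape : ℕ → Bool} (hK : 4 ≤ K) (hS : 1 ≤ S) {D : DHGroup}
    {σ a b : ℕ} {keyLen secLen hashLen num width : Polynomial ℕ}
    (h1 : keyLen.eval σ < S) (h2 : secLen.eval σ < S) (h3 : hashLen.eval σ < S)
    (h4 : num.eval σ ≤ S) (h5 : width.eval σ ≤ S) :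
    Does K S tape (parameterProg keyLen secLen hashLen num width) (dhInput σ D a b) 0
      fun M' pos' => pos' = 0 ∧ M' 0 20 = 0 ∧
        Base K ⟨D, keyLen.eval σ, secLen.eval σ, hashLen.eval σ⟩ σ (D.g ^ a % D.p) (D.g ^ b % D.p)
          (num.eval σ) (width.eval σ) M' := by
  have hK0 : 0 < K := by omega
  have small : ∀ v, v ≤ S → v.size ≤ S := fun v hv =>
    (Nat.size_le.2 Nat.lt_two_pow_self).trans hv
  set M₀ := dhInput σ D a b with hM₀
  have h00 : M₀ 0 0 = σ := rfl
  refine Does.seq (Does.store hS trivial (priv_polyTerm _ hK0) (fun _ => ?_) ?_)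
  · rw [eval_polyTerm, h00]
    exact small _ h4
  set M₁ := M₀.write 0 (ATerm.eval M₀ (.lit 5)) (ATerm.eval M₀ (polyTerm num)) with hM₁
  have a1 : ∀ b i, ¬ (b = 0 ∧ i = 5) → M₁ b i = M₀ b i := fun b i h => Memory.write_of_ne _ h
  have v1 : M₁ 0 5 = num.eval σ := by
    rw [hM₁, ATerm.eval, Memory.write_self, eval_polyTerm, h00]
  refine Does.seq ((does_powTwoProg hK0 hS (by norm_num) (priv_polyTerm _ hK0) ?_).mono ?_)
  · rw [eval_polyTerm, a1 0 0 (by norm_num), h00]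
    exact h1
  rintro M₂ pos₂ _ ⟨rfl, v2, a2⟩
  rw [eval_polyTerm, a1 0 0 (by norm_num), h00] at v2
  have e2 : M₂ 0 0 = σ := by rw [a2 0 0 (by simp), a1 0 0 (by norm_num), h00]
  refine Does.seq ((does_powTwoProg hK0 hS (by norm_num) (priv_polyTerm _ hK0) ?_).mono ?_)
  · rw [eval_polyTerm, e2]
    exact h2
  rintro M₃ pos₃ _ ⟨rfl, v3, a3⟩
  rw [eval_polyTerm, e2] at v3
  have e3 : M₃ 0 0 = σ := by rw [a3 0 0 (by simp), e2]
  refine Does.seq ((does_powTwoProg hK0 hS (by norm_num) (priv_polyTerm _ hK0) ?_).mono ?_)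
  · rw [eval_polyTerm, e3]
    exact h3
  rintro M₄ pos₄ _ ⟨rfl, v4, a4⟩
  rw [eval_polyTerm, e3] at v4
  have e4 : M₄ 0 0 = σ := by rw [a4 0 0 (by simp), e3]
  refine Does.store hS trivial (priv_polyTerm _ hK0) (fun _ => ?_) ?_
  · rw [eval_polyTerm, e4]
    exact small _ h5
  rw [eval_polyTerm, e4]
  simp only [ATerm.eval]
  have hall : ∀ b i, ¬ (b = 0 ∧ i ∈ ({5, 6, 7, 8, 9, 10} : Finset ℕ)) →
      (M₄.write 0 9 (width.eval σ)) b i = M₀ b i := by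
    intro b i h
    simp only [Finset.mem_insert, Finset.mem_singleton] at h
    rw [Memory.write_of_ne _ (by omega), a4 b i (by simp; omega), a3 b i (by simp; omega),
      a2 b i (by simp; omega), a1 b i (by omega)]
  have hz : ∀ b i, ¬ (b = 0 ∧ i < 5) → M₀ b i = 0 := by
    intro b i h
    rw [hM₀, dhInput]
    split_ifs with hb
    · rw [List.getElem?_eq_none (by simp; omega)]
      rfl
    · rfl
  refine ⟨trivial, ?_, ?_⟩
  · rw [hall 0 20 (by simp), hz 0 20 (by norm_num)]
  · refine ⟨?_, ?_, ?_, ?_, ?_, ?_, ?_, ?_, ?_, ?_, ?_, ?_, ?_⟩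
    · rw [Memory.write_of_ne _ (by omega), e4]
    · rw [hall _ _ (by simp)]; rfl
    · rw [hall _ _ (by simp)]; rfl
    · rw [hall _ _ (by simp)]; rfl
    · rw [hall _ _ (by simp)]; rfl
    · rw [Memory.write_of_ne _ (by omega), a4 _ _ (by simp), a3 _ _ (by simp), a2 _ _ (by simp), v1]
    · rw [Memory.write_of_ne _ (by omega), a4 _ _ (by simp), a3 _ _ (by simp), v2]
    · rw [Memory.write_of_ne _ (by omega), a4 _ _ (by simp), v3]
    · rw [Memory.write_of_ne _ (by omega), v4]
    · rw [Memory.write_self]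
    · intro i hi hi'
      rw [hall _ _ (by simp; omega), hz _ _ (by omega)]
    · intro c hc hc' i
      rw [hall _ _ (by omega), hz _ _ (by omega)]
    · intro c hc i
      rw [hall _ _ (by omega), hz _ _ (by omega)]

/-- Two powers of the guessed run are overwritten. This is consistent because nothing else in the
memory was computed from the exponents that they replace. -/
theorem does_challengeProg {S : ℕ} {tape : ℕ → Bool} (hS : 1 ≤ S) {P : Params} {σ ga gb N W pos : ℕ}
    {M : Memory} (hN : 0 < N) (hb : Base (offset n r m) P σ ga gb N W M)
    (hf : Filled P N W tape N 0 n r m M) :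
    Does (offset n r m) S tape (challengeProg n r m) M pos fun M' pos' => pos' = pos ∧
      Base (offset n r m) P σ ga gb N W M' ∧
      M' 0 22 = preparedValue P ga gb N W tape 0 (.ask : Kind n r m) ∧
      ∀ (k : Kind n r m) t, t < N → M' k.arr t = preparedValue P ga gb N W tape t k := by
  have hK : 0 < offset n r m := offset_pos
  have hrun := hf .run 0 (Or.inl hN)
  have hask := hf .ask 0 (Or.inl hN)
  set tt := (Kind.run : Kind n r m).value P N (rawValue tape W 0 (.run : Kind n r m))
    with htt
  have l1 := (Kind.x : Kind n r m).le_arr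
  have l1' := (Kind.x : Kind n r m).arr_lt
  have l2 := (Kind.y : Kind n r m).le_arr
  have l2' := (Kind.y : Kind n r m).arr_lt
  have n1 : (Kind.run : Kind n r m).arr ≠ (Kind.x : Kind n r m).arr := by simp [Kind.arr_inj]
  have n2 : (Kind.ask : Kind n r m).arr ≠ (Kind.x : Kind n r m).arr := by simp [Kind.arr_inj]
  have n3 : (Kind.ask : Kind n r m).arr ≠ (Kind.y : Kind n r m).arr := by simp [Kind.arr_inj]
  have n4 : (Kind.x : Kind n r m).arr ≠ (Kind.y : Kind n r m).arr := by simp [Kind.arr_inj]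
  intro hM
  have s3 := hM 0 hK 3
  have s4 := hM 0 hK 4
  have sa := hM _ (Kind.ask : Kind n r m).arr_lt 0
  rw [hb.ga] at s3
  rw [hb.gb] at s4
  rw [hask] at sa
  revert hM
  refine Does.seq (Does.store hS ⟨Kind.arr_lt _, trivial⟩ ⟨hK, trivial⟩ (fun _ => ?_) ?_)
  · simp only [ATerm.eval, hb.ga]
    exact s3
  simp only [ATerm.eval, hb.ga, hrun]
  set M₁ := M.write (Kind.x : Kind n r m).arr tt ga with hM₁
  have v1 : M₁ 0 4 = gb := by rw [hM₁, Memory.write_of_ne _ (by omega), hb.gb]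
  have v2 : M₁ (Kind.run : Kind n r m).arr 0 = tt := by
    rw [hM₁, Memory.write_of_ne _ (by omega), hrun]
  refine Does.seq (Does.store hS ⟨Kind.arr_lt _, trivial⟩ ⟨hK, trivial⟩ (fun _ => ?_) ?_)
  · simp only [ATerm.eval, v1]
    exact s4
  simp only [ATerm.eval, v1, v2]
  set M₂ := M₁.write (Kind.y : Kind n r m).arr tt gb with hM₂
  have v3 : M₂ (Kind.ask : Kind n r m).arr 0 =
      (Kind.ask : Kind n r m).value P N (rawValue tape W 0 (.ask : Kind n r m)) := by
    rw [hM₂, Memory.write_of_ne _ (by omega), hM₁, Memory.write_of_ne _ (by omega), hask]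
  refine Does.store hS trivial ⟨Kind.arr_lt _, trivial⟩ (fun _ => ?_) ?_
  · simp only [ATerm.eval, v3]
    exact sa
  simp only [ATerm.eval, v3]
  refine ⟨trivial, ?_, ?_, ?_⟩
  · refine ((hb.write four_le_offset ?_ _).write four_le_offset ?_ _).write four_le_offset ?_ _
    all_goals unfold Scratch; omega
  · rw [Memory.write_self]
    rfl
  · intro k t ht
    have hk := k.le_arr
    rw [Memory.write_of_ne _ (by omega)]
    have hfk := hf k t (Or.inl ht)
    have other : k ≠ .x → k ≠ .y → M₂ k.arr t = k.value P N (rawValue tape W t k) := by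
      intro h1 h2
      rw [← Kind.arr_inj.ne] at h1 h2
      rw [hM₂, Memory.write_of_ne _ (by omega), hM₁, Memory.write_of_ne _ (by omega), hfk]
    cases k
    case x =>
      rw [hM₂, Memory.write_of_ne _ (by omega)]
      simp only [preparedValue, ← htt]
      split_ifs with h
      · rw [hM₁, h, Memory.write_self]
      · rw [hM₁, Memory.write_of_ne _ (by omega), hfk]
    case y =>
      simp only [preparedValue, ← htt]
      split_ifs with h
      · rw [hM₂, h, Memory.write_self]
      · rw [hM₂, Memory.write_of_ne _ (by omega), hM₁, Memory.write_of_ne _ (by omega), hfk]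
    all_goals exact other (by simp) (by simp)

theorem does_preludeProg {S : ℕ} {tape : ℕ → Bool} (hS : 1 ≤ S) {D : DHGroup} {σ a b : ℕ}
    {keyLen secLen hashLen num width : Polynomial ℕ}
    (h1 : keyLen.eval σ < S) (h2 : secLen.eval σ < S) (h3 : hashLen.eval σ < S)
    (h4 : num.eval σ ≤ S) (h5 : width.eval σ ≤ S) (h6 : 0 < num.eval σ) :
    Does (offset n r m) S tape (preludeProg groups corrupt perm keyLen secLen hashLen num width)
      (dhInput σ D a b) 0 fun M' pos' =>
        pos' = num.eval σ * Fintype.card (Kind n r m) * width.eval σ ∧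
        Prepared groups corrupt perm ⟨D, keyLen.eval σ, secLen.eval σ, hashLen.eval σ⟩ σ
          (D.g ^ a % D.p) (D.g ^ b % D.p) (num.eval σ) (width.eval σ) tape M' := by
  refine Does.seq ((does_parameterProg four_le_offset hS h1 h2 h3 h4 h5).mono ?_)
  rintro M₁ _ _ ⟨rfl, e20, hb₁⟩
  refine Does.seq ((does_samplingProg hS h5 h4 hb₁ e20).mono ?_)
  rintro M₂ _ _ ⟨rfl, hb₂, hf₂⟩
  refine Does.seq ((does_challengeProg hS h6 hb₂ hf₂).mono ?_)
  rintro M₃ _ _ ⟨rfl, hb₃, hask, hval⟩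
  refine (does_storesProg hS _ priv_knowledgeTerms _ _).mono ?_
  rintro M₄ _ _ ⟨rfl, h7, h8⟩
  have h0 : 0 < offset n r m := offset_pos
  have h04 : 4 ≤ offset n r m := four_le_offset
  refine ⟨rfl, ?_⟩
  have mem : ∀ a i e, (a, i, e) ∈ knowledgeTerms groups corrupt perm ↔
      (a = 0 ∧ i < 3 ∧ e = var i) ∨
      (∃ G : Fin r, a = 1 ∧ i = G ∧ e = .get (Kind.secret G : Kind n r m).arr (.lit 0)) ∨
      (∃ (l : Fin n) (c : Fin m), l ∈ corrupt ∧ a = l + 2 ∧ i = c ∧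
        e = .get (cellKind groups perm l c).arr (.lit 0)) := by
    intro a i e
    simp only [knowledgeTerms, List.mem_append, List.mem_cons, List.not_mem_nil, or_false,
      List.mem_map, List.mem_flatMap, Prod.mk.injEq, List.mem_finRange, true_and]
    constructor
    · rintro (((⟨rfl, rfl, rfl⟩ | ⟨rfl, rfl, rfl⟩ | ⟨rfl, rfl, rfl⟩) | ⟨G, rfl, rfl, rfl⟩) | ⟨l, h⟩)
      · exact Or.inl ⟨rfl, by norm_num, rfl⟩
      · exact Or.inl ⟨rfl, by norm_num, rfl⟩
      · exact Or.inl ⟨rfl, by norm_num, rfl⟩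
      · exact Or.inr (Or.inl ⟨G, rfl, rfl, rfl⟩)
      · split_ifs at h with hl
        · obtain ⟨c, -, hc⟩ := List.mem_map.1 h
          simp only [Prod.mk.injEq] at hc
          exact Or.inr (Or.inr ⟨l, c, hl, hc.1.symm, hc.2.1.symm, hc.2.2.symm⟩)
        · simp at h
    · rintro (⟨rfl, hi, rfl⟩ | ⟨G, rfl, rfl, rfl⟩ | ⟨l, c, hl, rfl, rfl, rfl⟩)
      · interval_cases i <;> simp
      · exact Or.inl (Or.inr ⟨G, rfl, rfl, rfl⟩)
      · right
        refine ⟨l, ?_⟩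
        rw [if_pos hl]
        exact List.mem_map.2 ⟨c, List.mem_finRange _, rfl⟩
  refine ⟨?_, ?_, ?_, ?_, ?_, ?_, ?_, ?_, ?_, ?_⟩
  · rw [h7 _ h0, hb₃.p]
  · rw [h7 _ h0, hb₃.key]
  · rw [h7 _ h0, hb₃.sec]
  · intro i hi hi'
    rw [h7 _ h0, hb₃.zero i hi hi']
  · intro c hc hc' i
    rw [h7 _ (by omega), hb₃.memo c hc hc']
  · rw [h7 _ h0, hask]
  · intro k t ht
    rw [h7 _ k.arr_lt, hval k t ht]
  · intro i
    refine h8 0 i _ (fun e he => ?_) ?_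
    · rcases (mem _ _ _).1 he with ⟨-, hi, rfl⟩ | ⟨G, h, -⟩ | ⟨l, c, -, h, -⟩
      · simp only [ATerm.eval]
        interval_cases i
        · exact hb₃.sigma
        · exact hb₃.p
        · exact hb₃.g
      · omega
      · omega
    · by_cases hi : i < 3
      · exact Or.inl ⟨_, (mem _ _ _).2 (Or.inl ⟨rfl, hi, rfl⟩)⟩
      · right
        rw [hb₃.adv _ (by omega), List.getElem?_eq_none (by simp; omega)]
        rfl
  · intro i
    refine h8 1 i _ (fun e he => ?_) ?_
    · rcases (mem _ _ _).1 he with ⟨h, -⟩ | ⟨G, -, rfl, rfl⟩ | ⟨l, c, -, h, -⟩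
      · omega
      · rw [dif_pos G.2]
        exact hval _ _ h6
      · omega
    · by_cases hi : i < r
      · exact Or.inl ⟨_, (mem _ _ _).2 (Or.inr (Or.inl ⟨⟨i, hi⟩, rfl, rfl, rfl⟩))⟩
      · right
        rw [hb₃.adv _ (by omega), dif_neg hi]
  · intro l i
    refine h8 (l + 2) i _ (fun e he => ?_) ?_
    · rcases (mem _ _ _).1 he with ⟨h, -⟩ | ⟨G, h, -⟩ | ⟨l', c, hl', h, rfl, rfl⟩
      · omega
      · omega
      · have : l = l' := by omega
        subst this
        rw [dif_pos ⟨l'.2, c.2⟩, if_pos hl']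
        exact hval _ _ h6
    · by_cases hl : l < n ∧ i < m
      · by_cases hc : (⟨l, hl.1⟩ : Fin n) ∈ corrupt
        · exact Or.inl ⟨_, (mem _ _ _).2 (Or.inr (Or.inr
            ⟨⟨l, hl.1⟩, ⟨i, hl.2⟩, hc, rfl, rfl, rfl⟩))⟩
        · right
          rw [hb₃.adv _ (by omega), dif_pos hl, if_neg hc]
      · right
        rw [hb₃.adv _ (by omega), dif_neg hl]

end Prelude

/-! ### The simulation of an eavesdropper on idealised runs -/

/-- Read arrays from number `K` on. -/
def ATerm.shift (K : ℕ) : ATerm → ATerm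
  | .lit n => .lit n
  | .get a i => .get (K + a) (i.shift K)
  | .add s t => .add (s.shift K) (t.shift K)
  | .sub s t => .sub (s.shift K) (t.shift K)
  | .mul s t => .mul (s.shift K) (t.shift K)
  | .div s t => .div (s.shift K) (t.shift K)

theorem ATerm.eval_shift {K : ℕ} {M M' : Memory} (h : ∀ a i, M' (K + a) i = M a i) :
    ∀ e : ATerm, (e.shift K).eval M' = e.eval M
  | .lit _ => rfl
  | .get a i => by simp only [shift, eval, i.eval_shift h, h]
  | .add s t => by simp only [shift, eval, s.eval_shift h, t.eval_shift h]
  | .sub s t => by simp only [shift, eval, s.eval_shift h, t.eval_shift h]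
  | .mul s t => by simp only [shift, eval, s.eval_shift h, t.eval_shift h]
  | .div s t => by simp only [shift, eval, s.eval_shift h, t.eval_shift h]

/-- Costs depend on values and literals but not on array numbers, so a translated term is covered by
the time limit of the eavesdropper. -/
theorem ATerm.cost_shift {K : ℕ} {M M' : Memory} (h : ∀ a i, M' (K + a) i = M a i) :
    ∀ e : ATerm, (e.shift K).cost M' = e.cost M
  | .lit _ => rfl
  | .get a i => by simp only [shift, cost, i.eval_shift h, i.cost_shift h, h]
  | .add s t => by simp only [shift, cost, s.eval_shift h, t.eval_shift h, s.cost_shift h,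
      t.cost_shift h]
  | .sub s t => by simp only [shift, cost, s.eval_shift h, t.eval_shift h, s.cost_shift h,
      t.cost_shift h]
  | .mul s t => by simp only [shift, cost, s.eval_shift h, t.eval_shift h, s.cost_shift h,
      t.cost_shift h]
  | .div s t => by simp only [shift, cost, s.eval_shift h, t.eval_shift h, s.cost_shift h,
      t.cost_shift h]

/-- Do something unless the solver has found its result. -/
def unlessHalted (p : Prog) : Prog := .ite (var 16) .skip p

/-- If the guessed number of evaluations is reached, then the point is the result. -/
def hitProg : Prog :=
  .ite (.eq (var 14) (var 22)) (.seq (assign 17 (var 19)) (assign 16 (.lit 1))) .skip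

/-- Answer a query to a random oracle by lazy sampling. -/
def answerProg (K arr pool : ℕ) (hit : Prog) (a : ℕ) : Prog :=
  .seq (.ite (.get arr (var 19)) .skip
      (.seq (.store arr (var 19) (.add (.lit 1) (.get pool (var 14))))
        (.seq hit (assign 14 (.add (var 14) (.lit 1))))))
    (.store (K + a) (.lit 0) (.sub (.get arr (var 19)) (.lit 1)))

/-- The index of a pair of a session key and a secret. -/
def pairTerm : ATerm :=
  .add (.mul (.mod (var 19) (var 6)) (var 7)) (.mod (var 21) (var 7))

/-! ### Translation of the eavesdropper into a program without oracle -/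

section Programs

variable (n r m : ℕ) (corrupt : Finset (Fin n))

/-- A term that is nonzero if the value of `s` is an honest node. -/
def honestTerm {n : ℕ} (corrupt : Finset (Fin n)) (s : ATerm) : ATerm :=
  (List.finRange n).foldr (fun u t => if u ∈ corrupt then t else .add (.eq s (.lit u)) t) (.lit 0)

/-- The kinds of the values in a transcript. -/
def transcriptKinds : List (Kind n r m) :=
  [.x, .y] ++ List.ofFn Kind.idealA ++ List.ofFn Kind.idealB

/-- Where the values of a transcript are stored. -/
noncomputable def transcriptTerms (a : ℕ) : List (ℕ × ℕ × ATerm) :=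
  (transcriptKinds n r m).zipIdx.map fun e => (a, e.2, .get e.1.arr (var 15))

/-- Answer the query in the variables `19` and `21`. -/
noncomputable def replyProg (k a : ℕ) : Prog :=
  match k with
  | 0 => .seq (assign 19 (.mod (var 19) (var 1)))
      (answerProg (offset n r m) 1 (Kind.key : Kind n r m).arr hitProg a)
  | 1 => .seq (assign 19 pairTerm)
      (answerProg (offset n r m) 2 (Kind.hash : Kind n r m).arr .skip a)
  | 2 => .seq (assign 19 pairTerm)
      (answerProg (offset n r m) 3 (Kind.hash : Kind n r m).arr .skip a)
  | 3 => .ite (.mul (honestTerm corrupt (var 19)) (honestTerm corrupt (var 21)))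
      (.seq (storesProg (offset n r m) (transcriptTerms n r m a))
        (assign 15 (.add (var 15) (.lit 1)))) .skip
  | _ => .skip

/-- Evaluate the condition of a loop. -/
noncomputable def conditionProg (e : ATerm) : Prog :=
  .ite (var 16) (assign 18 (.lit 0)) (assign 18 (e.shift (offset n r m)))

/-- The program of the solver that simulates a program of the eavesdropper. -/
noncomputable def translate : Prog → Prog
  | .skip => .skip
  | .store a i e => unlessHalted
      (.store (offset n r m + a) (i.shift (offset n r m)) (e.shift (offset n r m)))
  | .flip a i e => unlessHalted
      (.flip (offset n r m + a) (i.shift (offset n r m)) (e.shift (offset n r m)))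
  | .call k a e₁ e₂ => unlessHalted
      (.seq (assign 19 (e₁.shift (offset n r m))) (.seq (assign 21 (e₂.shift (offset n r m)))
        (replyProg n r m corrupt k a)))
  | .seq p q => .seq (translate p) (translate q)
  | .ite e p q => unlessHalted (.ite (e.shift (offset n r m)) (translate p) (translate q))
  | .loop e p => .seq (conditionProg n r m e)
      (.loop (var 18) (.seq (translate p) (conditionProg n r m e)))

/-- The second list of commands simulates the first one. -/
inductive Follows (tail : List Prog) : List Prog → List Prog → Prop
  | nil : Follows tail [] tail
  | cons {l l' : List Prog} (p : Prog) : Follows tail l l' →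
      Follows tail (p :: l) (translate n r m corrupt p :: l')
  | loop {l l' : List Prog} (e : ATerm) (p : Prog) : Follows tail l l' →
      Follows tail (.loop e p :: l) (conditionProg n r m e ::
        .loop (var 18) (.seq (translate n r m corrupt p) (conditionProg n r m e)) :: l')

/-- A bound for the time that the simulation of one step takes, for all steps of a program. -/
noncomputable def simBound (S : ℕ) : Prog → ℕ
  | .skip => 100 * S
  | .store _ _ _ => 100 * S
  | .flip _ _ _ => 100 * S
  | .call k a _ _ => 100 * S + (replyProg n r m corrupt k a).bound S
  | .seq p q => 100 * S + simBound S p + simBound S q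
  | .ite _ p q => 100 * S + simBound S p + simBound S q
  | .loop _ p => 100 * S + simBound S p

theorem simBound_eq_polynomial (P : Prog) :
    ∃ q : Polynomial ℕ, ∀ S, simBound n r m corrupt S P = q.eval S := by
  induction P with
  | skip => exact ⟨Polynomial.C 100 * Polynomial.X, by simp [simBound]⟩
  | store a i e => exact ⟨Polynomial.C 100 * Polynomial.X, by simp [simBound]⟩
  | flip a i e => exact ⟨Polynomial.C 100 * Polynomial.X, by simp [simBound]⟩
  | call k a =>
    obtain ⟨q, hq⟩ := (replyProg n r m corrupt k a).bound_eq_polynomial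
    exact ⟨Polynomial.C 100 * Polynomial.X + q, by simp [simBound, hq]⟩
  | seq p q hp hq =>
    obtain ⟨p', hp⟩ := hp
    obtain ⟨q', hq⟩ := hq
    exact ⟨Polynomial.C 100 * Polynomial.X + p' + q', by simp [simBound, hp, hq]⟩
  | ite e p q hp hq =>
    obtain ⟨p', hp⟩ := hp
    obtain ⟨q', hq⟩ := hq
    exact ⟨Polynomial.C 100 * Polynomial.X + p' + q', by simp [simBound, hp, hq]⟩
  | loop e p hp =>
    obtain ⟨p', hp⟩ := hp
    exact ⟨Polynomial.C 100 * Polynomial.X + p', by simp [simBound, hp]⟩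

theorem le_simBound (S : ℕ) (P : Prog) : 100 * S ≤ simBound n r m corrupt S P := by
  cases P <;> simp only [simBound] <;> omega

/-- All commands that are still to be executed are bounded. -/
def TodoBound (S C : ℕ) (l : List Prog) : Prop := ∀ p ∈ l, simBound n r m corrupt S p ≤ C

variable {n r m corrupt}

/-- Pending commands are parts of the original program, and `simBound` adds up over parts; so a
single constant bounds the simulation of every step. -/
theorem TodoBound.stepT {S C T : ℕ} {Q : Type} {coin : ℕ → Bool} {O : Oracle Q} {c : Config Q}
    (h : TodoBound n r m corrupt S C c.todo) :
    TodoBound n r m corrupt S C (stepT T coin O c).todo := by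
  unfold PrivateHandshake.stepT
  split_ifs
  · rcases c with ⟨_ | ⟨p, l⟩, M, k, s, t⟩
    · exact h
    · have hp := h p (by simp)
      have hl : ∀ p ∈ l, simBound n r m corrupt S p ≤ C := fun q hq => h q (by simp [hq])
      cases p <;> simp only [step, simBound] at hp ⊢
      case seq p q =>
        simp only [TodoBound, List.mem_cons, forall_eq_or_imp]
        exact ⟨by omega, by omega, hl⟩
      case ite e p q =>
        simp only [TodoBound, List.mem_cons, forall_eq_or_imp]
        refine ⟨?_, hl⟩
        split_ifs <;> omega
      case loop e p =>
        split_ifs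
        · simp only [TodoBound, List.mem_cons, forall_eq_or_imp, simBound]
          exact ⟨by omega, by omega, hl⟩
        · exact hl
      all_goals exact hl
  · exact h

theorem length_todo_stepT {T : ℕ} {Q : Type} {coin : ℕ → Bool} {O : Oracle Q} {c : Config Q} :
    (stepT T coin O c).todo.length ≤ c.todo.length + 1 := by
  unfold PrivateHandshake.stepT
  split_ifs
  · rcases c with ⟨_ | ⟨p, l⟩, M, k, s, t⟩
    · simp [step]
    · cases p <;> simp only [step, List.length_cons] <;> try omega
      split_ifs <;> (try simp only [List.length_cons]) <;> omega
  · omega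

/-- After the result was found, the rest of the simulation is skipped. -/
theorem reach_of_halted {tape : ℕ → Bool} {S C : ℕ} (hS : 1 ≤ S) {tail : List Prog} {l l' : List Prog}
    (h : Follows n r m corrupt tail l l') (hC : TodoBound n r m corrupt S C l) {M : Memory}
    (hM : M 0 16 = 1) (pos s : ℕ) :
    ∃ M' t, Reach tape ⟨l', M, pos, (), s⟩ ⟨tail, M', pos, (), s + t⟩ ∧ t ≤ l.length * C ∧
      M' 0 17 = M 0 17 := by
  -- Reading variable `16` costs `1 + 5` for the literal and `1 + 1` for its value `1`; the
  -- constants `17`, `8` and `10` below arise in the same way.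
  have c16 : ∀ M : Memory, M 0 16 = 1 → (var 16).cost M = 8 := by
    intro M h
    simp [ATerm.cost, ATerm.eval, h]
    decide
  have hcond : ∀ (e : ATerm) (rest : List Prog) (M : Memory) (s : ℕ), M 0 16 = 1 →
      Reach tape ⟨conditionProg n r m e :: rest, M, pos, (), s⟩
        ⟨rest, M.write 0 18 0, pos, (), s + 17⟩ := by
    intro e rest M s h
    have h1 : (var 16).eval M ≠ 0 := by simp [ATerm.eval, h]
    have h2 : step tape noOracle ⟨conditionProg n r m e :: rest, M, pos, (), s⟩ =
        ⟨assign 18 (.lit 0) :: rest, M, pos, (), s + 9⟩ := by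
      simp only [conditionProg, step, h1, c16 M h, if_true, ne_eq, not_false_eq_true]
    refine Reach.step ?_
    rw [h2]
    refine ⟨1, ?_⟩
    have : Nat.size 18 = 5 := by decide
    simp [step, ATerm.cost, ATerm.eval, this]
  have hloop : ∀ (p : Prog) (rest : List Prog) (M : Memory) (s : ℕ), M 0 18 = 0 →
      Reach tape ⟨.loop (var 18) p :: rest, M, pos, (), s⟩ ⟨rest, M, pos, (), s + 8⟩ := by
    intro p rest M s h
    refine ⟨1, ?_⟩
    have : Nat.size 18 = 5 := by decide
    simp [step, ATerm.eval, ATerm.cost, h, this]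
  have hun : ∀ (p : Prog) (rest : List Prog) (M : Memory) (s : ℕ), M 0 16 = 1 →
      Reach tape ⟨unlessHalted p :: rest, M, pos, (), s⟩ ⟨rest, M, pos, (), s + 10⟩ := by
    intro p rest M s h
    refine ⟨2, ?_⟩
    have h1 : (var 16).eval M ≠ 0 := by simp [ATerm.eval, h]
    simp only [Function.iterate_succ_apply', Function.iterate_zero_apply, unlessHalted, step, h1,
      c16 M h, if_true, ne_eq, not_false_eq_true]
  have htr : ∀ (p : Prog) (rest : List Prog) (M : Memory) (s : ℕ), M 0 16 = 1 →
      ∃ M' t, Reach tape ⟨translate n r m corrupt p :: rest, M, pos, (), s⟩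
        ⟨rest, M', pos, (), s + t⟩ ∧ t ≤ simBound n r m corrupt S p ∧
        M' 0 16 = 1 ∧ M' 0 17 = M 0 17 := by
    -- Once variable `16` is set, guarded commands are skipped at cost `10`, and a loop ends at once
    -- because its condition is replaced by `0`.
    intro p
    induction p with
    | skip => exact fun rest M s h => ⟨M, 1, ⟨1, rfl⟩, by simp only [simBound]; omega, h, rfl⟩
    | store a i e =>
      exact fun rest M s h => ⟨M, 10, hun _ _ _ _ h, by simp only [simBound]; omega, h, rfl⟩
    | flip a i e =>
      exact fun rest M s h => ⟨M, 10, hun _ _ _ _ h, by simp only [simBound]; omega, h, rfl⟩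
    | call k a e₁ e₂ =>
      exact fun rest M s h => ⟨M, 10, hun _ _ _ _ h, by simp only [simBound]; omega, h, rfl⟩
    | ite e p q =>
      exact fun rest M s h => ⟨M, 10, hun _ _ _ _ h, by simp only [simBound]; omega, h, rfl⟩
    | seq p q hp hq =>
      intro rest M s h
      obtain ⟨M₁, t₁, r₁, b₁, h₁, o₁⟩ := hp (translate n r m corrupt q :: rest) M (s + 1) h
      obtain ⟨M₂, t₂, r₂, b₂, h₂, o₂⟩ := hq rest M₁ (s + 1 + t₁) h₁
      refine ⟨M₂, 1 + t₁ + t₂, Reach.step (r₁.trans ?_), ?_, h₂, o₂.trans o₁⟩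
      · convert r₂ using 2
        omega
      · simp only [simBound]
        omega
    | loop e p _ =>
      intro rest M s h
      refine ⟨M.write 0 18 0, 1 + 17 + 8, Reach.step ((hcond e _ M (s + 1) h).trans ?_), ?_, ?_, ?_⟩
      · convert hloop _ rest _ (s + 1 + 17) (Memory.write_self M 0 18 0) using 2
      · simp only [simBound]
        omega
      · rw [Memory.write_of_ne _ (by omega), h]
      · rw [Memory.write_of_ne _ (by omega)]
  induction h generalizing M s with
  | nil => exact ⟨M, 0, Reach.refl _ _, by simp, rfl⟩
  | @cons l l' p _ ih =>
    obtain ⟨M₁, t₁, r₁, b₁, h₁, o₁⟩ := htr p l' M s hM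
    obtain ⟨M₂, t₂, r₂, b₂, o₂⟩ := ih (fun q hq => hC q (by simp [hq])) h₁ (s + t₁)
    refine ⟨M₂, t₁ + t₂, r₁.trans ?_, ?_, o₂.trans o₁⟩
    · convert r₂ using 2
      omega
    · have := hC p (by simp)
      rw [List.length_cons, add_mul, one_mul]
      omega
  | @loop l l' e p _ ih =>
    have h1 : (M.write 0 18 0) 0 16 = 1 := by rw [Memory.write_of_ne _ (by omega), hM]
    obtain ⟨M₂, t₂, r₂, b₂, o₂⟩ := ih (fun q hq => hC q (by simp [hq])) h1 (s + 17 + 8)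
    refine ⟨M₂, 17 + 8 + t₂, (hcond e _ M s hM).trans ((hloop _ _ _ _
      (Memory.write_self M 0 18 0)).trans ?_), ?_, ?_⟩
    · convert r₂ using 2
      omega
    · have h2 := hC (.loop e p) (by simp)
      have h3 := le_simBound n r m corrupt S (.loop e p)
      rw [List.length_cons, add_mul, one_mul]
      omega
    · rw [o₂, Memory.write_of_ne _ (by omega)]

end Programs

/-! ### The invariant of the simulation -/

theorem answers_append_self {D R : Type} [DecidableEq D] (w : ℕ → R) {L : List D} {d : D}
    (h : d ∉ L) : answers w (L ++ [d]) d = w L.length := by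
  rw [answers, List.idxOf_append_of_notMem h, List.idxOf_cons_self, add_zero]

theorem answers_append_of_mem {D R : Type} [DecidableEq D] (w : ℕ → R) {L : List D} {d d' : D}
    (h : d' ∈ L) : answers w (L ++ [d]) d' = answers w L d' := by
  rw [answers, List.idxOf_append_of_mem h, answers]

section Points

variable {P : Params}

/-- The array in which the solver memorises the answer at a point. -/
def pointArr : P.Point → ℕ
  | .inl _ => 1
  | .inr (.inl _) => 2
  | .inr (.inr _) => 3

/-- The cell in which the solver memorises the answer at a point. -/
def pointIdx : P.Point → ℕ
  | .inl v => v
  | .inr (.inl a) => a.1 * 2 ^ P.secLen + a.2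
  | .inr (.inr a) => a.1 * 2 ^ P.secLen + a.2

/-- The part of an answer that is relevant for a point. -/
def pointOut : P.Point → P.Answer → ℕ
  | .inl _, b => b.1
  | .inr _, b => b.2

/-- The kind of the answers at a point. -/
def pointKind (n r m : ℕ) : P.Point → Kind n r m
  | .inl _ => .key
  | .inr _ => .hash

/-- What the solver does after a new point was evaluated. -/
def pointHit : P.Point → Prog
  | .inl _ => hitProg
  | .inr _ => .skip

theorem pair_index_inj {b k k' s s' : ℕ} (hs : s < b) (hs' : s' < b)
    (h : k * b + s = k' * b + s') : k = k' ∧ s = s' := by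
  have h1 : (k * b + s) / b = k := by
    rw [add_comm, Nat.add_mul_div_right _ _ (by omega), Nat.div_eq_of_lt hs, zero_add]
  have h2 : (k' * b + s') / b = k' := by
    rw [add_comm, Nat.add_mul_div_right _ _ (by omega), Nat.div_eq_of_lt hs', zero_add]
  have h3 : k = k' := by rw [← h1, ← h2, h]
  subst h3
  exact ⟨rfl, by omega⟩

/-- The cells of the memo tables do not clash: the three oracles have separate arrays, and a pair is
coded by `k * 2 ^ secLen + s` with `s < 2 ^ secLen`. -/
theorem point_ext {d d' : P.Point} (h : pointArr d' = pointArr d ∧ pointIdx d' = pointIdx d) :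
    d' = d := by
  obtain ⟨h1, h2⟩ := h
  rcases d with v | a | a <;> rcases d' with v' | a' | a' <;>
    simp only [pointArr, pointIdx] at h1 h2 <;> try omega
  · rw [Fin.ext h2]
  · obtain ⟨h3, h4⟩ := pair_index_inj a'.2.2 a.2.2 h2
    rw [Prod.ext (Fin.ext h3) (Fin.ext h4)]
  · obtain ⟨h3, h4⟩ := pair_index_inj a'.2.2 a.2.2 h2
    rw [Prod.ext (Fin.ext h3) (Fin.ext h4)]

theorem pointArr_pos (d : P.Point) : 1 ≤ pointArr d := by
  rcases d with v | a | a <;> simp [pointArr]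

theorem pointArr_lt (d : P.Point) : pointArr d < 4 := by
  rcases d with v | a | a <;> simp [pointArr]

/-- The point at which a random oracle is evaluated by a query. -/
def queryPoint (P : Params) (k v w : ℕ) : Option P.Point :=
  match k with
  | 0 => some (.inl (Fin.ofNat _ v))
  | 1 => some (.inr (.inl (Fin.ofNat _ v, Fin.ofNat _ w)))
  | 2 => some (.inr (.inr (Fin.ofNat _ v, Fin.ofNat _ w)))
  | _ => none

end Points

/-! ### The simulation relation and the answers of the random oracles -/

section Simulation

variable {P : Params} {n r m T : ℕ}

/-- The values of a transcript. -/
def Sample.transcriptValue (ω : Sample P n r m T) (t : Fin T) : Kind n r m → ℕ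
  | .x => ω.msgA t
  | .y => ω.msgB t
  | .idealA c => ω.idealA t c
  | .idealB c => ω.idealB t c
  | _ => 0

theorem Sample.idealRun_eq (ω : Sample P n r m T) (t : Fin T) :
    ω.idealRun t = (transcriptKinds n r m).map (ω.transcriptValue t) := by
  simp [Sample.idealRun, transcriptKinds, Sample.transcriptValue, List.map_ofFn, Function.comp_def]

/-- The memory `M` of the solver represents the memory `mem` of the eavesdropper after `cnt` runs
and evaluation of the random oracles at the points of `L`. -/
structure Sim (ω : Sample P n r m T) (w : ℕ → P.Answer) (q : ℕ) (mem : Memory) (L : List P.Point)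
    (cnt : ℕ) (M : Memory) : Prop where
  adv : ∀ a i, M (offset n r m + a) i = mem a i
  p : M 0 1 = P.grp.p
  key : M 0 6 = 2 ^ P.keyLen
  sec : M 0 7 = 2 ^ P.secLen
  asked : M 0 14 = L.length
  runs : M 0 15 = cnt
  going : M 0 16 = 0
  ask : M 0 22 = q
  known : ∀ d ∈ L, M (pointArr d) (pointIdx d) = pointOut d (answers w L d) + 1
  unknown : ∀ d ∉ L, M (pointArr d) (pointIdx d) = 0
  pool : ∀ (d : P.Point) (t : ℕ), t < T → M (pointKind n r m d).arr t = pointOut d (w t)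
  transcript : ∀ (t : Fin T), ∀ k ∈ transcriptKinds n r m, M k.arr t = ω.transcriptValue t k
  fresh : ∀ z, L[q]? ≠ some (.inl z)

/-- Either the simulation goes on, or the solver has found its result. -/
def Outcome (ω : Sample P n r m T) (w : ℕ → P.Answer) (q : ℕ) (mem : Memory) (L : List P.Point)
    (cnt : ℕ) (M : Memory) : Prop :=
  Sim ω w q mem L cnt M ∨ M 0 16 = 1 ∧ ∃ z, L[q]? = some (.inl z) ∧ M 0 17 = z

variable {ω : Sample P n r m T} {w : ℕ → P.Answer} {q : ℕ} {mem : Memory} {L : List P.Point}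
  {cnt : ℕ} {M : Memory}

/-- Variables from `17` on are scratch, except `22`, which holds the guessed position. All other
cells below the arrays of the eavesdropper have to stay unchanged. -/
theorem Sim.of_low (h : Sim ω w q mem L cnt M) {M' : Memory} {mem' : Memory}
    (hlow : ∀ a < offset n r m, ∀ i, ¬ (a = 0 ∧ 17 ≤ i ∧ i ≠ 22) → M' a i = M a i)
    (hadv : ∀ a i, M' (offset n r m + a) i = mem' a i) : Sim ω w q mem' L cnt M' := by
  have h0 : 0 < offset n r m := offset_pos
  have h4 : 4 ≤ offset n r m := four_le_offset
  have harr : ∀ (k : Kind n r m) i, M' k.arr i = M k.arr i := fun k i =>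
    hlow _ k.arr_lt _ (by have := k.le_arr; omega)
  refine ⟨hadv, ?_, ?_, ?_, ?_, ?_, ?_, ?_, ?_, ?_, ?_, ?_, h.fresh⟩
  · rw [hlow _ h0 _ (by omega), h.p]
  · rw [hlow _ h0 _ (by omega), h.key]
  · rw [hlow _ h0 _ (by omega), h.sec]
  · rw [hlow _ h0 _ (by omega), h.asked]
  · rw [hlow _ h0 _ (by omega), h.runs]
  · rw [hlow _ h0 _ (by omega), h.going]
  · rw [hlow _ h0 _ (by omega), h.ask]
  · intro d hd
    have := pointArr_pos d
    have := pointArr_lt d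
    rw [hlow _ (by omega) _ (by omega), h.known d hd]
  · intro d hd
    have := pointArr_pos d
    have := pointArr_lt d
    rw [hlow _ (by omega) _ (by omega), h.unknown d hd]
  · intro d t ht
    rw [harr, h.pool d t ht]
  · intro t k hk
    rw [harr, h.transcript t k hk]

theorem Sim.write_scratch (h : Sim ω w q mem L cnt M) {i : ℕ} (h1 : 17 ≤ i) (h2 : i ≠ 22) (v : ℕ) :
    Sim ω w q mem L cnt (M.write 0 i v) := by
  have h0 : 0 < offset n r m := offset_pos
  refine h.of_low (fun a ha j hj => Memory.write_of_ne _ ?_) fun a j => ?_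
  · rintro ⟨rfl, rfl⟩
    exact hj ⟨rfl, h1, h2⟩
  · rw [Memory.write_of_ne _ (by omega), h.adv]

theorem Sim.write_adv (h : Sim ω w q mem L cnt M) (a i v : ℕ) :
    Sim ω w q (mem.write a i v) L cnt (M.write (offset n r m + a) i v) := by
  refine h.of_low (fun b hb j hj => Memory.write_of_ne _ (by omega)) fun b j => ?_
  unfold Memory.write
  rw [h.adv]
  simp only [Nat.add_left_cancel_iff]

theorem writeList_singleton (M : Memory) (a v : ℕ) : M.writeList a [v] = M.write a 0 v := by
  funext b j
  unfold Memory.writeList Memory.write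
  rcases j with _ | j
  · simp
  · simp

/-- A new point was evaluated, and its answer was memorised. -/
theorem Sim.append (h : Sim ω w q mem L cnt M) {d : P.Point} (hd : d ∉ L)
    (hfresh : ∀ z, (L ++ [d])[q]? ≠ some (.inl z)) :
    Sim ω w q mem (L ++ [d]) cnt ((M.write (pointArr d) (pointIdx d)
      (1 + pointOut d (w L.length))).write 0 14 (L.length + 1)) := by
  have h4 : 4 ≤ offset n r m := four_le_offset
  have hd1 := pointArr_pos d
  have hd2 := pointArr_lt d
  have hrest : ∀ b j, ¬ (b = pointArr d ∧ j = pointIdx d) → ¬ (b = 0 ∧ j = 14) →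
      ((M.write (pointArr d) (pointIdx d) (1 + pointOut d (w L.length))).write 0 14
        (L.length + 1)) b j = M b j := by
    intro b j h1 h2
    rw [Memory.write_of_ne _ h2, Memory.write_of_ne _ h1]
  refine ⟨?_, ?_, ?_, ?_, ?_, ?_, ?_, ?_, ?_, ?_, ?_, ?_, hfresh⟩
  · intro a i
    rw [hrest _ _ (by omega) (by omega), h.adv]
  · rw [hrest _ _ (by omega) (by omega), h.p]
  · rw [hrest _ _ (by omega) (by omega), h.key]
  · rw [hrest _ _ (by omega) (by omega), h.sec]
  · rw [Memory.write_self, List.length_append, List.length_singleton]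
  · rw [hrest _ _ (by omega) (by omega), h.runs]
  · rw [hrest _ _ (by omega) (by omega), h.going]
  · rw [hrest _ _ (by omega) (by omega), h.ask]
  · intro d' hd'
    have := pointArr_pos d'
    by_cases hdd : d' = d
    · subst hdd
      rw [Memory.write_of_ne _ (by omega), Memory.write_self,
        answers_append_self w hd, add_comm]
    · have hd' : d' ∈ L := by simpa [hdd] using hd'
      rw [hrest _ _ (fun h => hdd (point_ext h)) (by omega), h.known d' hd',
        answers_append_of_mem w hd']
  · intro d' hd'
    have := pointArr_pos d'
    rw [List.mem_append, List.mem_singleton, not_or] at hd'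
    rw [hrest _ _ (fun h => hd'.2 (point_ext h)) (by omega), h.unknown d' hd'.1]
  · intro d' t ht
    have := (pointKind n r m d').le_arr
    rw [hrest _ _ (by omega) (by omega), h.pool d' t ht]
  · intro t k hk
    have := k.le_arr
    rw [hrest _ _ (by omega) (by omega), h.transcript t k hk]

theorem getElem?_append_singleton_ne {d : P.Point} (hfresh : ∀ z, L[q]? ≠ some (.inl z))
    (hd : q = L.length → ∀ z, d ≠ .inl z) (z) : (L ++ [d])[q]? ≠ some (.inl z) := by
  rcases lt_trichotomy q L.length with h | h | h
  · rw [List.getElem?_append_left h]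
    exact hfresh z
  · rw [h, List.getElem?_concat_length]
    simpa using hd h z
  · rw [List.getElem?_eq_none (by simp; omega)]
    simp

variable {S : ℕ} {tape : ℕ → Bool} {pos : ℕ}

/-- Only arguments of `h` can be Diffie-Hellman secrets, so at points of the keyed oracles the
counter is not compared with the guess. Otherwise the new point has index `L.length`, which is the
present value of the counter. -/
theorem does_pointHit (hS : 1 ≤ S) (h : Sim ω w q mem L cnt M) (d : P.Point)
    (h19 : M 0 19 = pointIdx d) (hsz : (pointIdx d).size ≤ S) {M₁ : Memory}
    (h14 : M₁ 0 14 = L.length) (h22 : M₁ 0 22 = q) (h19' : M₁ 0 19 = pointIdx d) :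
    Does (offset n r m) S tape (pointHit d) M₁ pos fun M₂ pos' => pos' = pos ∧
      (M₂ = M₁ ∧ (∀ z, (L ++ [d])[q]? ≠ some (.inl z)) ∨
        M₂ 0 14 = L.length ∧ M₂ 0 16 = 1 ∧ ∃ z, (L ++ [d])[q]? = some (.inl z) ∧ M₂ 0 17 = z) := by
  have h0 : 0 < offset n r m := offset_pos
  rcases d with v | a
  · refine Does.ite hS (ATerm.priv_eq.2 (by simp [ATerm.Priv, h0])) (fun hq => ?_) (fun hq => ?_)
    · rw [ATerm.eval_eq] at hq
      simp only [ATerm.eval, h14, h22] at hq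
      have hq : L.length = q := by by_contra hne; simp [hne] at hq
      refine Does.seq (Does.store hS trivial (by simp [ATerm.Priv, h0]) (fun _ => ?_) ?_)
      · simpa [ATerm.eval, h19'] using hsz
      refine Does.store hS trivial trivial (fun _ => by simpa [ATerm.eval] using hS)
        ⟨rfl, Or.inr ⟨?_, ?_, v, ?_, ?_⟩⟩
      · simp [Memory.write, ATerm.eval, h14]
      · simp [Memory.write, ATerm.eval]
      · rw [← hq, List.getElem?_concat_length]
      · simp [Memory.write, ATerm.eval, h19', pointIdx]
    · rw [ATerm.eval_eq] at hq
      simp only [ATerm.eval, h14, h22] at hq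
      have hq : L.length ≠ q := by rintro hne; simp [hne] at hq
      exact Does.skip ⟨rfl, Or.inl ⟨rfl, getElem?_append_singleton_ne h.fresh
        fun h => absurd h.symm hq⟩⟩
  · exact Does.skip ⟨rfl, Or.inl ⟨rfl, getElem?_append_singleton_ne h.fresh
      fun _ z => by simp⟩⟩

theorem size_one_add_le {b v s : ℕ} (h : v < 2 ^ b) (hs : b < s) : (1 + v).size ≤ s := by
  rw [Nat.size_le]
  have h1 : 2 ^ (b + 1) ≤ 2 ^ s := Nat.pow_le_pow_right (by norm_num) hs
  have h2 : 1 ≤ 2 ^ b := Nat.one_le_two_pow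
  rw [pow_succ] at h1
  omega

theorem size_one_add_pointOut (h1 : P.keyLen < S) (h2 : P.hashLen < S) (d : P.Point)
    (b : P.Answer) : (1 + pointOut d b).size ≤ S := by
  rcases d with v | a
  · exact size_one_add_le b.1.2 h1
  · exact size_one_add_le b.2.2 h2

/-- A query to a random oracle is answered. -/
theorem does_answerProg (hS : 1 ≤ S) (h1 : P.keyLen < S) (h2 : P.hashLen < S) (hTS : T ≤ S)
    (h : Sim ω w q mem L cnt M) (hL : L.length < T) (d : P.Point) (h19 : M 0 19 = pointIdx d)
    (hsz : (pointIdx d).size ≤ S) (a : ℕ) :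
    Does (offset n r m) S tape
      (answerProg (offset n r m) (pointArr d) (pointKind n r m d).arr (pointHit d) a) M pos
      fun M' pos' => pos' = pos ∧
        Outcome ω w q (mem.writeList a [pointOut d (answers w (record L (some d)) d)])
          (record L (some d)) cnt M' := by
  have h0 : 0 < offset n r m := offset_pos
  have h4 : 4 ≤ offset n r m := four_le_offset
  have hd1 := pointArr_pos d
  have hd2 := pointArr_lt d
  rw [writeList_singleton]
  unfold record
  simp only
  by_cases hd : d ∈ L
  -- Memo cells hold the answer plus one, so that `0` can stand for an unknown point.
  · have hmemo := h.known d hd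
    rw [if_pos hd]
    refine Does.seq (Does.ite hS ⟨by omega, h0, trivial⟩ (fun _ => Does.skip ?_) fun hz => ?_)
    · refine Does.store hS trivial ⟨⟨by omega, h0, trivial⟩, trivial⟩
        (fun h => absurd h (by simp)) ⟨rfl, Or.inl ?_⟩
      simp only [ATerm.eval, h19, hmemo, Nat.add_sub_cancel]
      exact h.write_adv _ _ _
    · simp [ATerm.eval, h19, hmemo] at hz
  · have hmemo := h.unknown d hd
    rw [if_neg hd]
    refine Does.seq (Does.ite hS ⟨by omega, h0, trivial⟩ (fun hz => ?_) fun _ => ?_)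
    · simp [ATerm.eval, h19, hmemo] at hz
    have hpool := h.pool d L.length hL
    refine Does.seq (Does.store hS ⟨h0, trivial⟩ ⟨trivial, Kind.arr_lt _, h0, trivial⟩
      (fun _ => ?_) ?_)
    · simp only [ATerm.eval, h.asked, hpool]
      exact size_one_add_pointOut h1 h2 _ _
    simp only [ATerm.eval, h.asked, hpool, h19]
    set M₁ := M.write (pointArr d) (pointIdx d) (1 + pointOut d (w L.length)) with hM₁
    have e : ∀ i, M₁ 0 i = M 0 i := fun i => Memory.write_of_ne _ (by omega)
    refine Does.seq ((does_pointHit hS h d h19 hsz (by rw [e, h.asked]) (by rw [e, h.ask])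
      (by rw [e, h19])).mono ?_)
    rintro M₂ pos₂ hM₂ ⟨rfl, hcase⟩
    have h14 : M₂ 0 14 = L.length := by
      rcases hcase with ⟨rfl, -⟩ | ⟨h14, -⟩
      · rw [e, h.asked]
      · exact h14
    refine Does.store hS trivial ⟨⟨h0, trivial⟩, trivial⟩ (fun _ => ?_) ?_
    · simp only [ATerm.eval, h14]
      rw [Nat.size_le]
      exact Nat.lt_two_pow_self.trans_le (Nat.pow_le_pow_right (by norm_num) (by omega))
    simp only [ATerm.eval, h14]
    refine Does.store hS trivial ⟨⟨by omega, h0, trivial⟩, trivial⟩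
      (fun h => absurd h (by simp)) ⟨rfl, ?_⟩
    rcases hcase with ⟨rfl, hf⟩ | ⟨-, h16, z, hz, h17⟩
    · left
      have hs := h.append hd hf
      rw [← hM₁] at hs
      have ev : (ATerm.sub (.get (pointArr d) (var 19)) (.lit 1)).eval (M₁.write 0 14 (L.length + 1))
          = pointOut d (answers w (L ++ [d]) d) := by
        simp only [ATerm.eval]
        rw [Memory.write_of_ne _ (show ¬ ((0 : ℕ) = 0 ∧ 19 = 14) by omega), e, h19,
          hs.known d (by simp), Nat.add_sub_cancel]
      rw [ev]
      exact hs.write_adv _ _ _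
    · right
      refine ⟨?_, z, hz, ?_⟩
      · rw [Memory.write_of_ne _ (by omega), Memory.write_of_ne _ (by omega), h16]
      · rw [Memory.write_of_ne _ (by omega), Memory.write_of_ne _ (by omega), h17]

end Simulation

/-! ### The simulation of one step -/

section Reply

variable {P : Params} {n r m T : ℕ} {corrupt : Finset (Fin n)}

theorem eval_honestTerm {s : ATerm} {M : Memory} :
    (honestTerm corrupt s).eval M ≠ 0 ↔ ∃ u : Fin n, u ∉ corrupt ∧ s.eval M = u := by
  have key : ∀ l : List (Fin n), (l.foldr (fun u t => if u ∈ corrupt then t else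
      ATerm.add (.eq s (.lit u)) t) (.lit 0)).eval M ≠ 0 ↔
      ∃ u ∈ l, u ∉ corrupt ∧ s.eval M = u := by
    intro l
    induction l with
    | nil => simp [ATerm.eval]
    | cons u l ih =>
      simp only [List.foldr_cons, List.exists_mem_cons_iff]
      split_ifs with hu
      · simp [ih, hu]
      · rw [← ih]
        simp only [ATerm.eval, ATerm.eval_eq, hu, not_false_eq_true, true_and]
        split_ifs with h
        · simp [h]
        · simp [h]
  rw [honestTerm, key]
  simp

theorem priv_honestTerm {s : ATerm} {K : ℕ} (hs : s.Priv K) : (honestTerm corrupt s).Priv K := by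
  unfold honestTerm
  induction List.finRange n with
  | nil => trivial
  | cons u l ih =>
    rw [List.foldr_cons]
    split_ifs
    · exact ih
    · exact ⟨ATerm.priv_eq.2 ⟨hs, trivial⟩, ih⟩

theorem mem_transcriptTerms {a b i : ℕ} {e : ATerm} :
    (b, i, e) ∈ transcriptTerms n r m a ↔
      b = a ∧ ∃ k, (transcriptKinds n r m)[i]? = some k ∧ e = .get k.arr (var 15) := by
  simp only [transcriptTerms, List.mem_map, Prod.exists, Prod.mk.injEq,
    List.mk_mem_zipIdx_iff_getElem?]
  constructor
  · rintro ⟨k, j, hk, rfl, rfl, rfl⟩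
    exact ⟨rfl, k, hk, rfl⟩
  · rintro ⟨rfl, k, hk, rfl⟩
    exact ⟨k, i, hk, rfl, rfl, rfl⟩

variable {ω : Sample P n r m T} {w : ℕ → P.Answer} {q : ℕ} {mem : Memory} {L : List P.Point}
  {cnt : ℕ} {M : Memory} {S : ℕ} {tape : ℕ → Bool} {pos : ℕ}

theorem writeList_nil (M : Memory) (a : ℕ) : M.writeList a [] = M := by
  funext b j
  simp [Memory.writeList]

/-- An idealised run is performed. -/
theorem does_transcript (hS : 1 ≤ S) (hTS : T ≤ S) (h : Sim ω w q mem L cnt M) (hcnt : cnt < T)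
    (a : ℕ) :
    Does (offset n r m) S tape (.seq (storesProg (offset n r m) (transcriptTerms n r m a))
      (assign 15 (.add (var 15) (.lit 1)))) M pos fun M' pos' => pos' = pos ∧
        Sim ω w q (mem.writeList a (ω.idealRun ⟨cnt, hcnt⟩)) L (cnt + 1) M' := by
  have h0 : 0 < offset n r m := offset_pos
  refine Does.seq ((does_storesProg hS _ (fun e he => ?_) _ _).mono ?_)
  · obtain ⟨b, i, e⟩ := e
    obtain ⟨-, k, -, rfl⟩ := mem_transcriptTerms.1 he
    exact ⟨k.arr_lt, h0, trivial⟩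
  rintro M' pos' hM' ⟨rfl, hlow, hst⟩
  have hs : Sim ω w q (mem.writeList a (ω.idealRun ⟨cnt, hcnt⟩)) L cnt M' := by
    refine h.of_low (fun b hb i _ => hlow b hb i) fun b i => hst b i _ (fun e he => ?_) ?_
    · obtain ⟨rfl, k, hk, rfl⟩ := mem_transcriptTerms.1 he
      have hmem := List.mem_of_getElem? hk
      simp only [ATerm.eval, h.runs]
      refine (h.transcript ⟨cnt, hcnt⟩ k hmem).trans ?_
      simp [Memory.writeList, Sample.idealRun_eq, hk]
    · by_cases hk : b = a ∧ ∃ k, (transcriptKinds n r m)[i]? = some k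
      · obtain ⟨rfl, k, hk⟩ := hk
        exact Or.inl ⟨_, mem_transcriptTerms.2 ⟨rfl, k, hk, rfl⟩⟩
      · right
        rw [h.adv]
        unfold Memory.writeList
        split_ifs with hb
        · have hn : (transcriptKinds n r m)[i]? = none := by
            by_contra hne
            obtain ⟨k, hk'⟩ := Option.ne_none_iff_exists'.1 hne
            exact hk ⟨hb, k, hk'⟩
          simp [Sample.idealRun_eq, hn]
        · rfl
  refine Does.store hS trivial ⟨⟨h0, trivial⟩, trivial⟩ (fun _ => ?_) ?_
  · simp only [ATerm.eval, hs.runs]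
    rw [Nat.size_le]
    exact Nat.lt_two_pow_self.trans_le (Nat.pow_le_pow_right (by norm_num) (by omega))
  simp only [ATerm.eval, hs.runs]
  have hrest : ∀ b j, ¬ (b = 0 ∧ j = 15) → (M'.write 0 15 (cnt + 1)) b j = M' b j :=
    fun b j hb => Memory.write_of_ne _ hb
  have harr : ∀ (k : Kind n r m) j, (M'.write 0 15 (cnt + 1)) k.arr j = M' k.arr j :=
    fun k j => hrest _ _ (by have := k.le_arr; omega)
  refine ⟨trivial, ?_, ?_, ?_, ?_, ?_, ?_, ?_, ?_, ?_, ?_, ?_, ?_, hs.fresh⟩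
  · intro b i
    rw [hrest _ _ (by omega), hs.adv]
  · rw [hrest _ _ (by omega), hs.p]
  · rw [hrest _ _ (by omega), hs.key]
  · rw [hrest _ _ (by omega), hs.sec]
  · rw [hrest _ _ (by omega), hs.asked]
  · rw [Memory.write_self]
  · rw [hrest _ _ (by omega), hs.going]
  · rw [hrest _ _ (by omega), hs.ask]
  · intro d hd
    have := pointArr_pos d
    rw [hrest _ _ (by omega), hs.known d hd]
  · intro d hd
    have := pointArr_pos d
    rw [hrest _ _ (by omega), hs.unknown d hd]
  · intro d t ht
    rw [harr, hs.pool d t ht]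
  · intro t k hk
    rw [harr, hs.transcript t k hk]

/-- A query of the eavesdropper is answered. -/
theorem does_replyProg (hS : 1 ≤ S) (h1 : P.keyLen < S) (h2 : P.hashLen < S)
    (h3 : P.keyLen + P.secLen ≤ S) (hTS : T ≤ S) (h : Sim ω w q mem L cnt M) (hL : L.length < T)
    (hcnt : cnt < T) {v₁ v₂ : ℕ} (h19 : M 0 19 = v₁) (h21 : M 0 21 = v₂) (k a : ℕ)
    {runs : List (Fin n × Fin n)} (hruns : runs.length = cnt) :
    Does (offset n r m) S tape (replyProg n r m corrupt k a) M pos fun M' pos' => pos' = pos ∧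
      Outcome ω w q (mem.writeList a ((ω.withRO (answers w (record L (queryPoint P k v₁ v₂)))).oracle
          corrupt (fun t _ _ => ω.idealRun t) runs k v₁ v₂).2)
        (record L (queryPoint P k v₁ v₂))
        ((ω.withRO (answers w (record L (queryPoint P k v₁ v₂)))).oracle
          corrupt (fun t _ _ => ω.idealRun t) runs k v₁ v₂).1.length M' := by
  have h0 : 0 < offset n r m := offset_pos
  -- Indices in the tables of the keyed oracles have at most `keyLen + secLen` bits; hence the
  -- hypothesis `h3`.
  have hpair : ∀ (x : P.Key × P.Secret), ((x.1 : ℕ) * 2 ^ P.secLen + x.2).size ≤ S := by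
    intro x
    rw [Nat.size_le]
    refine lt_of_lt_of_le ?_ (Nat.pow_le_pow_right (by norm_num) h3)
    rw [pow_add]
    have hx1 := x.1.2
    have hx2 := x.2.2
    calc (x.1 : ℕ) * 2 ^ P.secLen + x.2 < x.1 * 2 ^ P.secLen + 2 ^ P.secLen := by omega
      _ = (x.1 + 1) * 2 ^ P.secLen := by ring
      _ ≤ _ := Nat.mul_le_mul_right _ hx1
  have hpt : pairTerm.eval M = ((Fin.ofNat (2 ^ P.keyLen) v₁ : P.Key) : ℕ) * 2 ^ P.secLen +
      ((Fin.ofNat (2 ^ P.secLen) v₂ : P.Secret) : ℕ) := by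
    simp only [pairTerm, ATerm.eval, ATerm.eval_mod, h19, h21, h.key, h.sec, Fin.ofNat]
  have hpp : pairTerm.Priv (offset n r m) := by
    simp [pairTerm, ATerm.Priv, ATerm.priv_mod, h0]
  intro hM
  have hp : P.grp.p.size ≤ S := h.p ▸ hM 0 h0 1
  revert hM
  match k with
  | 0 =>
    have hv : (ATerm.mod (var 19) (var 1)).eval M = v₁ % P.grp.p := by
      simp only [ATerm.eval_mod, ATerm.eval, h19, h.p]
    have hsz : (v₁ % P.grp.p).size ≤ S :=
      (Nat.size_le_size (Nat.mod_lt _ P.grp.prime.pos).le).trans hp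
    refine Does.seq (Does.store hS trivial (ATerm.priv_mod.2 (by simp [ATerm.Priv, h0]))
      (fun _ => by rwa [hv]) ?_)
    rw [hv]
    refine (does_answerProg hS h1 h2 hTS (h.write_scratch (i := 19) (by norm_num) (by norm_num) _) hL
      (.inl (Fin.ofNat _ v₁)) (Memory.write_self _ _ _ _) hsz a).mono ?_
    rintro M' pos' - ⟨rfl, ho⟩
    subst hruns
    exact ⟨rfl, ho⟩
  | 1 =>
    refine Does.seq (Does.store hS trivial hpp (fun _ => by rw [hpt]; exact hpair (_, _)) ?_)
    rw [hpt]
    refine (does_answerProg hS h1 h2 hTS (h.write_scratch (i := 19) (by norm_num) (by norm_num) _) hL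
      (.inr (.inl (Fin.ofNat _ v₁, Fin.ofNat _ v₂))) (Memory.write_self _ _ _ _)
      (hpair (_, _)) a).mono ?_
    rintro M' pos' - ⟨rfl, ho⟩
    subst hruns
    exact ⟨rfl, ho⟩
  | 2 =>
    refine Does.seq (Does.store hS trivial hpp (fun _ => by rw [hpt]; exact hpair (_, _)) ?_)
    rw [hpt]
    refine (does_answerProg hS h1 h2 hTS (h.write_scratch (i := 19) (by norm_num) (by norm_num) _) hL
      (.inr (.inr (Fin.ofNat _ v₁, Fin.ofNat _ v₂))) (Memory.write_self _ _ _ _)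
      (hpair (_, _)) a).mono ?_
    rintro M' pos' - ⟨rfl, ho⟩
    subst hruns
    exact ⟨rfl, ho⟩
  | 3 =>
    have hpr : (honestTerm corrupt (var 19)).Priv (offset n r m) ∧
        (honestTerm corrupt (var 21)).Priv (offset n r m) :=
      ⟨priv_honestTerm ⟨h0, trivial⟩, priv_honestTerm ⟨h0, trivial⟩⟩
    have hiff : (ATerm.mul (honestTerm corrupt (var 19)) (honestTerm corrupt (var 21))).eval M ≠ 0 ↔
        ∃ u v : Fin n, v₁ = u ∧ v₂ = v ∧ u ∉ corrupt ∧ v ∉ corrupt := by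
      rw [ATerm.eval, mul_ne_zero_iff, eval_honestTerm, eval_honestTerm]
      simp only [ATerm.eval, h19, h21]
      constructor
      · rintro ⟨⟨u, hu, rfl⟩, v, hv, rfl⟩
        exact ⟨u, v, rfl, rfl, hu, hv⟩
      · rintro ⟨u, v, rfl, rfl, hu, hv⟩
        exact ⟨⟨u, hu, rfl⟩, v, hv, rfl⟩
    refine Does.ite hS hpr (fun hz => ?_) (fun hz => Does.skip ⟨rfl, ?_⟩)
    · obtain ⟨u, v, rfl, rfl, hu, hv⟩ := hiff.1 hz
      refine (does_transcript hS hTS h hcnt a).mono ?_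
      rintro M' pos' - ⟨rfl, ho⟩
      refine ⟨rfl, Or.inl ?_⟩
      have hc : (u : ℕ) < n ∧ (v : ℕ) < n ∧ runs.length < T := ⟨u.2, v.2, by omega⟩
      simp only [queryPoint, record, Sample.oracle, dif_pos hc, Fin.eta, hu, hv, not_false_eq_true,
        and_self, if_true]
      subst hruns
      simpa using ho
    · have hno : ¬ ∃ u v : Fin n, v₁ = u ∧ v₂ = v ∧ u ∉ corrupt ∧ v ∉ corrupt :=
        fun hex => hiff.2 hex hz
      left
      subst hruns
      simp only [queryPoint, record, Sample.oracle]
      split_ifs with hc hd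
      · exact absurd ⟨⟨v₁, hc.1⟩, ⟨v₂, hc.2.1⟩, rfl, rfl, hd.1, hd.2⟩ hno
      · simpa only [writeList_nil] using h
      · simpa only [writeList_nil] using h
  | k + 4 =>
    refine Does.skip ⟨rfl, Or.inl ?_⟩
    subst hruns
    simpa only [queryPoint, record, Sample.oracle, writeList_nil] using h

end Reply

section Step

variable {P : Params} {n r m T : ℕ} {corrupt : Finset (Fin n)} {ω : Sample P n r m T}
  {w : ℕ → P.Answer} {q : ℕ} {mem : Memory} {L : List P.Point} {cnt : ℕ} {M : Memory} {S C : ℕ}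
  {tape : ℕ → Bool}

theorem Sim.reach_unlessHalted (h : Sim ω w q mem L cnt M) (p : Prog) (rest : List Prog)
    (pos s : ℕ) : Reach tape ⟨unlessHalted p :: rest, M, pos, (), s⟩ ⟨p :: rest, M, pos, (), s + 8⟩ := by
  refine ⟨1, ?_⟩
  have : Nat.size 16 = 5 := by decide
  simp [unlessHalted, step, ATerm.eval, ATerm.cost, h.going, this]

/-- One step of a loop of the eavesdropper corresponds to evaluating the condition into variable
`18`, testing it, and unfolding the body. The commands then end in the shape described by
`Follows.loop`, with the next evaluation of the condition pending. -/
theorem Sim.reach_condition (h : Sim ω w q mem L cnt M) (e : ATerm) (p : Prog) (rest : List Prog)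
    (pos s : ℕ) :
    Reach tape ⟨conditionProg n r m e ::
        .loop (var 18) (.seq (translate n r m corrupt p) (conditionProg n r m e)) :: rest,
        M, pos, (), s⟩
      ⟨if e.eval mem ≠ 0 then translate n r m corrupt p :: conditionProg n r m e ::
          .loop (var 18) (.seq (translate n r m corrupt p) (conditionProg n r m e)) :: rest else rest,
        M.write 0 18 (e.eval mem), pos, (),
        s + (8 + (7 + e.cost mem) + (8 + (e.eval mem).size) + if e.eval mem ≠ 0 then 1 else 0)⟩ := by
  have h16 : Nat.size 16 = 5 := by decide
  have h18 : Nat.size 18 = 5 := by decide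
  have r1 : step tape noOracle ⟨conditionProg n r m e ::
      .loop (var 18) (.seq (translate n r m corrupt p) (conditionProg n r m e)) :: rest,
      M, pos, (), s⟩ = ⟨assign 18 (e.shift (offset n r m)) ::
      .loop (var 18) (.seq (translate n r m corrupt p) (conditionProg n r m e)) :: rest,
      M, pos, (), s + 8⟩ := by
    simp [conditionProg, step, ATerm.eval, ATerm.cost, h.going, h16]
  have r2 : step tape noOracle ⟨assign 18 (e.shift (offset n r m)) ::
      .loop (var 18) (.seq (translate n r m corrupt p) (conditionProg n r m e)) :: rest,
      M, pos, (), s + 8⟩ = ⟨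
      .loop (var 18) (.seq (translate n r m corrupt p) (conditionProg n r m e)) :: rest,
      M.write 0 18 (e.eval mem), pos, (), s + 8 + (7 + e.cost mem)⟩ := by
    simp [step, ATerm.eval_shift h.adv, ATerm.cost_shift h.adv, ATerm.eval, ATerm.cost, h18]
  have r3 : step tape noOracle ⟨
      .loop (var 18) (.seq (translate n r m corrupt p) (conditionProg n r m e)) :: rest,
      M.write 0 18 (e.eval mem), pos, (), s + 8 + (7 + e.cost mem)⟩ = ⟨if e.eval mem ≠ 0 then
        .seq (translate n r m corrupt p) (conditionProg n r m e) ::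
        .loop (var 18) (.seq (translate n r m corrupt p) (conditionProg n r m e)) :: rest else rest,
      M.write 0 18 (e.eval mem), pos, (),
      s + 8 + (7 + e.cost mem) + (8 + (e.eval mem).size)⟩ := by
    simp only [step, ATerm.eval, ATerm.cost, h18, Memory.write_self, Config.mk.injEq, true_and]
    omega
  refine Reach.step ?_
  rw [r1]
  refine Reach.step ?_
  rw [r2]
  refine Reach.step ?_
  rw [r3]
  split_ifs with hz
  · refine ⟨1, ?_⟩
    simp only [Function.iterate_one, step, Config.mk.injEq, true_and]
    omega
  · refine ⟨0, ?_⟩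
    simp only [Function.iterate_zero_apply, Config.mk.injEq, true_and]
    omega

theorem coinNumber_congr {coin coin' : ℕ → Bool} {a b len : ℕ}
    (h : ∀ d < len, coin (a + d) = coin' (b + d)) : coinNumber coin a len = coinNumber coin' b len := by
  unfold coinNumber
  exact Finset.sum_congr rfl fun d hd => by rw [h d (Finset.mem_range.1 hd)]

/-- The limits within which the simulation works. -/
structure Limits (P : Params) (T S : ℕ) : Prop where
  one_le : 1 ≤ S
  key : P.keyLen < S
  hash : P.hashLen < S
  pair : P.keyLen + P.secLen ≤ S
  time : T ≤ S

/-- One step of the eavesdropper is simulated. -/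
theorem Sim.exists_reach (hlim : Limits P T S) {tail : List Prog}
    {x : Config (List (Fin n × Fin n))} {l' : List Prog}
    (hF : Follows n r m corrupt tail x.todo l') (h : Sim ω w q x.mem L x.state.length M)
    (hM : Small (offset n r m) S M) (hC : TodoBound n r m corrupt S C x.todo) (hL : L.length < T)
    (hcnt : x.state.length < T) {n₀ : ℕ} (htape : ∀ d < T, tape (n₀ + d) = extendTape ω.coin d)
    (htoss : x.tossed ≤ x.spent) {y : Config (List (Fin n × Fin n)) × List P.Point}
    (hy : y = lazyStep (ω.idealStep corrupt) (Config.point P T) w (x, L)) (s : ℕ) :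
    ∃ l'' M' t, Reach tape ⟨l', M, n₀ + x.tossed, (), s⟩ ⟨l'', M', n₀ + y.1.tossed, (), s + t⟩ ∧
      t ≤ C ∧ Follows n r m corrupt tail y.1.todo l'' ∧ Small (offset n r m) S M' ∧
      Outcome ω w q y.1.mem y.2 y.1.state.length M' := by
  subst hy
  have h0 : 0 < offset n r m := offset_pos
  have hS := hlim.one_le
  have hTS := hlim.time
  -- If the eavesdropper cannot afford the step, it stands still, and the solver does nothing.
  by_cases hdue : x.due ≤ T
  swap
  · refine ⟨l', M, 0, ?_, Nat.zero_le _, ?_, hM, Or.inl ?_⟩ <;>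
      simp only [lazyStep, Sample.idealStep, stepT, Config.point, hdue, if_false, record]
    · exact Reach.refl _ _
    · exact hF
    · exact h
  obtain ⟨todo, mem, k, runs, sp⟩ := x
  simp only at h hC hcnt htoss hF
  have hun := fun p rest => h.reach_unlessHalted (tape := tape) p rest (n₀ + k) s
  cases hF with
  | nil =>
    refine ⟨tail, M, 0, ?_, Nat.zero_le _, ?_, hM, Or.inl ?_⟩ <;>
      simp only [lazyStep, Sample.idealStep, stepT, Config.point, hdue, if_true, record, step,
        Config.query]
    · exact Reach.refl _ _
    · exact Follows.nil
    · exact h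
  | @loop l l' e p hF =>
    have hC1 := hC _ List.mem_cons_self
    have hC2 := le_simBound n r m corrupt S (.loop e p)
    have hcost := e.cost_pos mem
    have hd : sp + (1 + e.cost mem) ≤ T := hdue
    refine ⟨(if e.eval mem ≠ 0 then translate n r m corrupt p :: conditionProg n r m e ::
          .loop (var 18) (.seq (translate n r m corrupt p) (conditionProg n r m e)) :: l' else l'),
      M.write 0 18 (e.eval mem), (8 + (7 + e.cost mem) + (8 + (e.eval mem).size) + if e.eval mem ≠ 0 then 1 else 0), ?_, ?_, ?_, ?_, Or.inl ?_⟩ <;>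
      (try simp only [lazyStep, Sample.idealStep, stepT, Config.point, hdue, if_true, record, step,
        Config.query])
    · exact h.reach_condition e p l' (n₀ + k) s
    · split_ifs <;> omega
    · split_ifs
      · exact Follows.cons _ (Follows.loop _ _ hF)
      · exact hF
    · exact hM.write fun _ => by omega
    · exact h.write_scratch (by norm_num) (by norm_num) _
  | @cons l l' p hF =>
    have hC1 := hC _ List.mem_cons_self
    have hC2 := le_simBound n r m corrupt S p
    cases p with
    | skip =>
      refine ⟨l', M, 1, ?_, by omega, ?_, hM, Or.inl ?_⟩ <;>
        simp only [lazyStep, Sample.idealStep, stepT, Config.point, hdue, if_true, record, step,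
          Config.query]
      · exact ⟨1, rfl⟩
      · exact hF
      · exact h
    | store a i e =>
      have hd : sp + (1 + i.cost mem + e.cost mem) ≤ T := hdue
      refine ⟨l', M.write (offset n r m + a) (i.eval mem) (e.eval mem),
        8 + (1 + i.cost mem + e.cost mem), (hun _ _).trans ?_, by omega, ?_,
        hM.write fun h => absurd h (by simp), Or.inl ?_⟩ <;>
        simp only [lazyStep, Sample.idealStep, stepT, Config.point, hdue, if_true, record, step,
          Config.query]
      · refine ⟨1, ?_⟩
        simp only [Function.iterate_one, step, ATerm.eval_shift h.adv, ATerm.cost_shift h.adv,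
          Nat.add_assoc]
      · exact hF
      · exact h.write_adv _ _ _
    | flip a i e =>
      have hd : sp + (1 + i.cost mem + e.cost mem + e.eval mem) ≤ T := hdue
      -- The step is affordable and `k ≤ sp`, so only coins with index below `T` are read, and these
      -- are copied on the tape of the solver from position `n₀` on.
      have hcoin : coinNumber tape (n₀ + k) (e.eval mem) =
          coinNumber (extendTape ω.coin) k (e.eval mem) := by
        refine coinNumber_congr fun d hd' => ?_
        rw [add_assoc]
        exact htape _ (by omega)
      refine ⟨l', M.write (offset n r m + a) (i.eval mem)
        (coinNumber (extendTape ω.coin) k (e.eval mem)),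
        8 + (1 + i.cost mem + e.cost mem + e.eval mem), (hun _ _).trans ?_, by omega, ?_,
        hM.write fun h => absurd h (by simp), Or.inl ?_⟩ <;>
        simp only [lazyStep, Sample.idealStep, stepT, Config.point, hdue, if_true, record, step,
          Config.query]
      · refine ⟨1, ?_⟩
        simp only [Function.iterate_one, step, ATerm.eval_shift h.adv, ATerm.cost_shift h.adv,
          hcoin, Nat.add_assoc]
      · exact hF
      · exact h.write_adv _ _ _
    | seq p p' =>
      refine ⟨translate n r m corrupt p :: translate n r m corrupt p' :: l', M, 1, ?_, by omega,
        ?_, hM, Or.inl ?_⟩ <;>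
        simp only [lazyStep, Sample.idealStep, stepT, Config.point, hdue, if_true, record, step,
          Config.query]
      · exact ⟨1, rfl⟩
      · exact Follows.cons _ (Follows.cons _ hF)
      · exact h
    | ite e p p' =>
      have hd : sp + (1 + e.cost mem) ≤ T := hdue
      refine ⟨(if e.eval mem ≠ 0 then translate n r m corrupt p else translate n r m corrupt p') :: l',
        M, 8 + (1 + e.cost mem), (hun _ _).trans ?_, by omega, ?_, hM, Or.inl ?_⟩ <;>
        simp only [lazyStep, Sample.idealStep, stepT, Config.point, hdue, if_true, record, step,
          Config.query]
      · refine ⟨1, ?_⟩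
        simp only [Function.iterate_one, step, ATerm.eval_shift h.adv, ATerm.cost_shift h.adv,
          Nat.add_assoc]
      · split_ifs <;> exact Follows.cons _ hF
      · exact h
    | loop e p =>
      have hcost := e.cost_pos mem
      have hd : sp + (1 + e.cost mem) ≤ T := hdue
      refine ⟨(if e.eval mem ≠ 0 then translate n r m corrupt p :: conditionProg n r m e ::
          .loop (var 18) (.seq (translate n r m corrupt p) (conditionProg n r m e)) :: l' else l'),
        M.write 0 18 (e.eval mem), 1 + (8 + (7 + e.cost mem) + (8 + (e.eval mem).size) + if e.eval mem ≠ 0 then 1 else 0),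
        Reach.step ?_, ?_, ?_, ?_, Or.inl ?_⟩
      all_goals (try simp only [lazyStep, Sample.idealStep, stepT, Config.point, hdue, if_true, record,
        step, Config.query])
      · have := h.reach_condition (corrupt := corrupt) (tape := tape) e p l' (n₀ + k) (s + 1)
        rw [Nat.add_assoc] at this
        exact this
      · split_ifs <;> omega
      · split_ifs
        · exact Follows.cons _ (Follows.loop _ _ hF)
        · exact hF
      · exact hM.write fun _ => by omega
      · exact h.write_scratch (by norm_num) (by norm_num) _
    | call c a e₁ e₂ =>
      have hd : sp + (1 + e₁.cost mem + e₂.cost mem) ≤ T := hdue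
      have hcost₁ := e₁.cost_pos mem
      have hcost₂ := e₂.cost_pos mem
      set M₁ := M.write 0 19 (e₁.eval mem) with hM₁
      set M₂ := M₁.write 0 21 (e₂.eval mem) with hM₂
      have hs₁ : Sim ω w q mem L runs.length M₁ := h.write_scratch (by norm_num) (by norm_num) _
      have hs₂ : Sim ω w q mem L runs.length M₂ := hs₁.write_scratch (by norm_num) (by norm_num) _
      have hsm₂ : Small (offset n r m) S M₂ :=
        (hM.write fun _ => by omega).write fun _ => by omega
      have h19 : M₂ 0 19 = e₁.eval mem := by
        rw [hM₂, Memory.write_of_ne _ (by omega), hM₁, Memory.write_self]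
      have h21 : M₂ 0 21 = e₂.eval mem := Memory.write_self _ _ _ _
      obtain ⟨M', k', t, hr, ht, hsm, rfl, ho⟩ := does_replyProg (tape := tape) (corrupt := corrupt)
        (pos := n₀ + k) hS hlim.key
        hlim.hash hlim.pair hTS hs₂ hL hcnt h19 h21 c a rfl hsm₂ l'
        (s + 8 + 1 + (7 + e₁.cost mem) + 1 + (7 + e₂.cost mem))
      have hpoint : Config.point P T
          (⟨.call c a e₁ e₂ :: l, mem, k, runs, sp⟩ : Config (List (Fin n × Fin n))) =
          queryPoint P c (e₁.eval mem) (e₂.eval mem) := by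
        simp only [Config.point, hdue, if_true, Config.query]
        match c with
        | 0 => rfl
        | 1 => rfl
        | 2 => rfl
        | 3 => rfl
        | c + 4 => rfl
      have h19s : Nat.size 19 = 5 := by decide
      have h21s : Nat.size 21 = 5 := by decide
      refine ⟨l', M', 8 + 1 + (7 + e₁.cost mem) + 1 + (7 + e₂.cost mem) + t,
        (hun _ _).trans ?_, ?_, ?_, hsm, ?_⟩
      · have e1 : (step tape noOracle)^[4] ⟨.seq (assign 19 (e₁.shift (offset n r m)))
            (.seq (assign 21 (e₂.shift (offset n r m))) (replyProg n r m corrupt c a)) :: l',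
            M, n₀ + k, (), s + 8⟩ = ⟨replyProg n r m corrupt c a :: l', M₂, n₀ + k, (),
            s + 8 + 1 + (7 + e₁.cost mem) + 1 + (7 + e₂.cost mem)⟩ := by
          simp only [Function.iterate_succ_apply, Function.iterate_zero_apply, step,
            ATerm.eval_shift h.adv, ATerm.cost_shift h.adv, ATerm.eval_shift hs₁.adv,
            ATerm.cost_shift hs₁.adv, ATerm.eval, ATerm.cost, h19s, h21s, ← hM₁, ← hM₂]
        refine Reach.trans ⟨4, e1⟩ ?_
        have htossed : (lazyStep (ω.idealStep corrupt) (Config.point P T) w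
            (⟨.call c a e₁ e₂ :: l, mem, k, runs, sp⟩, L)).1.tossed = k := by
          simp only [lazyStep, Sample.idealStep, stepT, hdue, if_true, step]
        rw [htossed]
        convert hr using 2
        omega
      · simp only [simBound] at hC1
        omega
      · simp only [lazyStep, Sample.idealStep, stepT, hdue, if_true, step]
        exact hF
      · simp only [lazyStep, Sample.idealStep, stepT, hdue, if_true, step, hpoint]
        exact ho

end Step

/-! ### The simulation of all steps -/

section Iterate

variable {P : Params} {n r m T : ℕ} {corrupt : Finset (Fin n)} {ω : Sample P n r m T}
  {w : ℕ → P.Answer} {q : ℕ} {S : ℕ} {tape : ℕ → Bool}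

theorem Sample.length_oracle_le (ω : Sample P n r m T) (transcript : Fin T → Fin n → Fin n → List ℕ)
    (runs : List (Fin n × Fin n)) (k v₁ v₂ : ℕ) :
    (ω.oracle corrupt transcript runs k v₁ v₂).1.length ≤ runs.length + 1 := by
  unfold Sample.oracle
  split
  · simp
  · simp
  · simp
  · split_ifs
    · dsimp only
      split_ifs <;> simp
    · simp
  · simp

theorem Sample.length_state_idealStep_le (ω : Sample P n r m T) (c : Config (List (Fin n × Fin n)))
    (F : P.Point → P.Answer) :
    (ω.idealStep corrupt c F).state.length ≤ c.state.length + 1 := by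
  unfold Sample.idealStep stepT
  split_ifs
  · rcases c with ⟨_ | ⟨p, l⟩, M, k, s, t⟩
    · simp [step]
    · cases p <;> simp only [step] <;> try omega
      exact Sample.length_oracle_le _ _ _ _ _ _
  · omega

/-- The eavesdropper on idealised runs with lazily sampled random oracles, after `s` steps. -/
def Sample.lazyAt (ω : Sample P n r m T) (corrupt : Finset (Fin n)) (w : ℕ → P.Answer) (prog : Prog)
    (mem : Memory) (s : ℕ) : Config (List (Fin n × Fin n)) × List P.Point :=
  (lazyStep (ω.idealStep corrupt) (Config.point P T) w)^[s] (⟨[prog], mem, 0, [], 0⟩, [])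

theorem Sample.lazyAt_succ (ω : Sample P n r m T) (prog : Prog) (mem : Memory) (s : ℕ) :
    ω.lazyAt corrupt w prog mem (s + 1) =
      lazyStep (ω.idealStep corrupt) (Config.point P T) w (ω.lazyAt corrupt w prog mem s) :=
  Function.iterate_succ_apply' _ _ _

theorem Sample.lazyAt_bounds (ω : Sample P n r m T) (prog : Prog) (mem : Memory) (s : ℕ) :
    (ω.lazyAt corrupt w prog mem s).1.state.length ≤ s ∧
    (ω.lazyAt corrupt w prog mem s).2.length ≤ s ∧
    (ω.lazyAt corrupt w prog mem s).1.todo.length ≤ s + 1 ∧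
    (ω.lazyAt corrupt w prog mem s).1.tossed ≤ (ω.lazyAt corrupt w prog mem s).1.spent ∧
    TodoBound n r m corrupt S (simBound n r m corrupt S prog)
      (ω.lazyAt corrupt w prog mem s).1.todo := by
  induction s with
  | zero => exact ⟨le_rfl, le_rfl, le_rfl, le_rfl, by simp [TodoBound, Sample.lazyAt]⟩
  | succ s ih =>
    obtain ⟨h1, h2, h3, h4, h5⟩ := ih
    rw [Sample.lazyAt_succ]
    refine ⟨?_, ?_, ?_, ?_, ?_⟩
    · exact (Sample.length_state_idealStep_le _ _ _).trans (by omega)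
    · exact (length_record_le _ _).trans (by omega)
    · exact length_todo_stepT.trans (by omega)
    · exact tossed_le_spent_stepT _ _ _ _ h4
    · exact h5.stepT

/-- The whole run of the eavesdropper is simulated: if the `q`-th new point at which a random oracle
is evaluated is a residue `z`, then the solver finds `z`. -/
theorem Sim.exists_result (hlim : Limits P T S) {prog : Prog} {tail : List Prog} {mem M : Memory}
    (h : Sim ω w q mem [] 0 M) (hM : Small (offset n r m) S M) {n₀ : ℕ}
    (htape : ∀ d < T, tape (n₀ + d) = extendTape ω.coin d) {z : Fin P.grp.p}
    (hz : (ω.lazyAt corrupt w prog mem T).2[q]? = some (.inl z)) (s₀ : ℕ) :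
    ∃ M' pos t, Reach tape ⟨translate n r m corrupt prog :: tail, M, n₀, (), s₀⟩
        ⟨tail, M', pos, (), s₀ + t⟩ ∧ t ≤ (2 * T + 1) * simBound n r m corrupt S prog ∧
      M' 0 17 = z := by
  set C := simBound n r m corrupt S prog with hCdef
  -- After each step either the simulation is still in progress, or the hit has occurred and the
  -- solver has already run to its end.
  have key : ∀ s ≤ T,
      (∃ l' M' t, Reach tape ⟨translate n r m corrupt prog :: tail, M, n₀, (), s₀⟩
        ⟨l', M', n₀ + (ω.lazyAt corrupt w prog mem s).1.tossed, (), s₀ + t⟩ ∧ t ≤ s * C ∧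
        Follows n r m corrupt tail (ω.lazyAt corrupt w prog mem s).1.todo l' ∧
        Small (offset n r m) S M' ∧
        Sim ω w q (ω.lazyAt corrupt w prog mem s).1.mem (ω.lazyAt corrupt w prog mem s).2
          (ω.lazyAt corrupt w prog mem s).1.state.length M') ∨
      ∃ M' pos t, Reach tape ⟨translate n r m corrupt prog :: tail, M, n₀, (), s₀⟩
        ⟨tail, M', pos, (), s₀ + t⟩ ∧ t ≤ (2 * T + 1) * C ∧
        ∃ z, (ω.lazyAt corrupt w prog mem s).2[q]? = some (.inl z) ∧ M' 0 17 = z := by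
    intro s
    induction s with
    | zero =>
      intro _
      exact Or.inl ⟨_, M, 0, Reach.refl _ _, by simp, Follows.cons _ Follows.nil, hM, h⟩
    | succ s ih =>
      intro hs
      obtain ⟨b1, b2, b3, b4, b5⟩ := ω.lazyAt_bounds (corrupt := corrupt) (w := w) (S := S) prog mem s
      obtain ⟨-, -, b3', -, b5'⟩ :=
        ω.lazyAt_bounds (corrupt := corrupt) (w := w) (S := S) prog mem (s + 1)
      rcases ih (by omega) with ⟨l', M', t, hr, ht, hF, hsm, hsim⟩ | ⟨M', pos, t, hr, ht, z, hz, ho⟩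
      · obtain ⟨l'', M'', t', hr', ht', hF', hsm', ho'⟩ := hsim.exists_reach hlim hF hsm b5
          (by omega) (by omega) htape b4 (ω.lazyAt_succ prog mem s) (s₀ + t)
        have hr2 := hr.trans hr'
        rw [add_assoc] at hr2
        have ht2 : t + t' ≤ (s + 1) * C := by rw [add_mul, one_mul]; omega
        rcases ho' with ho' | ⟨h16, z, hz, h17⟩
        · exact Or.inl ⟨l'', M'', t + t', hr2, ht2, hF', hsm', ho'⟩
        · right
          obtain ⟨M₃, t₃, hr₃, ht₃, h17'⟩ := reach_of_halted (tape := tape) hlim.one_le hF' b5' h16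
            (n₀ + (ω.lazyAt corrupt w prog mem (s + 1)).1.tossed) (s₀ + (t + t'))
          refine ⟨M₃, n₀ + (ω.lazyAt corrupt w prog mem (s + 1)).1.tossed, t + t' + t₃, ?_, ?_, z, hz,
            h17'.trans h17⟩
          · have := hr2.trans hr₃
            rwa [add_assoc s₀] at this
          -- At most `T + 1` commands are left to be skipped at cost at most `C` each; the simulated
          -- steps cost at most `T * C`.
          · have h5 : t₃ ≤ (T + 1) * C :=
              ht₃.trans (Nat.mul_le_mul_right _ (by omega))
            have h6 : (s + 1) * C ≤ T * C := Nat.mul_le_mul_right _ hs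
            have h7 : (2 * T + 1) * C = T * C + (T + 1) * C := by ring
            omega
      · refine Or.inr ⟨M', pos, t, hr, ht, z, ?_, ho⟩
        rw [Sample.lazyAt_succ]
        obtain ⟨K, hK⟩ := prefix_record (ω.lazyAt corrupt w prog mem s).2
          ((ω.lazyAt corrupt w prog mem s).1.point P T)
        simp only [lazyStep]
        rw [← hK, List.getElem?_append_left (List.getElem?_eq_some_iff.1 hz).1, hz]
  rcases key T le_rfl with ⟨l', M', t, -, -, -, -, hsim⟩ | ⟨M', pos, t, hr, ht, z', hz', ho⟩
  -- If the simulation were still going on after `T` steps, `fresh` would say that position `q`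
  -- holds no argument of `h`.
  · exact absurd hz (hsim.fresh z)
  · rw [hz'] at hz
    refine ⟨M', pos, t, hr, ht, ?_⟩
    rw [ho]
    simp only [Option.some.injEq, Sum.inl.injEq] at hz
    rw [hz]

end Iterate

/-! ### The solver -/

section Solver

variable {P : Params} {n r m T : ℕ}

/-- The number of possible values of a kind. -/
def Kind.modulus (P : Params) (N : ℕ) : Kind n r m → ℕ
  | .run => N
  | .ask => N
  | .x => P.grp.p - 1
  | .y => P.grp.p - 1
  | .key => 2 ^ P.keyLen
  | .hash => 2 ^ P.hashLen
  | .idealA _ => 2 ^ P.hashLen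
  | .idealB _ => 2 ^ P.hashLen
  | .secret _ => 2 ^ P.secLen
  | .filler _ _ => 2 ^ P.secLen

theorem Kind.modulus_pos (P : Params) {N : ℕ} (hN : 0 < N) (k : Kind n r m) : 0 < k.modulus P N := by
  cases k <;> simp only [Kind.modulus] <;>
    first | exact hN | exact Nat.sub_pos_of_lt P.grp.prime.one_lt | positivity

instance (P : Params) (T : ℕ) (k : Kind n r m) : NeZero (k.modulus P (T + 1)) :=
  ⟨(k.modulus_pos P T.succ_pos).ne'⟩

/-- The random values of the solver. -/
abbrev Pool (P : Params) (n r m T : ℕ) : Type :=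
  ∀ a : Fin (T + 1) × Kind n r m, Fin (a.2.modulus P (T + 1))

/-- The sample of an eavesdropper that is determined by the random values of the solver. -/
def sampleOf (perm : Fin n → Equiv.Perm (Fin m)) (ρ : Pool P n r m T) (coin : Fin T → Bool)
    (F : P.Point → P.Answer) : Sample P n r m T where
  secret G := ρ (0, .secret G)
  filler l c := ρ (0, .filler l c)
  perm := perm
  x t := ρ (t.castSucc, .x)
  y t := ρ (t.castSucc, .y)
  h v := (F (.inl v)).1
  hA k s := (F (.inr (.inl (k, s)))).2
  hB k s := (F (.inr (.inr (k, s)))).2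
  idealA t c := ρ (t.castSucc, .idealA c)
  idealB t c := ρ (t.castSucc, .idealB c)
  coin := coin

/-- The answers of the random oracles. -/
def poolAnswers (ρ : Pool P n r m T) (t : Fin T) : P.Answer :=
  (ρ (t.castSucc, .key), ρ (t.castSucc, .hash))

/-- Put a challenge into the run number `ρ (0, .run)`. -/
noncomputable def embed (a b : P.grp.Exponent) (ρ : Pool P n r m T) : Pool P n r m T :=
  open Classical in
  fun c => match c with
  | (t, .x) => if t = ρ (0, .run) then a else ρ (t, .x)
  | (t, .y) => if t = ρ (0, .run) then b else ρ (t, .y)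
  | c => ρ c

section Embed

variable (a b : P.grp.Exponent) {ρ : Pool P n r m T} {t : Fin (T + 1)}

theorem embed_x_of_eq (h : t = ρ (0, .run)) : embed a b ρ (t, .x) = a := if_pos h

theorem embed_y_of_eq (h : t = ρ (0, .run)) : embed a b ρ (t, .y) = b := if_pos h

theorem embed_x_of_ne (h : t ≠ ρ (0, .run)) : embed a b ρ (t, .x) = ρ (t, .x) := if_neg h

theorem embed_y_of_ne (h : t ≠ ρ (0, .run)) : embed a b ρ (t, .y) = ρ (t, .y) := if_neg h

end Embed

/-- The number that represents a value in the memory of the solver. -/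
def Kind.output : (k : Kind n r m) → Fin (k.modulus P (T + 1)) → ℕ
  | .x, v => P.grp.g ^ (v : ℕ) % P.grp.p
  | .y, v => P.grp.g ^ (v : ℕ) % P.grp.p
  | _, v => v

/-- The random values that are determined by a tape. -/
noncomputable def tapePool (P : Params) (n r m T W : ℕ) (tape : ℕ → Bool) : Pool P n r m T :=
  fun c => Fin.ofNat _ (rawValue tape W c.1 c.2)

/-- The memory holds powers with unreduced random exponents, whereas the pool has exponents modulo
`p - 1`. Fermat's theorem, in the form `DHGroup.pow_mod`, identifies them. -/
theorem preparedValue_eq (W : ℕ) (tape : ℕ → Bool) (a b : P.grp.Exponent) (t : Fin (T + 1))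
    (k : Kind n r m) :
    preparedValue P (P.grp.g ^ (a : ℕ) % P.grp.p) (P.grp.g ^ (b : ℕ) % P.grp.p) (T + 1) W tape t k =
      k.output (embed a b (tapePool P n r m T W tape) (t, k)) := by
  have hrun : (t : ℕ) = (Kind.run : Kind n r m).value P (T + 1)
      (rawValue tape W 0 (.run : Kind n r m)) ↔ t = tapePool P n r m T W tape (0, .run) :=
    ⟨fun h => Fin.ext h, fun h => congrArg Fin.val h⟩
  cases k
  case x =>
    by_cases h : t = tapePool P n r m T W tape (0, .run)
    · simp only [preparedValue, if_pos (hrun.2 h), Kind.output, embed_x_of_eq a b h]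
    · simp only [preparedValue, if_neg (mt hrun.1 h), Kind.output, embed_x_of_ne a b h]
      exact (P.grp.pow_mod _).symm
  case y =>
    by_cases h : t = tapePool P n r m T W tape (0, .run)
    · simp only [preparedValue, if_pos (hrun.2 h), Kind.output, embed_y_of_eq a b h]
    · simp only [preparedValue, if_neg (mt hrun.1 h), Kind.output, embed_y_of_ne a b h]
      exact (P.grp.pow_mod _).symm
  all_goals rfl

/-- The program of the solver. -/
noncomputable def solverProg (𝒮 : Scheme) (groups : Fin n → Finset (Fin r)) (corrupt : Finset (Fin n))
    (perm : Fin n → Equiv.Perm (Fin m)) (A : PPT) (width : Polynomial ℕ) : Prog :=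
  .seq (preludeProg groups corrupt perm 𝒮.keyLen 𝒮.secLen 𝒮.hashLen (A.clock + 1) width)
    (.seq (translate n r m corrupt A.prog) (assign 0 (var 17)))

theorem output_cellKind (groups : Fin n → Finset (Fin r)) (perm : Fin n → Equiv.Perm (Fin m))
    (ρ : Pool P n r m T) (coin : Fin T → Bool) (F : P.Point → P.Answer) (l : Fin n) (c : Fin m) :
    (cellKind groups perm l c).output (ρ (0, cellKind groups perm l c)) =
      ((sampleOf perm ρ coin F).array groups l c : ℕ) := by
  -- The type of a pool value depends on its kind, so the case distinction is first made for an
  -- arbitrary option.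
  have key : ∀ o : Option (Fin r),
      (match o with
        | some G => .secret G
        | none => .filler l (perm l c) : Kind n r m).output (ρ (0, match o with
          | some G => .secret G
          | none => .filler l (perm l c))) =
      ((match o with
        | some G => (sampleOf perm ρ coin F).secret G
        | none => (sampleOf perm ρ coin F).filler l (perm l c) : P.Secret) : ℕ) := by
    rintro (_ | G) <;> rfl
  exact key _

/-- The oracles `F` are arbitrary here: no point is known yet, and neither the initial knowledge nor
idealised transcripts depend on them. -/
theorem Prepared.sim {groups : Fin n → Finset (Fin r)} {corrupt : Finset (Fin n)}
    {perm : Fin n → Equiv.Perm (Fin m)} {σ W : ℕ} {a b : P.grp.Exponent} {tape : ℕ → Bool}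
    {M : Memory} (h : Prepared groups corrupt perm P σ (P.grp.g ^ (a : ℕ) % P.grp.p)
      (P.grp.g ^ (b : ℕ) % P.grp.p) (T + 1) W tape M) {ρ : Pool P n r m T}
    (hρ : ρ = embed a b (tapePool P n r m T W tape)) (coin : Fin T → Bool)
    (F : P.Point → P.Answer) :
    Sim (sampleOf perm ρ coin F) (extendPool (poolAnswers ρ)) (ρ (0, .ask))
      ((sampleOf perm ρ coin F).knowledge σ groups corrupt) [] 0 M := by
  have hv : ∀ (t : Fin (T + 1)) (k : Kind n r m), preparedValue P (P.grp.g ^ (a : ℕ) % P.grp.p)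
      (P.grp.g ^ (b : ℕ) % P.grp.p) (T + 1) W tape t k = k.output (ρ (t, k)) := by
    intro t k
    rw [hρ, preparedValue_eq]
  have hv0 : ∀ (k : Kind n r m), preparedValue P (P.grp.g ^ (a : ℕ) % P.grp.p)
      (P.grp.g ^ (b : ℕ) % P.grp.p) (T + 1) W tape 0 k = k.output (ρ (0, k)) := hv 0
  have hval : ∀ (t : Fin T) (k : Kind n r m), M k.arr t = k.output (ρ (t.castSucc, k)) := by
    intro t k
    rw [h.value k t (by omega)]
    exact hv t.castSucc k
  refine ⟨?_, h.p, h.key, h.sec, h.zero 14 (by norm_num) (by norm_num),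
    h.zero 15 (by norm_num) (by norm_num), h.zero 16 (by norm_num) (by norm_num), ?_, ?_, ?_, ?_, ?_,
    ?_⟩
  · intro c i
    rcases c with _ | _ | l
    · exact h.adv0 i
    · refine (h.adv1 i).trans ?_
      simp only [Sample.knowledge]
      split_ifs
      · rw [hv0]
        rfl
      · rfl
    · refine (h.adv2 l i).trans ?_
      simp only [Sample.knowledge]
      split_ifs
      · rw [hv0]
        exact output_cellKind _ _ _ _ _ _ _
      · rfl
      · rfl
  · rw [h.ask, hv0]
    rfl
  · intro d hd
    simp at hd
  · intro d _
    exact h.memo _ (pointArr_pos d) (by have := pointArr_lt d; omega) _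
  · intro d t ht
    have h1 := hval ⟨t, ht⟩
    simp only [extendPool, dif_pos ht]
    rcases d with v | v
    · exact h1 .key
    · exact h1 .hash
  · intro t k hk
    rw [hval]
    simp only [transcriptKinds, List.mem_append, List.mem_cons, List.not_mem_nil, or_false,
      List.mem_ofFn] at hk
    rcases hk with ((rfl | rfl) | ⟨c, rfl⟩) | ⟨c, rfl⟩ <;> rfl
  · simp

/-- If the eavesdropper evaluates the random oracle at `z` at the guessed time, then the solver
outputs `z`. -/
theorem solver_finds (𝒮 : Scheme) (groups : Fin n → Finset (Fin r)) (corrupt : Finset (Fin n))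
    (perm : Fin n → Equiv.Perm (Fin m)) (A : PPT) (width : Polynomial ℕ) {σ S clk : ℕ}
    (hlim : Limits (𝒮.params σ) (A.time σ + 1) S) (hsec : 𝒮.secLen.eval σ < S)
    (hW : width.eval σ ≤ S) (hσ : σ ≤ S) (hp : (𝒮.grp σ).p.size ≤ S)
    (hclk : (preludeProg groups corrupt perm 𝒮.keyLen 𝒮.secLen 𝒮.hashLen (A.clock + 1) width).bound S
      + (2 * A.time σ + 1) * simBound n r m corrupt S A.prog + S + 20 ≤ clk)
    (tape : Fin clk → Bool) (a b : (𝒮.grp σ).Exponent) {ρ : Pool (𝒮.params σ) n r m (A.time σ)}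
    (hρ : ρ = embed (P := 𝒮.params σ) a b (tapePool (𝒮.params σ) n r m (A.time σ) (width.eval σ)
      (extendTape tape)))
    {coin : Fin (A.time σ) → Bool}
    (hcoin : ∀ d, coin d = extendTape tape
      ((A.time σ + 1) * Fintype.card (Kind n r m) * width.eval σ + d))
    (F : (𝒮.params σ).Point → (𝒮.params σ).Answer) {z : Fin (𝒮.params σ).grp.p}
    (hz : ((sampleOf perm ρ coin F).lazyAt corrupt (extendPool (poolAnswers ρ)) A.prog
      ((sampleOf perm ρ coin F).knowledge σ groups corrupt) (A.time σ)).2[(ρ (0, .ask) : ℕ)]? =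
        some (.inl z)) :
    ∃ res, runProg clk (solverProg 𝒮 groups corrupt perm A width) tape noOracle ()
      (dhInput σ (𝒮.grp σ) a b) = some res ∧ res.1 0 0 = z := by
  have hlim' : Limits (𝒮.params σ) (A.time σ) S :=
    ⟨hlim.one_le, hlim.key, hlim.hash, hlim.pair, by have := hlim.time; omega⟩
  have hnum : (A.clock + 1).eval σ = A.time σ + 1 := by simp [PPT.time]
  have h0 : 0 < offset n r m := offset_pos
  have hsize : ∀ v, v ≤ S → v.size ≤ S := fun v hv =>
    (Nat.size_le.2 Nat.lt_two_pow_self).trans hv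
  have hsmall : Small (offset n r m) S (dhInput σ (𝒮.grp σ) a b) := by
    intro c _ i
    unfold dhInput
    have hlt : ∀ v, v < (𝒮.grp σ).p → v.size ≤ S := fun v hv => (Nat.size_le_size hv.le).trans hp
    have hpos := (𝒮.grp σ).prime.pos
    split_ifs
    · match i with
      | 0 => exact hsize _ hσ
      | 1 => exact hp
      | 2 => exact hlt _ (𝒮.grp σ).g_lt
      | 3 => exact hlt _ (Nat.mod_lt _ hpos)
      | 4 => exact hlt _ (Nat.mod_lt _ hpos)
      | i + 5 => simp
    · simp
  obtain ⟨M₁, pos₁, t₁, hr₁, ht₁, hs₁, rfl, hprep⟩ := does_preludeProg (n := n) (r := r) (m := m)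
    (groups := groups) (corrupt := corrupt) (perm := perm)
    (tape := extendTape tape) (D := 𝒮.grp σ) (a := a) (b := b) (keyLen := 𝒮.keyLen)
    (secLen := 𝒮.secLen) (hashLen := 𝒮.hashLen) (num := A.clock + 1) (width := width) hlim.one_le
    hlim.key hsec hlim.hash (by rw [hnum]; exact hlim.time) hW (by rw [hnum]; omega) hsmall
    [.seq (translate n r m corrupt A.prog) (assign 0 (var 17))] 1
  rw [hnum] at hprep hr₁
  have hsim := Prepared.sim (P := 𝒮.params σ) hprep hρ coin F
  obtain ⟨M₂, pos₂, t₂, hr₂, ht₂, h17⟩ := hsim.exists_result (tail := [assign 0 (var 17)])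
    hlim' hs₁ (tape := extendTape tape)
    (n₀ := (A.time σ + 1) * Fintype.card (Kind n r m) * width.eval σ) (fun d hd => by
      simp only [sampleOf, extendTape, dif_pos hd]
      exact (hcoin ⟨d, hd⟩).symm) hz (1 + t₁ + 1)
  have hstart : Reach (extendTape tape)
      ⟨[solverProg 𝒮 groups corrupt perm A width], dhInput σ (𝒮.grp σ) a b, 0, (), 0⟩
      ⟨[assign 0 (var 17)], M₂, pos₂, (), 1 + t₁ + 1 + t₂⟩ := by
    refine Reach.step (hr₁.trans (Reach.step hr₂))
  have hsz : (M₂ 0 17).size ≤ S := by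
    rw [h17]
    exact (Nat.size_le_size z.2.le).trans hp
  have h17s : Nat.size 17 = 5 := by decide
  obtain ⟨N, hN⟩ := hstart.trans (c'' := ⟨[], M₂.write 0 0 (M₂ 0 17), pos₂, (),
    1 + t₁ + 1 + t₂ + (1 + 1 + (6 + (1 + (M₂ 0 17).size)))⟩) ⟨1, by
      simp [step, ATerm.eval, ATerm.cost, h17s]⟩
  refine ⟨_, runProg_of_iterate hN (by omega), ?_⟩
  simp only [Memory.write_self]
  exact h17

end Solver

/-! ### Fair coins and uniform values -/

noncomputable instance (n r m : ℕ) : DecidableEq (Kind n r m) := Classical.decEq _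

/-- The values at the points of an injection. -/
noncomputable def Lens.ofInjective {I J V : Type} (e : J → I) (he : Function.Injective e) :
    Lens (I → V) (J → V) where
  get f j := f (e j)
  set f g := Function.extend e g f
  get_set f g := funext fun j => he.extend_apply g f j
  set_get f := by
    funext i
    by_cases h : ∃ j, e j = i
    · obtain ⟨j, rfl⟩ := h
      rw [he.extend_apply]
    · rw [Function.extend_apply' _ _ _ h]
  set_set f g g' := by
    funext i
    by_cases h : ∃ j, e j = i
    · obtain ⟨j, rfl⟩ := h
      rw [he.extend_apply, he.extend_apply]
    · rw [Function.extend_apply' _ _ _ h, Function.extend_apply' _ _ _ h,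
        Function.extend_apply' _ _ _ h]

/-- Binary digits. -/
noncomputable def bitsEquiv (W : ℕ) : (Fin W → Bool) ≃ Fin (2 ^ W) :=
  (Equiv.arrowCongr (Equiv.refl _) finTwoEquiv.symm).trans finFunctionFinEquiv

theorem bitsEquiv_apply {W : ℕ} (tape : ℕ → Bool) (pos : ℕ) :
    (bitsEquiv W (fun i => tape (pos + i)) : ℕ) = coinNumber tape pos W := by
  unfold bitsEquiv coinNumber
  rw [Equiv.trans_apply, finFunctionFinEquiv_apply_val, Finset.sum_range]
  refine Finset.sum_congr rfl fun i _ => ?_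
  simp only [Equiv.arrowCongr_apply, Equiv.refl_symm, Equiv.coe_refl, Function.comp_apply, id_eq]
  cases tape (pos + i) <;> simp [finTwoEquiv]

/-! ### Independent values from disjoint blocks of coins -/

section Tape

variable {n r m : ℕ} (N W T clk : ℕ)

/-- The coins of the eavesdropper, and the coins from which the random values are computed. -/
noncomputable def coinIndex (hclk : N * Fintype.card (Kind n r m) * W + T ≤ clk) :
    Fin T ⊕ ((Fin N × Kind n r m) × Fin W) → Fin clk
  | .inl d => ⟨N * Fintype.card (Kind n r m) * W + d, by omega⟩
  | .inr c => ⟨(c.1.1 * Fintype.card (Kind n r m) + c.1.2.code) * W + c.2, by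
      have h1 := c.1.1.2
      have h2 := c.1.2.code_lt
      have h3 := c.2.2
      have h4 : (c.1.1 * Fintype.card (Kind n r m) + c.1.2.code) + 1 ≤
          N * Fintype.card (Kind n r m) := by
        calc _ ≤ c.1.1 * Fintype.card (Kind n r m) + Fintype.card (Kind n r m) := by omega
          _ = (c.1.1 + 1) * Fintype.card (Kind n r m) := by ring
          _ ≤ _ := Nat.mul_le_mul_right _ h1
      have h5 := Nat.mul_le_mul_right W h4
      rw [add_mul, one_mul] at h5
      omega⟩

/-- The positions are numbers in mixed radix, all below the block reserved for the coins of the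
eavesdropper. -/
theorem coinIndex_injective (hclk : N * Fintype.card (Kind n r m) * W + T ≤ clk) :
    Function.Injective (coinIndex (n := n) (r := r) (m := m) N W T clk hclk) := by
  have hlt : ∀ c : (Fin N × Kind n r m) × Fin W,
      (c.1.1 * Fintype.card (Kind n r m) + c.1.2.code) * W + c.2 <
        N * Fintype.card (Kind n r m) * W := by
    intro c
    have h1 := c.1.1.2
    have h2 := c.1.2.code_lt
    have h3 := c.2.2
    have h4 : (c.1.1 * Fintype.card (Kind n r m) + c.1.2.code) + 1 ≤
        N * Fintype.card (Kind n r m) := by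
      calc _ ≤ c.1.1 * Fintype.card (Kind n r m) + Fintype.card (Kind n r m) := by omega
        _ = (c.1.1 + 1) * Fintype.card (Kind n r m) := by ring
        _ ≤ _ := Nat.mul_le_mul_right _ h1
    have h5 := Nat.mul_le_mul_right W h4
    rw [add_mul, one_mul] at h5
    omega
  rintro (d | c) (d' | c') h <;> simp only [coinIndex, Fin.mk.injEq] at h
  · rw [Fin.ext (show (d : ℕ) = d' by omega)]
  · have := hlt c'
    omega
  · have := hlt c
    omega
  · obtain ⟨h1, h2⟩ := pair_index_inj c.2.2 c'.2.2 h
    obtain ⟨h3, h4⟩ := pair_index_inj c.1.2.code_lt c'.1.2.code_lt h1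
    rw [Prod.ext (Prod.ext (Fin.ext h3) (Kind.code_injective h4)) (Fin.ext h2)]

/-- The coins of the eavesdropper and the raw random values are independent and uniform. -/
theorem prob_tape (hclk : N * Fintype.card (Kind n r m) * W + T ≤ clk)
    (E : (Fin T → Bool) × (Fin N × Kind n r m → Fin (2 ^ W)) → Prop) :
    prob (Fin clk → Bool) (fun tape => E
      (fun d => extendTape tape (N * Fintype.card (Kind n r m) * W + d),
        fun c => ⟨rawValue (extendTape tape) W c.1 c.2, coinNumber_lt _ _ _⟩)) =
      prob ((Fin T → Bool) × (Fin N × Kind n r m → Fin (2 ^ W))) E := by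
  let e : (Fin T ⊕ ((Fin N × Kind n r m) × Fin W) → Bool) ≃
      (Fin T → Bool) × (Fin N × Kind n r m → Fin (2 ^ W)) :=
    (Equiv.sumArrowEquivProdArrow _ _ _).trans (Equiv.prodCongr (Equiv.refl _)
      ((Equiv.curry _ _ _).trans (Equiv.piCongrRight fun _ => bitsEquiv W)))
  rw [← prob_equiv e]
  -- Restricting a uniform tape to distinct positions gives a uniform family of coins.
  have hl := (Lens.ofInjective (V := Bool) _
    (coinIndex_injective (n := n) (r := r) (m := m) N W T clk hclk)).prob_get fun f => E (e f)
  rw [← hl]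
  refine congrArg _ (funext fun tape => congrArg E ?_)
  refine Prod.ext (funext fun d => ?_) (funext fun c => Fin.ext ?_)
  · simp only [extendTape]
    rw [dif_pos (by omega)]
    rfl
  · change rawValue (extendTape tape) W c.1 c.2 = _
    unfold rawValue
    rw [← bitsEquiv_apply]
    refine congrArg (fun f => ((bitsEquiv W f : Fin (2 ^ W)) : ℕ)) (funext fun i => ?_)
    have := (coinIndex (n := n) (r := r) (m := m) N W T clk hclk (.inr (c, i))).2
    exact dif_pos this

end Tape

/-! ### Nearly uniform values by reduction of long numbers -/

section Uniform

variable {P : Params} {n r m T : ℕ}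

/-- A single crude bound for all moduli, so that one width of random numbers serves every kind. -/
theorem Kind.modulus_le {N b : ℕ} (hb : P.grp.p.size ≤ b) (k : Kind n r m) :
    k.modulus P N ≤ 2 ^ (P.keyLen + P.secLen + P.hashLen + b + N) := by
  have hp : P.grp.p - 1 ≤ 2 ^ b := (Nat.sub_le _ _).trans
    ((Nat.lt_size_self _).le.trans (Nat.pow_le_pow_right (by norm_num) hb))
  cases k <;> simp only [Kind.modulus]
  case run => exact Nat.lt_two_pow_self.le.trans (Nat.pow_le_pow_right (by norm_num) (by omega))
  case ask => exact Nat.lt_two_pow_self.le.trans (Nat.pow_le_pow_right (by norm_num) (by omega))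
  case x => exact hp.trans (Nat.pow_le_pow_right (by norm_num) (by omega))
  case y => exact hp.trans (Nat.pow_le_pow_right (by norm_num) (by omega))
  all_goals exact Nat.pow_le_pow_right (by norm_num) (by omega)

/-- Reduction of sufficiently long random numbers gives almost uniform values. -/
theorem half_prob_pool_le {b W : ℕ} (hb : P.grp.p.size ≤ b)
    (hW : P.keyLen + P.secLen + P.hashLen + b + (T + 1) + (T + 1) * Fintype.card (Kind n r m) + 1 ≤ W)
    (E : Pool P n r m T → Prop) :
    1 / 2 * prob (Pool P n r m T) E ≤ prob (Fin (T + 1) × Kind n r m → Fin (2 ^ W)) fun f =>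
      E fun c => Fin.ofNat (c.2.modulus P (T + 1)) (f c) := by
  classical
  set B := P.keyLen + P.secLen + P.hashLen + b + (T + 1) with hB
  have hBW : (2 : ℝ) ^ B ≤ 2 ^ W := pow_le_pow_right₀ (by norm_num) (by omega)
  refine half_prob_le_prob_pi (fun (c : Fin (T + 1) × Kind n r m) (v : Fin (2 ^ W)) =>
    Fin.ofNat (c.2.modulus P (T + 1)) (v : ℕ)) (2 ^ B / 2 ^ W) ?_ ?_ ?_ E
  -- The width exceeds the common bound `B` by at least the number of values plus one, so the total
  -- error is at most `1 / 2`.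
  · have h1 : ((Fintype.card (Fin (T + 1) × Kind n r m) : ℕ) : ℝ) ≤
        2 ^ ((T + 1) * Fintype.card (Kind n r m)) := by
      rw [Fintype.card_prod, Fintype.card_fin]
      exact_mod_cast Nat.lt_two_pow_self.le
    have h2 : (2 : ℝ) ^ ((T + 1) * Fintype.card (Kind n r m)) * 2 ^ B * 2 ≤ 2 ^ W := by
      rw [← pow_add, ← pow_succ]
      exact pow_le_pow_right₀ (by norm_num) (by omega)
    rw [← mul_div_assoc, div_le_iff₀ (by positivity)]
    have h3 : (0 : ℝ) < 2 ^ B := by positivity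
    nlinarith
  · rw [div_le_one (by positivity)]
    exact hBW
  · rintro c v
    refine le_trans ?_ (prob_mod_ge W (c.2.modulus P (T + 1)) v)
    rw [Fintype.card_fin]
    have h4 : ((c.2.modulus P (T + 1) : ℕ) : ℝ) ≤ 2 ^ B := by
      exact_mod_cast c.2.modulus_le hb
    gcongr

end Uniform

/-! ### The success probability of the solver -/

section Lenses

variable {P : Params} {n r m T : ℕ}

theorem Sample.ext_fields {ω ω' : Sample P n r m T} (h1 : ω.secret = ω'.secret)
    (h2 : ω.filler = ω'.filler) (h3 : ω.perm = ω'.perm) (h4 : ω.x = ω'.x) (h5 : ω.y = ω'.y)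
    (h6 : ω.h = ω'.h) (h7 : ω.hA = ω'.hA) (h8 : ω.hB = ω'.hB) (h9 : ω.idealA = ω'.idealA)
    (h10 : ω.idealB = ω'.idealB) (h11 : ω.coin = ω'.coin) : ω = ω' := by
  cases ω
  cases ω'
  simp_all

/-- The exponents of the guessed run. -/
noncomputable def challengeLens :
    Lens (Pool P n r m T) (P.grp.Exponent × P.grp.Exponent) where
  get ρ := (ρ (ρ (0, .run), .x), ρ (ρ (0, .run), .y))
  set ρ v := embed v.1 v.2 ρ
  get_set ρ v := Prod.ext (embed_x_of_eq v.1 v.2 rfl) (embed_y_of_eq v.1 v.2 rfl)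
  set_get ρ := by
    funext ⟨t, k⟩
    by_cases h : t = ρ (0, .run)
    · subst h
      cases k
      case x => exact embed_x_of_eq _ _ rfl
      case y => exact embed_y_of_eq _ _ rfl
      all_goals rfl
    · cases k
      case x => exact embed_x_of_ne _ _ h
      case y => exact embed_y_of_ne _ _ h
      all_goals rfl
  set_set ρ v w := by
    funext ⟨t, k⟩
    have h0 : embed v.1 v.2 ρ (0, .run) = ρ (0, .run) := rfl
    by_cases h : t = ρ (0, .run)
    · cases k
      case x => rw [embed_x_of_eq _ _ h, embed_x_of_eq _ _ (h.trans h0.symm)]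
      case y => rw [embed_y_of_eq _ _ h, embed_y_of_eq _ _ (h.trans h0.symm)]
      all_goals rfl
    · cases k
      case x => rw [embed_x_of_ne _ _ h, embed_x_of_ne _ _ (h0 ▸ h), embed_x_of_ne _ _ h]
      case y => rw [embed_y_of_ne _ _ h, embed_y_of_ne _ _ (h0 ▸ h), embed_y_of_ne _ _ h]
      all_goals rfl

/-- The guesses. -/
def guessLens : Lens (Pool P n r m T) (Fin (T + 1) × Fin (T + 1)) where
  get ρ := (ρ (0, .run), ρ (0, .ask))
  set ρ v := fun c => match c with
    | (t, .run) => if t = 0 then v.1 else ρ (t, .run)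
    | (t, .ask) => if t = 0 then v.2 else ρ (t, .ask)
    | c => ρ c
  get_set ρ v := rfl
  set_get ρ := by
    funext ⟨t, k⟩
    by_cases h : t = 0
    · subst h
      cases k <;> rfl
    · cases k
      case run => exact if_neg h
      case ask => exact if_neg h
      all_goals rfl
  set_set ρ v w := by
    funext ⟨t, k⟩
    by_cases h : t = 0
    · subst h
      cases k <;> rfl
    · cases k
      case run => exact (if_neg h).trans ((if_neg h).trans (if_neg h).symm)
      case ask => exact (if_neg h).trans ((if_neg h).trans (if_neg h).symm)
      all_goals rfl

/-- The answers of the random oracles. -/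
def answerLens : Lens (Pool P n r m T) (Fin T → P.Answer) where
  get ρ := poolAnswers ρ
  set ρ v := fun c => match c with
    | (t, .key) => if h : (t : ℕ) < T then (v ⟨t, h⟩).1 else ρ (t, .key)
    | (t, .hash) => if h : (t : ℕ) < T then (v ⟨t, h⟩).2 else ρ (t, .hash)
    | c => ρ c
  get_set ρ v := by
    funext t
    exact Prod.ext (dif_pos t.2) (dif_pos t.2)
  set_get ρ := by
    funext ⟨t, k⟩
    by_cases h : (t : ℕ) < T
    · cases k
      case key => exact dif_pos h
      case hash => exact dif_pos h
      all_goals rfl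
    · cases k
      case key => exact dif_neg h
      case hash => exact dif_neg h
      all_goals rfl
  set_set ρ v w := by
    funext ⟨t, k⟩
    by_cases h : (t : ℕ) < T
    · cases k
      case key => exact (dif_pos h).trans (Eq.symm (by exact dif_pos h))
      case hash => exact (dif_pos h).trans (Eq.symm (by exact dif_pos h))
      all_goals rfl
    · cases k
      case key => exact (dif_neg h).trans ((dif_neg h).trans (Eq.symm (by exact dif_neg h)))
      case hash => exact (dif_neg h).trans ((dif_neg h).trans (Eq.symm (by exact dif_neg h)))
      all_goals rfl

/-- Samples as functions of permutations, coins, the random values of the solver, and random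
oracles. -/
def sampleLens : Lens ((Fin n → Equiv.Perm (Fin m)) × (Fin T → Bool) × Pool P n r m T ×
    (P.Point → P.Answer)) (Sample P n r m T) where
  get a := sampleOf a.1 a.2.2.1 a.2.1 a.2.2.2
  set a ω := (ω.perm, ω.coin, fun c => match c with
    | (t, .secret G) => if t = 0 then ω.secret G else a.2.2.1 (t, .secret G)
    | (t, .filler l c) => if t = 0 then ω.filler l c else a.2.2.1 (t, .filler l c)
    | (t, .x) => if h : (t : ℕ) < T then ω.x ⟨t, h⟩ else a.2.2.1 (t, .x)
    | (t, .y) => if h : (t : ℕ) < T then ω.y ⟨t, h⟩ else a.2.2.1 (t, .y)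
    | (t, .idealA c) => if h : (t : ℕ) < T then ω.idealA ⟨t, h⟩ c else a.2.2.1 (t, .idealA c)
    | (t, .idealB c) => if h : (t : ℕ) < T then ω.idealB ⟨t, h⟩ c else a.2.2.1 (t, .idealB c)
    | c => a.2.2.1 c,
    fun d => match d with
    | .inl v => (ω.h v, (a.2.2.2 (.inl v)).2)
    | .inr (.inl b) => ((a.2.2.2 (.inr (.inl b))).1, ω.hA b.1 b.2)
    | .inr (.inr b) => ((a.2.2.2 (.inr (.inr b))).1, ω.hB b.1 b.2))
  get_set a ω := by
    refine Sample.ext_fields rfl rfl rfl ?_ ?_ rfl rfl rfl ?_ ?_ rfl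
    · funext t
      exact dif_pos t.2
    · funext t
      exact dif_pos t.2
    · funext t c
      exact dif_pos t.2
    · funext t c
      exact dif_pos t.2
  set_get a := by
    obtain ⟨π, coin, ρ, F⟩ := a
    refine Prod.ext rfl (Prod.ext rfl (Prod.ext ?_ ?_))
    · funext ⟨t, k⟩
      have h0 : t = 0 ∨ t ≠ 0 := em _
      have hT : (t : ℕ) < T ∨ ¬ (t : ℕ) < T := em _
      cases k
      case secret G =>
        rcases h0 with rfl | h0
        · rfl
        · exact if_neg h0
      case filler l c =>
        rcases h0 with rfl | h0
        · rfl
        · exact if_neg h0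
      case run => rfl
      case ask => rfl
      case key => rfl
      case hash => rfl
      all_goals
        rcases hT with hT | hT
        · exact dif_pos hT
        · exact dif_neg hT
    · funext d
      rcases d with v | b | b <;> rfl
  set_set a ω ω' := by
    obtain ⟨π, coin, ρ, F⟩ := a
    refine Prod.ext rfl (Prod.ext rfl (Prod.ext ?_ ?_))
    · funext ⟨t, k⟩
      have h0 : t = 0 ∨ t ≠ 0 := em _
      have hT : (t : ℕ) < T ∨ ¬ (t : ℕ) < T := em _
      cases k
      case secret G =>
        rcases h0 with rfl | h0
        · rfl
        · exact (if_neg h0).trans ((if_neg h0).trans (if_neg h0).symm)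
      case filler l c =>
        rcases h0 with rfl | h0
        · rfl
        · exact (if_neg h0).trans ((if_neg h0).trans (if_neg h0).symm)
      case run => rfl
      case ask => rfl
      case key => rfl
      case hash => rfl
      all_goals
        rcases hT with hT | hT
        · exact (dif_pos hT).trans (Eq.symm (by exact dif_pos hT))
        · exact (dif_neg hT).trans ((dif_neg hT).trans (Eq.symm (by exact dif_neg hT)))
    · funext d
      rcases d with v | b | b <;> rfl

end Lenses

/-! ### From the eavesdropper's queries to the guesses of the solver -/

section Coupling

variable {P : Params} {n r m T : ℕ} (groups : Fin n → Finset (Fin r)) (corrupt : Finset (Fin n))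
  (prog : Prog) (σ : ℕ)

/-- The points at which the random oracles are evaluated if they are sampled lazily. -/
def lazyAsked (perm : Fin n → Equiv.Perm (Fin m)) (coin : Fin T → Bool) (ρ : Pool P n r m T)
    (w : Fin T → P.Answer) : List P.Point :=
  ((sampleOf perm ρ coin default).lazyAt corrupt (extendPool w) prog
    ((sampleOf perm ρ coin default).knowledge σ groups corrupt) T).2

/-- The Diffie-Hellman secret of a run, computed from the random values of the solver. -/
def poolDH (ρ : Pool P n r m T) (t : Fin (T + 1)) : Fin P.grp.p :=
  Fin.ofNat _ (P.grp.g ^ ((ρ (t, .x) : ℕ) * ρ (t, .y)))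

/-- Everything except the random oracles is fixed. The Diffie-Hellman secrets do not involve the
oracles, so the event only concerns the list of points, and lazy sampling applies. -/
theorem prob_asked_le_prob_lazyAsked (perm : Fin n → Equiv.Perm (Fin m)) (coin : Fin T → Bool)
    (ρ : Pool P n r m T) :
    prob (P.Point → P.Answer) (fun F =>
        Sample.AskedDH groups corrupt prog σ (sampleOf perm ρ coin F)) ≤
      prob (Fin T → P.Answer) (fun w => ∃ t : Fin T,
        .inl (poolDH ρ t.castSucc) ∈ lazyAsked groups corrupt prog σ perm coin ρ w) := by
  set ω₀ := sampleOf perm ρ coin (default : P.Point → P.Answer) with hω₀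
  have key := prob_rec_le_prob_lazy (R := P.Answer) (q := Config.point P T)
    (nxt := ω₀.idealStep corrupt) (ω₀.idealStep_congr corrupt)
    (⟨[prog], ω₀.knowledge σ groups corrupt, 0, [], 0⟩ : Config (List (Fin n × Fin n))) T
    (fun c => ∃ t : Fin T, .inl (poolDH ρ t.castSucc) ∈ c.2)
  refine le_trans (prob_mono fun F hF => ?_) key
  exact hF

/-- The event that the guesses are correct. -/
def GuessedAsk (perm : Fin n → Equiv.Perm (Fin m)) (coin : Fin T → Bool) (ρ : Pool P n r m T) : Prop :=
  (lazyAsked groups corrupt prog σ perm coin ρ (poolAnswers ρ))[(ρ (0, .ask) : ℕ)]? =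
    some (.inl (poolDH ρ (ρ (0, .run))))

/-- The fresh answers may be replaced by those of the pool, which `lazyAsked` does not use
otherwise. The guess of a run and of a position is right for at least one of `(T + 1) ^ 2` pairs. -/
theorem prob_lazyAsked_le (perm : Fin n → Equiv.Perm (Fin m)) (coin : Fin T → Bool) :
    prob (Pool P n r m T × (Fin T → P.Answer)) (fun a => ∃ t : Fin T,
        .inl (poolDH a.1 t.castSucc) ∈ lazyAsked groups corrupt prog σ perm coin a.1 a.2) ≤
      (T + 1) ^ 2 * prob (Pool P n r m T) (GuessedAsk groups corrupt prog σ perm coin) := by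
  have h1 := (answerLens (P := P) (n := n) (r := r) (m := m) (T := T)).prob_eq (fun ρ =>
    ∃ t : Fin T, .inl (poolDH ρ t.castSucc) ∈
      lazyAsked groups corrupt prog σ perm coin ρ (poolAnswers ρ))
  have h2 : ∀ a : Pool P n r m T × (Fin T → P.Answer),
      poolAnswers (answerLens.set a.1 a.2) = a.2 := fun a => answerLens.get_set a.1 a.2
  have h3 : prob (Pool P n r m T × (Fin T → P.Answer)) (fun a => ∃ t : Fin T,
        .inl (poolDH a.1 t.castSucc) ∈ lazyAsked groups corrupt prog σ perm coin a.1 a.2) =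
      prob (Pool P n r m T) (fun ρ => ∃ t : Fin T, .inl (poolDH ρ t.castSucc) ∈
        lazyAsked groups corrupt prog σ perm coin ρ (poolAnswers ρ)) := by
    rw [h1]
    simp only [h2]
    rfl
  rw [h3]
  have h4 := (guessLens (P := P) (n := n) (r := r) (m := m) (T := T)).prob_exists_le
    (GuessedAsk groups corrupt prog σ perm coin)
  rw [Fintype.card_prod, Fintype.card_fin] at h4
  push_cast at h4
  rw [← pow_two] at h4
  refine le_trans (prob_mono ?_) h4
  rintro ρ ⟨t, ht⟩
  obtain ⟨i, hi, hz⟩ := List.getElem_of_mem ht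
  have hlen : (lazyAsked groups corrupt prog σ perm coin ρ (poolAnswers ρ)).length ≤ T :=
    ((sampleOf perm ρ coin default).lazyAt_bounds (S := 0) prog
      ((sampleOf perm ρ coin default).knowledge σ groups corrupt) T).2.1
  -- The right guesses are the run `t` and the position `i` of its secret. Neither the sample nor
  -- the answers read the guesses, so setting them leaves the list unchanged.
  refine ⟨(t.castSucc, ⟨i, by omega⟩), ?_⟩
  change (lazyAsked groups corrupt prog σ perm coin ρ (poolAnswers ρ))[i]? =
    some (.inl (poolDH ρ t.castSucc))
  rw [List.getElem?_eq_getElem hi, hz]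

end Coupling

theorem prob_prod_le_mul {Ω V V' : Type} [Fintype Ω] [Fintype V] [Fintype V']
    {E : Ω × V → Prop} {E' : Ω × V' → Prop} {c : ℝ}
    (h : ∀ ω, prob V (fun v => E (ω, v)) ≤ c * prob V' (fun v => E' (ω, v))) :
    prob (Ω × V) E ≤ c * prob (Ω × V') E' := by
  classical
  rw [prob_prod, prob_prod, ← mul_div_assoc, Finset.mul_sum]
  gcongr with ω
  exact h ω

theorem poolDH_embed {P : Params} {n r m T : ℕ} (a b : P.grp.Exponent) (ρ : Pool P n r m T) :
    poolDH (embed a b ρ) (embed a b ρ (0, .run)) =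
      Fin.ofNat _ (P.grp.g ^ ((a : ℕ) * (b : ℕ))) := by
  have h : embed a b ρ (0, .run) = ρ (0, .run) := rfl
  unfold poolDH
  rw [embed_x_of_eq a b h, embed_y_of_eq a b h]

/-! ### Bounding the queries at Diffie-Hellman secrets -/

section Solvers

variable {n r m : ℕ} (groups : Fin n → Finset (Fin r)) (corrupt : Finset (Fin n))

/-- The probability of correct guesses is bounded by the success probability of the solver. -/
theorem prob_guessedAsk_le (𝒮 : Scheme) (perm : Fin n → Equiv.Perm (Fin m)) (A : PPT)
    (width : Polynomial ℕ) {σ S clk b : ℕ}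
    (hlim : Limits (𝒮.params σ) (A.time σ + 1) S) (hsec : 𝒮.secLen.eval σ < S)
    (hWS : width.eval σ ≤ S) (hσ : σ ≤ S) (hp : (𝒮.grp σ).p.size ≤ b) (hbS : b ≤ S)
    (hW : 𝒮.keyLen.eval σ + 𝒮.secLen.eval σ + 𝒮.hashLen.eval σ + b + (A.time σ + 1) +
      (A.time σ + 1) * Fintype.card (Kind n r m) + 1 ≤ width.eval σ)
    (hclk : (preludeProg groups corrupt perm 𝒮.keyLen 𝒮.secLen 𝒮.hashLen (A.clock + 1) width).bound S
      + (2 * A.time σ + 1) * simBound n r m corrupt S A.prog + S + 20 +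
      ((A.time σ + 1) * Fintype.card (Kind n r m) * width.eval σ + A.time σ) ≤ clk) :
    prob ((Fin (A.time σ) → Bool) × Pool (𝒮.params σ) n r m (A.time σ))
        (fun a => GuessedAsk groups corrupt A.prog σ perm a.1 a.2) ≤
      2 * prob (DHSample (𝒮.grp σ) clk) fun ω =>
        ∃ res, runProg clk (solverProg 𝒮 groups corrupt perm A width) ω.2.2 noOracle ()
          (dhInput σ (𝒮.grp σ) ω.1 ω.2.1) = some res ∧
          res.1 0 0 = (𝒮.grp σ).g ^ ((ω.1 : ℕ) * (ω.2.1 : ℕ)) % (𝒮.grp σ).p := by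
  set T := A.time σ with hT
  set P := 𝒮.params σ with hP
  -- The exponents of the guessed run are independent of the guess, so a random challenge in their
  -- place does not change the distribution.
  have e1 : prob ((Fin T → Bool) × Pool P n r m T)
      (fun a => GuessedAsk groups corrupt A.prog σ perm a.1 a.2) ≤
      prob ((Fin T → Bool) × Pool P n r m T × (P.grp.Exponent × P.grp.Exponent))
      (fun a => GuessedAsk groups corrupt A.prog σ perm a.1 (embed a.2.2.1 a.2.2.2 a.2.1)) :=
    prob_prod_le fun coin => (challengeLens.prob_eq _).le
  let e : P.grp.Exponent × P.grp.Exponent × ((Fin T → Bool) × Pool P n r m T) ≃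
      (Fin T → Bool) × Pool P n r m T × (P.grp.Exponent × P.grp.Exponent) :=
    { toFun a := (a.2.2.1, a.2.2.2, (a.1, a.2.1))
      invFun a := (a.2.2.1, a.2.2.2, (a.1, a.2.1))
      left_inv _ := rfl
      right_inv _ := rfl }
  rw [← prob_equiv e] at e1
  refine e1.trans (prob_prod_le_mul fun a => prob_prod_le_mul fun b' => ?_)
  -- Values reduced from coins instead of uniform ones cost the factor `2`.
  have e2 : prob ((Fin T → Bool) × Pool P n r m T) (fun c =>
        GuessedAsk groups corrupt A.prog σ perm c.1 (embed a b' c.2)) ≤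
      2 * prob ((Fin T → Bool) × (Fin (T + 1) × Kind n r m → Fin (2 ^ width.eval σ))) (fun c =>
        GuessedAsk groups corrupt A.prog σ perm c.1 (embed a b' fun k =>
          Fin.ofNat (k.2.modulus P (T + 1)) (c.2 k))) := by
    refine prob_prod_le_mul fun coin => ?_
    have := half_prob_pool_le (P := P) (T := T) hp hW
      (fun ρ => GuessedAsk groups corrupt A.prog σ perm coin (embed a b' ρ))
    linarith
  rw [← prob_tape (T + 1) (width.eval σ) T clk (by omega)] at e2
  refine e2.trans (mul_le_mul_of_nonneg_left (prob_mono fun tape h => ?_) (by norm_num))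
  obtain ⟨res, h1, h2⟩ := solver_finds 𝒮 groups corrupt perm A width (clk := clk) hlim hsec hWS hσ
    (hp.trans hbS) ((Nat.le_add_right _ _).trans hclk) tape a b' rfl (fun _ => rfl) default h
  exact ⟨res, h1, h2.trans (congrArg Fin.val (poolDH_embed (P := P) a b' _))⟩

/-- The solver as a machine with a polynomial clock. -/
theorem exists_solver (𝒮 : Scheme) (b : Polynomial ℕ) (hb : ∀ σ, (𝒮.grp σ).p.size ≤ b.eval σ)
    (A : PPT) (perm : Fin n → Equiv.Perm (Fin m)) :
    ∃ B : PPT, ∀ σ, prob ((Fin (A.time σ) → Bool) × Pool (𝒮.params σ) n r m (A.time σ))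
        (fun a => GuessedAsk groups corrupt A.prog σ perm a.1 a.2) ≤ 2 * dhSuccess 𝒮.grp B σ := by
  set width : Polynomial ℕ := 𝒮.keyLen + 𝒮.secLen + 𝒮.hashLen + b + (A.clock + 1) +
    (A.clock + 1) * Polynomial.C (Fintype.card (Kind n r m)) + 1 with hwidth
  have hw : ∀ σ, width.eval σ = 𝒮.keyLen.eval σ + 𝒮.secLen.eval σ + 𝒮.hashLen.eval σ + b.eval σ +
      (A.time σ + 1) + (A.time σ + 1) * Fintype.card (Kind n r m) + 1 := by
    intro σ
    simp only [hwidth, PPT.time, Polynomial.eval_add, Polynomial.eval_mul, Polynomial.eval_one,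
      Polynomial.eval_C]
  obtain ⟨q₁, hq₁⟩ := (preludeProg groups corrupt perm 𝒮.keyLen 𝒮.secLen 𝒮.hashLen (A.clock + 1)
    width).bound_eq_polynomial
  obtain ⟨q₂, hq₂⟩ := simBound_eq_polynomial n r m corrupt A.prog
  refine ⟨⟨solverProg 𝒮 groups corrupt perm A width,
    q₁.comp (width + Polynomial.X) + (2 * A.clock + 1) * q₂.comp (width + Polynomial.X) +
      (width + Polynomial.X) + 20 +
      ((A.clock + 1) * Polynomial.C (Fintype.card (Kind n r m)) * width + A.clock)⟩, fun σ => ?_⟩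
  have hwσ := hw σ
  -- The width exceeds all lengths and the number of rounds, so `width + σ` serves as the common
  -- bound `S` for bit lengths and iterations.
  refine prob_guessedAsk_le groups corrupt 𝒮 perm A width (S := width.eval σ + σ) (b := b.eval σ)
    ⟨by omega, ?_, ?_, ?_, by omega⟩ (by omega) (by omega) (by omega) (hb σ) (by omega) hwσ.ge ?_
  · simp only [Scheme.params]
    omega
  · simp only [Scheme.params]
    omega
  · simp only [Scheme.params]
    omega
  · simp only [PPT.time, hq₁, hq₂, Polynomial.eval_add, Polynomial.eval_mul, Polynomial.eval_comp,
      Polynomial.eval_X, Polynomial.eval_C, Polynomial.eval_one, Polynomial.eval_ofNat]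
    exact le_rfl

/-- The eavesdropper asks for a Diffie-Hellman secret at most as often as solvers succeed. -/
theorem prob_askedDH_le (𝒮 : Scheme) (A : PPT) (σ : ℕ) :
    prob (ExpSample 𝒮 n r m A σ) (Sample.AskedDH groups corrupt A.prog σ) ≤
      ∑ perm : Fin n → Equiv.Perm (Fin m), ((A.time σ : ℝ) + 1) ^ 2 *
        prob ((Fin (A.time σ) → Bool) × Pool (𝒮.params σ) n r m (A.time σ))
          (fun a => GuessedAsk groups corrupt A.prog σ perm a.1 a.2) := by
  set T := A.time σ with hT
  set P := 𝒮.params σ with hP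
  rw [← (sampleLens (P := P) (n := n) (r := r) (m := m) (T := T)).prob_get, prob_prod]
  -- The average over the permutations is bounded by the sum. Nothing essential is lost, because
  -- their number does not depend on `σ`.
  have hcard : (1 : ℝ) ≤ Fintype.card (Fin n → Equiv.Perm (Fin m)) := by
    exact_mod_cast Fintype.card_pos
  refine div_le_of_le_mul₀ (by positivity)
    (Finset.sum_nonneg fun _ _ => mul_nonneg (by positivity) (prob_nonneg _)) ?_
  refine le_trans (Finset.sum_le_sum fun perm _ => ?_) (le_mul_of_one_le_right
    (Finset.sum_nonneg fun _ _ => mul_nonneg (by positivity) (prob_nonneg _)) hcard)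
  refine prob_prod_le_mul fun coin => le_trans (prob_prod_le fun ρ => ?_)
    (prob_lazyAsked_le groups corrupt A.prog σ perm coin)
  exact prob_asked_le_prob_lazyAsked groups corrupt A.prog σ perm coin ρ

/-- Asking for a Diffie-Hellman secret has negligible probability. -/
theorem negligible_prob_askedDH {θ : ℕ → ℝ} (𝒮 : Scheme)
    (hsize : ∃ b : Polynomial ℕ, ∀ σ, (𝒮.grp σ).p.size ≤ b.eval σ) (hDH : DHAssumption θ 𝒮.grp)
    (A : PPT) : Negligible θ fun σ =>
      prob (ExpSample 𝒮 n r m A σ) (Sample.AskedDH groups corrupt A.prog σ) := by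
  obtain ⟨b, hb⟩ := hsize
  choose B hB using fun perm : Fin n → Equiv.Perm (Fin m) =>
    exists_solver (r := r) groups corrupt 𝒮 b hb A perm
  have hneg : Negligible θ fun σ => ∑ perm : Fin n → Equiv.Perm (Fin m),
      (((((A.clock + 1) ^ 2).eval σ : ℕ) : ℝ) * (2 * dhSuccess 𝒮.grp (B perm) σ)) :=
    -- The solver that does nothing only serves to show that the zero function is negligible.
    Negligible.sum _ (hDH ⟨.skip, 0⟩).zero fun perm _ => ((hDH (B perm)).const_mul 2).poly_mul _
  refine hneg.of_le fun σ => ?_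
  rw [abs_of_nonneg (prob_nonneg _)]
  refine (prob_askedDH_le groups corrupt 𝒮 A σ).trans (Finset.sum_le_sum fun perm _ => ?_)
  have hT : (((A.clock + 1) ^ 2).eval σ : ℕ) = (A.time σ + 1) ^ 2 := by simp [PPT.time]
  rw [hT]
  push_cast
  exact mul_le_mul_of_nonneg_left (hB perm σ) (by positivity)

/-- The Diffie-Hellman secret is `1` with negligible probability. -/
theorem negligible_trivialDH {θ : ℕ → ℝ} {D : ℕ → DHGroup} (hDH : DHAssumption θ D) :
    Negligible θ fun σ => trivialDH (D σ) := by
  -- The solver that always answers `1`: its only command costs `1 + 1 + 2 = 4`, well within the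
  -- constant clock.
  refine (hDH ⟨.store 0 (.lit 0) (.lit 1), 10⟩).of_le fun σ => ?_
  rw [abs_of_nonneg (show 0 ≤ trivialDH (D σ) from prob_nonneg _)]
  set T := PPT.time ⟨.store 0 (.lit 0) (.lit 1), 10⟩ σ with hT
  have hT10 : T = 10 := by simp [hT, PPT.time]
  unfold trivialDH
  rw [← prob_fst (V := Fin T → Bool), ← prob_equiv (Equiv.prodAssoc _ _ _).symm]
  refine prob_mono fun ω hω => ⟨((dhInput σ (D σ) ω.1 ω.2.1).write 0 0 1, ()), ?_, ?_⟩
  · refine runProg_of_iterate (N := 1) (k := 0) (t := 4) ?_ (by omega)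
    simp [step, ATerm.eval, ATerm.cost]
  · exact (Memory.write_self (dhInput σ (D σ) ω.1 ω.2.1) 0 0 1).trans hω.symm

end Solvers

/-! ### Security of the handshake -/

theorem exists_runProg_iff {S : Type} {T : ℕ} {p : Prog} {coin : Fin T → Bool} {O : Oracle S} {s : S}
    {M : Memory} {Q : Memory × S → Prop} {c : Config S}
    (hc : (stepT T (extendTape coin) O)^[T] ⟨[p], M, 0, s, 0⟩ = c) :
    (∃ res, runProg T p coin O s M = some res ∧ Q res) ↔
      (c.todo.isEmpty ∧ c.spent ≤ T) ∧ Q (c.mem, c.state) := by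
  rw [runProg_eq_stepT]
  simp only [hc]
  split_ifs with h
  · simp [h]
  · constructor
    · rintro ⟨_, h1, _⟩
      cases h1
    · exact fun h1 => absurd h1.1 h

section Security

variable {n r m : ℕ} {groups groups' : Fin n → Finset (Fin r)} {corrupt : Finset (Fin n)}
  {θ : ℕ → ℝ} {𝒮 : Scheme} {A : PPT}

theorem negligible_prob_compromised
    (hsize : ∃ b : Polynomial ℕ, ∀ σ, (𝒮.grp σ).p.size ≤ b.eval σ)
    (hkey : Negligible θ fun σ => 1 / 2 ^ 𝒮.keyLen.eval σ)
    (hsec : Negligible θ fun σ => 1 / 2 ^ 𝒮.secLen.eval σ) (hDH : DHAssumption θ 𝒮.grp) :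
    Negligible θ fun σ =>
      prob (ExpSample 𝒮 n r m A σ) (Sample.Compromised groups corrupt A.prog σ) := by
  have h1 := negligible_prob_askedDH (m := m) groups corrupt 𝒮 hsize hDH A
  have h2 := (hkey.poly_mul (A.clock + 1)).poly_mul A.clock
  have h3 := ((negligible_trivialDH hDH).add hkey).poly_mul (A.clock ^ 2)
  have h4 := hsec.const_mul (((r : ℝ) + n * m) ^ 2)
  refine (h1.add (h2.add (h3.add h4))).of_le fun σ => ?_
  rw [abs_of_nonneg (prob_nonneg _)]
  refine (prob_compromised_le groups corrupt A.prog σ).trans (le_of_eq ?_)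
  simp only [Polynomial.eval_add, Polynomial.eval_one, Polynomial.eval_pow, Nat.cast_add,
    Nat.cast_one, Nat.cast_pow]
  rfl

/-- An output `1` at the end of a run. -/
def Accepts (T : ℕ) (c : Config (List (Fin n × Fin n))) : Prop :=
  (c.todo.isEmpty ∧ c.spent ≤ T) ∧ c.mem 0 0 = 1

theorem realAccept_eq (σ : ℕ) : realAccept 𝒮 m groups corrupt A σ =
    prob (ExpSample 𝒮 n r m A σ) fun ω =>
      Accepts (A.time σ) (ω.realFin groups corrupt A.prog σ) :=
  prob_congr fun _ => exists_runProg_iff (Q := fun res => res.1 0 0 = 1) rfl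

theorem idealAccept_eq (σ : ℕ) : idealAccept 𝒮 m groups corrupt A σ =
    prob (ExpSample 𝒮 n r m A σ) fun ω =>
      Accepts (A.time σ) (ω.idealFin groups corrupt A.prog σ) :=
  prob_congr fun ω => exists_runProg_iff (Q := fun res => res.1 0 0 = 1)
    (ω.idealAt_fst groups corrupt A.prog σ (A.time σ)).symm

/-- The one-sided comparison of the games is applied to acceptance and to its complement. -/
theorem abs_realAccept_sub_idealAccept_le (σ : ℕ) :
    |realAccept 𝒮 m groups corrupt A σ - idealAccept 𝒮 m groups corrupt A σ| ≤
      prob (ExpSample 𝒮 n r m A σ) (Sample.Compromised groups corrupt A.prog σ) := by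
  rw [realAccept_eq, idealAccept_eq]
  have h1 := prob_ideal_le groups corrupt A.prog σ (P := 𝒮.params σ) (m := m) (T := A.time σ)
    (E := fun _ c => Accepts (A.time σ) c) fun _ _ _ h => h
  have h2 := prob_ideal_le groups corrupt A.prog σ (P := 𝒮.params σ) (m := m) (T := A.time σ)
    (E := fun _ c => ¬ Accepts (A.time σ) c) fun _ _ _ h => h
  rw [prob_not, prob_not] at h2
  rw [abs_le]
  constructor <;> linarith

theorem Sample.knowledge_congr {P : Params} {T : ℕ} (ω : Sample P n r m T) (σ : ℕ)
    (h : ∀ l ∈ corrupt, groups l = groups' l) :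
    ω.knowledge σ groups corrupt = ω.knowledge σ groups' corrupt := by
  funext a i
  match a with
  | 0 => rfl
  | 1 => rfl
  | l + 2 =>
    simp only [Sample.knowledge]
    split_ifs with h1 h2
    · simp only [Sample.array, h _ h2]
    · rfl
    · rfl

/-- In the idealised game the memberships enter only through the arrays of corrupt nodes. -/
theorem idealAccept_congr (h : ∀ l ∈ corrupt, groups l = groups' l) (σ : ℕ) :
    idealAccept 𝒮 m groups corrupt A σ = idealAccept 𝒮 m groups' corrupt A σ := by
  refine prob_congr fun ω => ?_
  simp only [idealExp, ω.knowledge_congr σ h]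

/-- Which run is named, and between whom it took place, does not matter: outputting any session key
is already a compromise up to the transfer between the games. -/
theorem keySuccess_le (σ : ℕ) (i j : Fin n) : keySuccess 𝒮 m groups corrupt A σ i j ≤
    prob (ExpSample 𝒮 n r m A σ) (Sample.Compromised groups corrupt A.prog σ) := by
  refine le_trans (prob_mono fun ω h => ?_) (prob_output_key_le groups corrupt A.prog σ)
  obtain ⟨-, t, -, -, hk⟩ := (exists_runProg_iff (Q := fun res => ∃ t : Fin (A.time σ),
    res.1 0 0 = t ∧ (res.2[(t : ℕ)]? = some (i, j) ∨ res.2[(t : ℕ)]? = some (j, i)) ∧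
      (res.1 0 1 = ω.keyA t ∨ res.1 0 1 = ω.keyB t)) rfl).1 h
  refine ⟨t, ?_⟩
  rw [ω.keyB_eq, ← ω.keyA_eq, or_self] at hk
  exact hk

end Security

end PrivateHandshake

open PrivateHandshake in
theorem mainTheorem4
    -- the scale of negligibility, and a scheme whose moduli have polynomial length
    (θ : ℕ → ℝ) (𝒮 : Scheme)
    (hsize : ∃ b : Polynomial ℕ, ∀ σ, (𝒮.grp σ).p.size ≤ b.eval σ)
    -- session keys and group secrets can only be guessed with negligible probability
    (hkey : Negligible θ fun σ => 1 / 2 ^ 𝒮.keyLen.eval σ)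
    (hsec : Negligible θ fun σ => 1 / 2 ^ 𝒮.secLen.eval σ)
    -- the Diffie-Hellman assumption
    (hDH : DHAssumption θ 𝒮.grp)
    -- a system of `n` nodes and `r` groups, each node being in at most `m` of them
    (n r m : ℕ) (groups : Fin n → Finset (Fin r)) (hm : ∀ l, (groups l).card ≤ m)
    -- the corrupt nodes, two honest nodes, and a group
    (corrupt : Finset (Fin n)) (i j : Fin n) (hi : i ∉ corrupt) (hj : j ∉ corrupt)
    (G : Fin r) (hG : (insert G (groups i)).card ≤ m)
    -- the eavesdropper
    (A : PPT) :
    -- the session key of a run between `i` and `j` is unknown to the eavesdropper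
    Negligible θ (fun σ => keySuccess 𝒮 m groups corrupt A σ i j) ∧
    -- the keyed hashes look random
    Negligible θ (fun σ =>
      realAccept 𝒮 m groups corrupt A σ - idealAccept 𝒮 m groups corrupt A σ) ∧
    -- the runs do not reveal whether `i` is in `G`
    Negligible θ (fun σ =>
      realAccept 𝒮 m (Function.update groups i (insert G (groups i))) corrupt A σ -
        realAccept 𝒮 m (Function.update groups i ((groups i).erase G)) corrupt A σ) := by
  have hcomp : ∀ groups : Fin n → Finset (Fin r), Negligible θ fun σ =>
      prob (ExpSample 𝒮 n r m A σ) (Sample.Compromised groups corrupt A.prog σ) :=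
    fun _ => negligible_prob_compromised hsize hkey hsec hDH
  have hreal : ∀ groups : Fin n → Finset (Fin r), Negligible θ fun σ =>
      realAccept 𝒮 m groups corrupt A σ - idealAccept 𝒮 m groups corrupt A σ :=
    fun groups => (hcomp groups).of_le abs_realAccept_sub_idealAccept_le
  refine ⟨(hcomp groups).of_le fun σ => ?_, hreal groups, ?_⟩
  · rw [abs_of_nonneg (show 0 ≤ keySuccess 𝒮 m groups corrupt A σ i j from prob_nonneg _)]
    exact keySuccess_le σ i j
  -- Both real probabilities are compared with the same idealised one, since the honest node `i` is
  -- the only one whose groups change.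
  · have h := (hreal (Function.update groups i (insert G (groups i)))).add
      ((hreal (Function.update groups i ((groups i).erase G))).const_mul (-1))
    have hcongr : ∀ σ, idealAccept 𝒮 m (Function.update groups i (insert G (groups i))) corrupt A σ =
        idealAccept 𝒮 m (Function.update groups i ((groups i).erase G)) corrupt A σ := by
      refine idealAccept_congr fun l hl => ?_
      have hli : l ≠ i := fun h => hi (h ▸ hl)
      rw [Function.update_of_ne hli, Function.update_of_ne hli]
    convert h using 2 with σ
    rw [hcongr σ]
    ring
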